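/- **Setting.** Fix $\beta\in\mathbb R$ and let $\Omega=\{0,1\}^{\mathbb Z}$, $\Lambda_n=\{x\in\mathbb Z:|x|\le n\}$. For $\lambda\in\mathbb R$ let $\nu^{\lambda}$ be the (unique) nearest-neighbour Ising measure with tilt $\lambda$, i.e. the probability measure on $\Omega$ with $$\nu^\lambda\big(\eta=e\text{ on }\Lambda_n\,\big|\,\eta=\xi\text{ off }\Lambda_n\big)=\frac1{\mathcal Z(n,\xi)}\exp\Big\{-Q_{\beta,n}(e,\xi)+\lambda\sum_{x\in\Lambda_n}\big(e(x)-\tfrac12\big)\Big\}\qquad(n\ge 0),$$ $$-Q_{\beta,n}(e,\xi)=\beta\sum_{x,x+1\in\Lambda_n}\!\!\big(e(x)-\tfrac12\big)\big(e(x+1)-\tfrac12\big)+\beta\big(\xi(-n-1)-\tfrac12\big)\big(e(-n)-\tfrac12\big)+\beta\big(e(n)-\tfrac12\big)\big(\xi(n+1)-\tfrac12\big).$$ Put $\nu_{1/2}=\nu^{0}$. For $z\in(0,1)$ let $\lambda(z)$ be the tilt with $E_{\nu^{\lambda(z)}}[\eta(0)]=z$, and $\nu_z=\nu^{\lambda(z)}$.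 For a local function $f:\Omega\to\mathbb R$ put $\varphi_f(z)=E_{\nu_z}[f]$ and, with $\bar f=f-E_{\nu_z}[f]$, $$\varphi_f'(z)=\lambda'(z)\,E_{\nu_z}\Big[\bar f\sum_{x\in\mathbb Z}(\eta(x)-z)\Big],$$ $$\varphi_f''(z)=\lambda'(z)^2\,E_{\nu_z}\Big[\bar f\Big(\sum_{x\in\mathbb Z}(\eta(x)-z)\Big)^2\Big]+\lambda''(z)\,E_{\nu_z}\Big[\bar f\sum_{x\in\mathbb Z}(\eta(x)-z)\Big],$$ the infinite sums being understood as limits of the expectations with sums over $\Lambda_m$, $m\to\infty$. Let $\eta^{(n)}=\frac1{2n+1}\sum_{x\in\Lambda_n}\eta(x)$, $y=\eta^{(n)}-\frac12$, $\sigma_n^2=E_{\nu_{1/2}}\big[\big(\frac1{\sqrt{2n+1}}\sum_{x\in\Lambda_n}(\eta(x)-\frac12)\big)^2\big]$, and let $\eta_n^c=\{\eta(x):x\notin\Lambda_n\}$. **Proposition 5.2 (Markov_EE).** Let $0<\varepsilon<1$ and $\ell\ge 0$. There is a constant $C$, depending only on $\varepsilon$, $\beta$ and $\ell$, such that the following hold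 for every $f:\Omega\to\mathbb R$ depending only on $\{\eta(x):x\in\Lambda_\ell\}$. 1. If $\varphi_f(1/2)=\varphi_f'(1/2)=0$, then for all $a,b\in\{0,1\}$ and $n\ge1$, $$\Big\|E_{\nu_{1/2}}\big[f\,\big|\,y,\eta(-n-1)=a,\eta(n+1)=b\big]-\frac{\varphi_f''(1/2)}2\Big[y^2-\frac{\sigma_n^2}{2n+1}\Big]\Big\|_{L^4(\nu_{1/2})}\le\frac{C\|f\|_{L^\infty}}{n^{3/2-\varepsilon}}.$$ 2. If only $\varphi_f(1/2)=0$, then for all $a,b\in\{0,1\}$ and $n\ge1$, $$\Big\|E_{\nu_{1/2}}\big[f\,\big|\,y,\eta(-n-1)=a,\eta(n+1)=b\big]-y\,\varphi_f'(1/2)\Big\|_{L^4(\nu_{1/2})}\le\frac{C\|f\|_{L^\infty}}{n^{1-\varepsilon}}.$$ 3. Consequently the equivalence of ensembles condition (EE) holds with $\alpha_0=1-\varepsilon$: for all $n\ge\max(\ell,1)$, $$\Big\|E_{\nu_{1/2}}\big[f\,\big|\,\eta^{(n)},\eta_n^c\big]-\frac{\varphi_f''(1/2)}2\Big[y^2-\frac{\sigma_n^2}{2n+1}\Big]\Big\|_{L^4(\nu_{1/2})}\le\frac{C\|f\|_{L^5(\nu_{1/2})}}{n^{1+\alpha_0/2}}\quad\text{if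 }\varphi_f(1/2)=\varphi'_f(1/2)=0,$$ $$\Big\|E_{\nu_{1/2}}\big[f\,\big|\,\eta^{(n)},\eta_n^c\big]-\varphi_f'(1/2)\,y\Big\|_{L^4(\nu_{1/2})}\le\frac{C\|f\|_{L^5(\nu_{1/2})}}{n^{1/2+\alpha_0/2}}\quad\text{if only }\varphi_f(1/2)=0.$$ -/

import Mathlib

open MeasureTheory ProbabilityTheory Filter
open scoped Topology ENNReal

namespace SpeedChange

/-- Particle configurations `η ∈ {0,1}^ℤ` (`true` = occupied), with the product topology and
σ-algebra. -/
abbrev Config : Type := ℤ → Bool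

/-- The occupation number `η(x) ∈ {0,1}` as a real number. -/
def occ (η : Config) (x : ℤ) : ℝ := if η x then 1 else 0

/-- The box `Λ_n = {x ∈ ℤ : |x| ≤ n}`. -/
noncomputable def box (n : ℕ) : Finset ℤ := Finset.Icc (-(n : ℤ)) n

/-- The Hamiltonian `Q_{β,n}(e, ξ)` of `e` on `Λ_n` with boundary condition `ξ` outside `Λ_n`
(nearest-neighbour interaction `-β (η(x) - 1/2)(η(x+1) - 1/2)`). -/
noncomputable def energy (β : ℝ) (n : ℕ) (e ξ : Config) : ℝ :=
  -β * (∑ x ∈ Finset.Ico (-(n : ℤ)) n, (occ e x - 1 / 2) * (occ e (x + 1) - 1 / 2))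
    - β * (occ ξ (-(n : ℤ) - 1) - 1 / 2) * (occ e (-(n : ℤ)) - 1 / 2)
    - β * (occ e n - 1 / 2) * (occ ξ (n + 1) - 1 / 2)

/-- Boltzmann weight on `Λ_n`, with the tilt `exp(lam * ∑_{x ∈ Λ_n} (e(x) - 1/2))`. -/
noncomputable def boltzmann (β lam : ℝ) (n : ℕ) (e ξ : Config) : ℝ :=
  Real.exp (-energy β n e ξ) * Real.exp (lam * ∑ x ∈ box n, (occ e x - 1 / 2))

/-- The configuration whose set of occupied sites is `A`. -/
def indicatorConfig (A : Finset ℤ) : Config := fun x => decide (x ∈ A)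

/-- The normalization: sum of the weights over all configurations on `Λ_n` (a configuration on
`Λ_n` is given by its set of occupied sites). -/
noncomputable def partitionFn (β lam : ℝ) (n : ℕ) (ξ : Config) : ℝ :=
  ∑ A ∈ (box n).powerset, boltzmann β lam n (indicatorConfig A) ξ

/-- The finite-volume conditional probability of seeing `e` on `Λ_n` given `ξ` outside `Λ_n`. -/
noncomputable def localSpec (β lam : ℝ) (n : ℕ) (e ξ : Config) : ℝ :=
  boltzmann β lam n e ξ / partitionFn β lam n ξ

/-- The σ-algebra generated by the outside variables `{η(x) : x ∉ Λ_n}`. -/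
@[reducible] def outsideAlg (n : ℕ) : MeasurableSpace Config :=
  ⨆ x ∈ ((box n : Finset ℤ) : Set ℤ)ᶜ, MeasurableSpace.comap (fun η : Config => η x) ⊤

/-- `ν` is the Ising measure with coupling `β` and tilt `lam`: a probability measure with
`ν(η = e on Λ_n | η(y), y ∉ Λ_n) = localSpec β lam n e η` a.s. for all `n` and `e`.
(In one dimension there is exactly one such measure.) -/
def IsIsing (β lam : ℝ) (ν : Measure Config) : Prop :=
  IsProbabilityMeasure ν ∧ ∀ (n : ℕ) (e : Config),
    ν[Set.indicator {η : Config | ∀ x ∈ box n, η x = e x} (fun _ => (1 : ℝ)) | outsideAlg n]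
      =ᵐ[ν] localSpec β lam n e

lemma mem_box {n : ℕ} {x : ℤ} : x ∈ box n ↔ -(n : ℤ) ≤ x ∧ x ≤ n := by simp [box]

lemma boltzmann_pos (β lam : ℝ) (n : ℕ) (e ξ : Config) : 0 < boltzmann β lam n e ξ := by
  unfold boltzmann; positivity

lemma partitionFn_pos (β lam : ℝ) (n : ℕ) (ξ : Config) : 0 < partitionFn β lam n ξ :=
  Finset.sum_pos (fun _ _ => boltzmann_pos ..) ⟨∅, by simp⟩

lemma boltzmann_congr (β lam : ℝ) (n : ℕ) {e e' ξ ξ' : Config}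
    (h : ∀ x ∈ box n, e x = e' x) (h' : ∀ x, x ∉ box n → ξ x = ξ' x) :
    boltzmann β lam n e ξ = boltzmann β lam n e' ξ' := by
  have H : ∀ x ∈ box n, occ e x = occ e' x := fun x hx => by simp [occ, h x hx]
  have H' : ∀ x, x ∉ box n → occ ξ x = occ ξ' x := fun x hx => by simp [occ, h' x hx]
  unfold boltzmann energy
  rw [H' (-(n : ℤ) - 1) (by simp [mem_box]), H' (n + 1) (by simp [mem_box]),
    H n (by simp [mem_box]), H (-n) (by simp [mem_box]),
    Finset.sum_congr rfl (fun x hx => by rw [H x hx] : ∀ x ∈ box n, occ e x - 1 / 2 = occ e' x - 1 / 2),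
    Finset.sum_congr rfl (fun x hx => by
      rw [Finset.mem_Ico] at hx
      rw [H x (by rw [mem_box]; omega), H (x + 1) (by rw [mem_box]; omega)] :
        ∀ x ∈ Finset.Ico (-(n : ℤ)) n, (occ e x - 1 / 2) * (occ e (x + 1) - 1 / 2)
          = (occ e' x - 1 / 2) * (occ e' (x + 1) - 1 / 2))]

lemma partitionFn_congr (β lam : ℝ) (n : ℕ) {ξ ξ' : Config}
    (h' : ∀ x, x ∉ box n → ξ x = ξ' x) : partitionFn β lam n ξ = partitionFn β lam n ξ' :=
  Finset.sum_congr rfl fun _ _ => boltzmann_congr _ _ _ (fun _ _ => rfl) h'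

lemma boltzmann_ratio (β lam : ℝ) {n N : ℕ} (hn : n < N) {η η' ξ : Config}
    (h : ∀ x, x ∉ box n → η x = η' x) :
    boltzmann β lam N η ξ * boltzmann β lam n η' η' =
      boltzmann β lam N η' ξ * boltzmann β lam n η η := by
  have H : ∀ x, x ∉ box n → occ η x = occ η' x := fun x hx => by simp [occ, h x hx]
  unfold boltzmann energy
  rw [← Real.exp_add, ← Real.exp_add, ← Real.exp_add, ← Real.exp_add, ← Real.exp_add,
    ← Real.exp_add]
  congr 1
  have e1 : ∑ x ∈ box N, ((occ η x - 1 / 2) - (occ η' x - 1 / 2))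
      = ∑ x ∈ box n, ((occ η x - 1 / 2) - (occ η' x - 1 / 2)) := by
    symm
    apply Finset.sum_subset
    · intro x; simp only [mem_box]; omega
    · intro x _ hx; rw [H x hx]; ring
  have e2 : ∑ x ∈ Finset.Ico (-(N : ℤ)) N, ((occ η x - 1 / 2) * (occ η (x + 1) - 1 / 2)
        - (occ η' x - 1 / 2) * (occ η' (x + 1) - 1 / 2))
      = ∑ x ∈ insert (-(n : ℤ) - 1) (insert (n : ℤ) (Finset.Ico (-(n : ℤ)) n)),
        ((occ η x - 1 / 2) * (occ η (x + 1) - 1 / 2)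
        - (occ η' x - 1 / 2) * (occ η' (x + 1) - 1 / 2)) := by
    symm
    apply Finset.sum_subset
    · intro x; simp only [Finset.mem_insert, Finset.mem_Ico]; omega
    · intro x _ hx
      simp only [Finset.mem_insert, Finset.mem_Ico] at hx
      rw [H x (by rw [mem_box]; omega), H (x + 1) (by rw [mem_box]; omega)]; ring
  rw [Finset.sum_insert (by simp), Finset.sum_insert (by simp)] at e2
  simp only [Finset.sum_sub_distrib] at e1 e2
  rw [H (-(N : ℤ)) (by rw [mem_box]; omega), H N (by rw [mem_box]; omega)]
  rw [H (-(n : ℤ) - 1) (by rw [mem_box]; omega), H ((n : ℤ) + 1) (by rw [mem_box]; omega)] at *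
  rw [show -(n : ℤ) - 1 + 1 = -n by ring] at e2
  simp only [Finset.sum_sub_distrib]
  linear_combination lam * e1 + β * e2

lemma finite_volume_identity (β lam : ℝ) {n N : ℕ} (hn : n < N) (e ξ : Config)
    (g : Config → ℝ) (hg : ∀ η η' : Config, (∀ x, x ∉ box n → η x = η' x) → g η = g η') :
    ∑ A ∈ (box N).powerset, boltzmann β lam N (indicatorConfig A) ξ *
      (if ∀ x ∈ box n, indicatorConfig A x = e x then g (indicatorConfig A) else 0) =
    ∑ A ∈ (box N).powerset, boltzmann β lam N (indicatorConfig A) ξ *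
      (g (indicatorConfig A) * localSpec β lam n e (indicatorConfig A)) := by
  classical
  have hsub : box n ⊆ box N := by intro x; simp only [mem_box]; omega
  set E : Finset ℤ := (box n).filter (fun x => e x = true) with hE
  have hEe : ∀ B : Finset ℤ, ∀ x ∈ box n, indicatorConfig ((B \ box n) ∪ E) x = e x := by
    intro B x hx
    simp [indicatorConfig, hE, hx]
  have hout : ∀ (B C D : Finset ℤ), C ⊆ box n → D ⊆ box n → ∀ x, x ∉ box n →
      indicatorConfig ((B \ box n) ∪ C) x = indicatorConfig ((B \ box n) ∪ D) x := by
    intro B C D hC hD x hx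
    have h1 : x ∉ C := fun h => hx (hC h)
    have h2 : x ∉ D := fun h => hx (hD h)
    simp [indicatorConfig, hx, h1, h2]
  have hin : ∀ (B C : Finset ℤ), C ⊆ box n → ∀ x, x ∈ box n →
      indicatorConfig ((B \ box n) ∪ C) x = indicatorConfig C x := by
    intro B C hC x hx
    simp [indicatorConfig, hx]
  have hEs : E ⊆ box n := Finset.filter_subset _ _
  -- split a configuration in the large box into its parts outside and inside the small box
  have split : ∀ F : Finset ℤ → ℝ, ∑ A ∈ (box N).powerset, F A =
      ∑ B ∈ (box N \ box n).powerset, ∑ C ∈ (box n).powerset, F ((B \ box n) ∪ C) := by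
    intro F
    rw [← Finset.sum_product']
    refine Finset.sum_bij' (fun A _ => (A \ box n, A ∩ box n)) (fun p _ => (p.1 \ box n) ∪ p.2)
      ?_ ?_ ?_ ?_ ?_
    · intro A hA
      simp only [Finset.mem_powerset, Finset.mem_product] at hA ⊢
      exact ⟨Finset.sdiff_subset_sdiff hA le_rfl, Finset.inter_subset_right⟩
    · intro p hp
      simp only [Finset.mem_powerset, Finset.mem_product] at hp ⊢
      intro x hx
      have h1 := @hp.1 x
      have h2 := @hp.2 x
      have h3 := @hsub x
      simp only [Finset.mem_union, Finset.mem_sdiff] at hx h1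
      tauto
    · intro A _
      ext x; simp only [Finset.mem_union, Finset.mem_sdiff, Finset.mem_inter]; tauto
    · intro p hp
      simp only [Finset.mem_powerset, Finset.mem_product] at hp
      ext x
      · have h1 := @hp.1 x
        have h2 := @hp.2 x
        simp only [Finset.mem_union, Finset.mem_sdiff] at h1 ⊢; tauto
      · have h1 := @hp.1 x
        have h2 := @hp.2 x
        simp only [Finset.mem_union, Finset.mem_sdiff, Finset.mem_inter] at h1 ⊢; tauto
    · intro A _
      congr 1
      ext x; simp only [Finset.mem_union, Finset.mem_sdiff, Finset.mem_inter]; tauto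
  rw [split, split]
  refine Finset.sum_congr rfl fun B hB => ?_
  set ζ : Config := indicatorConfig ((B \ box n) ∪ E) with hζ
  have L : ∑ C ∈ (box n).powerset, boltzmann β lam N (indicatorConfig ((B \ box n) ∪ C)) ξ *
      (if ∀ x ∈ box n, indicatorConfig ((B \ box n) ∪ C) x = e x
        then g (indicatorConfig ((B \ box n) ∪ C)) else 0) = boltzmann β lam N ζ ξ * g ζ := by
    rw [Finset.sum_eq_single E]
    · rw [if_pos (hEe B)]
    · intro C hC hCE
      rw [if_neg, mul_zero]
      intro h
      apply hCE
      rw [Finset.mem_powerset] at hC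
      ext x
      by_cases hx : x ∈ box n
      · have := (hin B C hC x hx).symm.trans (h x hx)
        simp only [hE, Finset.mem_filter, hx, true_and, ← this, indicatorConfig, decide_eq_true_eq]
      · exact ⟨fun h => absurd (hC h) hx, fun h => absurd (hEs h) hx⟩
    · intro h; exact absurd (Finset.mem_powerset.2 hEs) h
  rw [L]
  have R : ∀ C ∈ (box n).powerset, boltzmann β lam N (indicatorConfig ((B \ box n) ∪ C)) ξ *
      (g (indicatorConfig ((B \ box n) ∪ C)) *
        localSpec β lam n e (indicatorConfig ((B \ box n) ∪ C))) =
      boltzmann β lam N ζ ξ * g ζ / partitionFn β lam n ζ *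
        boltzmann β lam n (indicatorConfig C) ζ := by
    intro C hC
    rw [Finset.mem_powerset] at hC
    have ho := hout B C E hC hEs
    have r := boltzmann_ratio β lam hn (ξ := ξ) ho
    rw [hg _ _ ho, localSpec, partitionFn_congr β lam n ho, ← hζ]
    rw [← hζ] at r
    have e1 : boltzmann β lam n e (indicatorConfig ((B \ box n) ∪ C)) = boltzmann β lam n ζ ζ :=
      boltzmann_congr _ _ _ (fun x hx => (hEe B x hx).symm) ho
    have e2 : boltzmann β lam n (indicatorConfig C) ζ =
        boltzmann β lam n (indicatorConfig ((B \ box n) ∪ C)) (indicatorConfig ((B \ box n) ∪ C)) :=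
      boltzmann_congr _ _ _ (fun x hx => (hin B C hC x hx).symm) (fun x hx => (ho x hx).symm)
    rw [e1, e2]
    have := (partitionFn_pos β lam n ζ).ne'
    field_simp
    linear_combination g ζ * r
  rw [Finset.sum_congr rfl R, ← Finset.mul_sum]
  have := (partitionFn_pos β lam n ζ).ne'
  change _ = _ * partitionFn β lam n ζ
  field_simp


/-- The finite-volume measure on `Λ_N` with empty boundary condition. -/
noncomputable def finiteVolume (β lam : ℝ) (N : ℕ) : Measure Config :=
  ∑ A ∈ (box N).powerset,
    ENNReal.ofReal (localSpec β lam N (indicatorConfig A) (indicatorConfig ∅)) •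
      Measure.dirac (indicatorConfig A)

lemma localSpec_nonneg (β lam : ℝ) (n : ℕ) (e ξ : Config) : 0 ≤ localSpec β lam n e ξ :=
  div_nonneg (boltzmann_pos ..).le (partitionFn_pos ..).le

lemma integral_finiteVolume (β lam : ℝ) (N : ℕ) (g : Config → ℝ) (hg : Measurable g) :
    ∫ η, g η ∂finiteVolume β lam N = ∑ A ∈ (box N).powerset,
      localSpec β lam N (indicatorConfig A) (indicatorConfig ∅) * g (indicatorConfig A) := by
  unfold finiteVolume
  rw [integral_finsetSum_measure]
  · refine Finset.sum_congr rfl fun A _ => ?_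
    rw [integral_smul_measure, integral_dirac' _ _ hg.stronglyMeasurable,
      ENNReal.toReal_ofReal (localSpec_nonneg ..), smul_eq_mul]
  · intro A _
    exact (integrable_dirac' hg.stronglyMeasurable (by finiteness)).smul_measure (by finiteness)

instance (β lam : ℝ) (N : ℕ) : IsProbabilityMeasure (finiteVolume β lam N) := by
  constructor
  unfold finiteVolume
  simp only [Measure.finsetSum_apply, Measure.smul_apply, measure_univ, smul_eq_mul, mul_one]
  rw [← ENNReal.ofReal_sum_of_nonneg fun _ _ => localSpec_nonneg ..]
  unfold localSpec
  rw [← Finset.sum_div]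
  change ENNReal.ofReal (partitionFn β lam N _ / _) = 1
  rw [div_self (partitionFn_pos ..).ne', ENNReal.ofReal_one]

lemma continuous_occ (x : ℤ) : Continuous fun η : Config => occ η x := by
  have : Continuous fun b : Bool => (if b then (1 : ℝ) else 0) := continuous_of_discreteTopology
  exact this.comp (continuous_apply x)

lemma continuous_localSpec (β lam : ℝ) (n : ℕ) (e : Config) :
    Continuous (localSpec β lam n e) := by
  have hb : ∀ e, Continuous (boltzmann β lam n e) := fun e => by
    have h1 := continuous_occ (-(n : ℤ) - 1)
    have h2 := continuous_occ ((n : ℤ) + 1)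
    unfold boltzmann energy
    fun_prop
  exact (hb e).div (continuous_finsetSum _ fun A _ => hb _) fun ξ => (partitionFn_pos ..).ne'

lemma outsideAlg_le (n : ℕ) : outsideAlg n ≤ (inferInstance : MeasurableSpace Config) :=
  iSup₂_le fun x _ => (measurable_pi_apply x).comap_le

lemma measurable_occ_outside (n : ℕ) {x : ℤ} (hx : x ∉ box n) :
    Measurable[outsideAlg n] fun η : Config => occ η x := by
  have h1 : Measurable[outsideAlg n, ⊤] fun η : Config => η x := by
    apply Measurable.mono (comap_measurable _) _ le_rfl
    exact le_iSup₂_of_le x (by simpa using hx) le_rfl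
  have h2 : @Measurable _ _ ⊤ _ fun b : Bool => (if b then (1 : ℝ) else 0) := fun _ _ => trivial
  exact h2.comp h1

lemma measurable_localSpec (β lam : ℝ) (n : ℕ) (e : Config) :
    Measurable[outsideAlg n] (localSpec β lam n e) := by
  have hb : ∀ e, Measurable[outsideAlg n] (boltzmann β lam n e) := fun e => by
    have h1 := measurable_occ_outside n (x := -(n : ℤ) - 1) (by simp [mem_box])
    have h2 := measurable_occ_outside n (x := (n : ℤ) + 1) (by simp [mem_box])
    unfold boltzmann energy
    fun_prop
  have hp : Measurable[outsideAlg n] (partitionFn β lam n) := by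
    unfold partitionFn
    exact Finset.measurable_fun_sum _ fun A _ => hb _
  exact (hb e).div hp

lemma isClopen_preimage (x : ℤ) (s : Set Bool) : IsClopen ((fun η : Config => η x) ⁻¹' s) :=
  (isClopen_discrete s).preimage (continuous_apply x)

/-- Existence of the Ising measure, as a limit of finite-volume measures. -/
theorem exists_isIsing (β lam : ℝ) : ∃ ν : Measure Config, IsIsing β lam ν := by
  classical
  let P : ℕ → ProbabilityMeasure Config := fun N => ⟨finiteVolume β lam N, inferInstance⟩
  obtain ⟨ν, -, hν⟩ := isCompact_univ.ultrafilter_le_nhds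
    (Ultrafilter.map P (hyperfilter ℕ)) (by simp)
  have hlim : Tendsto P (hyperfilter ℕ) (𝓝 ν) := hν
  rw [ProbabilityMeasure.tendsto_iff_forall_integral_tendsto] at hlim
  have hlim' : ∀ g : Config → ℝ, Continuous g →
      Tendsto (fun N => ∫ η, g η ∂finiteVolume β lam N) (hyperfilter ℕ)
        (𝓝 (∫ η, g η ∂(ν : Measure Config))) := fun g hg =>
    hlim (BoundedContinuousFunction.mkOfCompact ⟨g, hg⟩)
  refine ⟨ν, inferInstance, fun n e => ?_⟩
  set S : Set Config := {η | ∀ x ∈ box n, η x = e x} with hS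
  have hSc : IsClopen S := by
    have : S = ⋂ x ∈ box n, (fun η : Config => η x) ⁻¹' {e x} := by ext; simp [hS]
    rw [this]
    exact isClopen_biInter_finset fun x _ => isClopen_preimage x _
  -- the identity on finite intersections of outside coordinate events
  have key : ∀ B : Set Config, IsClopen B →
      (∀ η η' : Config, (∀ x, x ∉ box n → η x = η' x) → (η ∈ B ↔ η' ∈ B)) →
      ∫ η, B.indicator (S.indicator fun _ => (1 : ℝ)) η ∂(ν : Measure Config) =
        ∫ η, B.indicator (localSpec β lam n e) η ∂(ν : Measure Config) := by
    intro B hB hBo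
    have c1 : Continuous (B.indicator (S.indicator fun _ => (1 : ℝ))) :=
      (continuous_const.indicator fun a ha => by simp [hSc.frontier_eq] at ha).indicator
        fun a ha => by simp [hB.frontier_eq] at ha
    have c2 : Continuous (B.indicator (localSpec β lam n e)) :=
      (continuous_localSpec ..).indicator fun a ha => by simp [hB.frontier_eq] at ha
    refine tendsto_nhds_unique (hlim' _ c1) ((hlim' _ c2).congr' ?_)
    have hev : ∀ᶠ N in (hyperfilter ℕ : Filter ℕ), n < N :=
      Nat.hyperfilter_le_atTop (eventually_gt_atTop n)
    filter_upwards [hev] with N hN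
    rw [integral_finiteVolume _ _ _ _ c1.measurable, integral_finiteVolume _ _ _ _ c2.measurable]
    have := finite_volume_identity β lam hN e (indicatorConfig ∅) (B.indicator fun _ => (1 : ℝ))
      (fun η η' h => by simp [Set.indicator, hBo η η' h])
    have hZ := (partitionFn_pos β lam N (indicatorConfig ∅)).ne'
    unfold localSpec at this ⊢
    simp only [div_mul_eq_mul_div]
    rw [← Finset.sum_div, ← Finset.sum_div]
    congr 1
    symm
    convert this using 2 with A _ A _
    · congr 1
      by_cases h1 : indicatorConfig A ∈ S <;> by_cases h2 : indicatorConfig A ∈ B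
      all_goals
        have h1' : (∀ x ∈ box n, indicatorConfig A x = e x) ↔ indicatorConfig A ∈ S := Iff.rfl
        rw [if_congr h1' rfl rfl]
        simp [h1, h2]
    · congr 1
      by_cases h2 : indicatorConfig A ∈ B <;> simp [h2]
  symm
  have hloc : Integrable (localSpec β lam n e) (ν : Measure Config) :=
    (BoundedContinuousFunction.mkOfCompact ⟨_, continuous_localSpec β lam n e⟩).integrable _
  have hind : Integrable (S.indicator fun _ => (1 : ℝ)) (ν : Measure Config) :=
    (integrable_const 1).indicator hSc.isOpen.measurableSet
  refine ae_eq_condExp_of_forall_setIntegral_eq (outsideAlg_le n) hind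
    (fun _ _ _ => hloc.integrableOn) ?_ (measurable_localSpec ..).aestronglyMeasurable
  intro s hs _
  refine MeasurableSpace.induction_on_inter (m := outsideAlg n)
    (C := fun s _ => ∫ x in s, localSpec β lam n e x ∂(ν : Measure Config) =
      ∫ x in s, S.indicator (fun _ => (1 : ℝ)) x ∂(ν : Measure Config))
    (generateFrom_piiUnionInter_measurableSet _ _).symm
    (isPiSystem_piiUnionInter _ (fun x => @MeasurableSpace.isPiSystem_measurableSet _
      (MeasurableSpace.comap (fun η : Config => η x) ⊤)) _) ?_ ?_ ?_ ?_ s hs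
  · simp
  · rintro t ⟨F, hF, f, hf, rfl⟩
    choose! g _ hg using hf
    have hB : IsClopen (⋂ x ∈ F, f x) := isClopen_biInter_finset fun x hx => by
      rw [← hg x hx]; exact isClopen_preimage x _
    rw [← integral_indicator hB.isOpen.measurableSet, ← integral_indicator hB.isOpen.measurableSet]
    refine (key _ hB fun η η' h => ?_).symm
    simp only [Set.mem_iInter]
    refine forall₂_congr fun x hx => ?_
    rw [← hg x hx, Set.mem_preimage, Set.mem_preimage, h x (by simpa using hF hx)]
  · intro t ht h
    have ht' := outsideAlg_le n t ht
    have hu := key Set.univ isClopen_univ (by simp)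
    simp only [Set.indicator_univ] at hu
    rw [setIntegral_compl ht' hloc, setIntegral_compl ht' hind, h, hu]
  · intro f hd hm h
    have hm' := fun i => outsideAlg_le n _ (hm i)
    rw [integral_iUnion hm' hd hloc.integrableOn, integral_iUnion hm' hd hind.integrableOn]
    simp only [h]

/-- The Ising measure `ν^lam` on `{0,1}^ℤ` with coupling `β` and tilt `lam`. For `lam = 0` this is
the measure `ν_{1/2}`. -/
noncomputable def ising (β lam : ℝ) : Measure Config := Classical.choose (exists_isIsing β lam)

lemma ising_isIsing (β lam : ℝ) : IsIsing β lam (ising β lam) :=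
  Classical.choose_spec (exists_isIsing β lam)

instance (β lam : ℝ) : IsProbabilityMeasure (ising β lam) := (ising_isIsing β lam).1

/-- The particle density of the tilted measure, `E_{ν^lam}[η(0)]`. -/
noncomputable def density (β lam : ℝ) : ℝ := ∫ η, occ η 0 ∂ising β lam

/-- The tilt `λ(z)` at which the density is `z`, for `z ∈ (0,1)` (the density is a strictly
increasing bijection of `ℝ` onto `(0,1)`). -/
noncomputable def tilt (β z : ℝ) : ℝ := Function.invFun (density β) z

/-- `ν_z`, the tilted measure of density `z`. -/
noncomputable def nu (β z : ℝ) : Measure Config := ising β (tilt β z)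

/-- `φ_f(z) = E_{ν_z}[f]`. -/
noncomputable def phi (β : ℝ) (f : Config → ℝ) (z : ℝ) : ℝ := ∫ η, f η ∂nu β z

/-- `E_{ν_z}[(f - E_{ν_z} f) (∑_{x ∈ ℤ} (η(x) - z))^i]`, as the limit of the sums over `Λ_m`. -/
noncomputable def centeredMoment (β : ℝ) (f : Config → ℝ) (i : ℕ) (z : ℝ) : ℝ :=
  limUnder atTop fun m : ℕ =>
    ∫ η, (f η - phi β f z) * (∑ x ∈ box m, (occ η x - z)) ^ i ∂nu β z

/-- `φ_f'(z) = λ'(z) E_{ν_z}[(f - E_{ν_z} f) ∑_x (η(x) - z)]`. -/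
noncomputable def phi' (β : ℝ) (f : Config → ℝ) (z : ℝ) : ℝ :=
  deriv (tilt β) z * centeredMoment β f 1 z

/-- `φ_f''(z) = λ'(z)² E_{ν_z}[(f - E_{ν_z} f) (∑_x (η(x) - z))²]
  + λ''(z) E_{ν_z}[(f - E_{ν_z} f) ∑_x (η(x) - z)]`. -/
noncomputable def phi'' (β : ℝ) (f : Config → ℝ) (z : ℝ) : ℝ :=
  deriv (tilt β) z ^ 2 * centeredMoment β f 2 z
    + deriv (deriv (tilt β)) z * centeredMoment β f 1 z

/-- The block density `η^{(n)} = (2n+1)⁻¹ ∑_{x ∈ Λ_n} η(x)`. -/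
noncomputable def blockDensity (n : ℕ) (η : Config) : ℝ :=
  (∑ x ∈ box n, occ η x) / (2 * (n : ℝ) + 1)

/-- The variance `σ_n²(1/2) = E_{ν_{1/2}}[((2n+1)^{-1/2} ∑_{x ∈ Λ_n} (η(x) - 1/2))²]`. -/
noncomputable def blockVariance (β : ℝ) (n : ℕ) : ℝ :=
  ∫ η, ((∑ x ∈ box n, (occ η x - 1 / 2)) / Real.sqrt (2 * (n : ℝ) + 1)) ^ 2 ∂ising β 0

/-- `E_{ν_{1/2}}[f | y, η(-n-1) = a, η(n+1) = b]`, where `y` is the value of `η^{(n)} - 1/2`: the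
elementary conditional expectation given an event (of positive probability if the value `y` is
attained). -/
noncomputable def blockCondExp (β : ℝ) (f : Config → ℝ) (n : ℕ) (a b : Bool) (y : ℝ) : ℝ :=
  ∫ η, f η ∂ProbabilityTheory.cond (ising β 0)
    {η | blockDensity n η - 1 / 2 = y ∧ η (-(n : ℤ) - 1) = a ∧ η ((n : ℤ) + 1) = b}

/-- The σ-algebra generated by the block density `η^{(n)}` and the outside variables. -/
@[reducible] noncomputable def blockAlg (n : ℕ) : MeasurableSpace Config :=
  MeasurableSpace.comap (blockDensity n) inferInstance ⊔ outsideAlg n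

/-- The equivalence of ensembles estimate (EE) for `ν_{1/2}` with exponent `α₀`. -/
def EquivalenceOfEnsembles (β α₀ : ℝ) : Prop :=
  ∀ l₀ : ℕ, ∃ C : ℝ, ∀ f : Config → ℝ, DependsOn f (box l₀ : Set ℤ) →
    phi β f (1 / 2) = 0 → ∀ n : ℕ, 1 ≤ n → l₀ ≤ n →
      (phi' β f (1 / 2) = 0 →
        eLpNorm (fun η => ((ising β 0)[f | blockAlg n]) η - phi'' β f (1 / 2) / 2 *
            ((blockDensity n η - 1 / 2) ^ 2 - blockVariance β n / (2 * (n : ℝ) + 1))) 4 (ising β 0)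
          ≤ ENNReal.ofReal (C / (n : ℝ) ^ (1 + α₀ / 2)) * eLpNorm f 5 (ising β 0)) ∧
      eLpNorm (fun η => ((ising β 0)[f | blockAlg n]) η
            - phi' β f (1 / 2) * (blockDensity n η - 1 / 2)) 4 (ising β 0)
          ≤ ENNReal.ofReal (C / (n : ℝ) ^ (1 / 2 + α₀ / 2)) * eLpNorm f 5 (ising β 0)

end SpeedChange

/-!
The conditional expectation of `f` given the total spin of `Λ_n` and the two adjacent boundary
values is computed by Fourier inversion at a saddle point.

*Generating functions.* By the DLR equations the conditional expectation is the ratio `levelMean`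
of two sums over configurations on `Λ_n` with a prescribed total spin `S`
(`blockCondExp_eq_levelMean` for the elementary conditional expectation, `condExp_blockAlg_ae_eq`
for the one given the outside of the block). Both sums are Fourier coefficients of a generating
function `genFn β n f w` with complex tilt `w`, which is a product of `2 × 2` transfer matrices.
Near `w = 0` the leading eigenvalue dominates, so that `genFn β n f w` equals `G(w)` times `genFn
β n 1 w`, up to an error that is exponentially small compared with `genFn β n 1 0`
(`eventually_norm_genFn_sub_le`), where `G = tilted β l f` is analytic at zero. At real tilts `G`
is the expectation of `f` under the tilted Ising measure (`ofReal_integral_eq_tilted`).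

*Saddle point.* With `N = 2n + 1`, the partition function is close to the Gaussian `exp(Nτw²/2)`,
where `τ = susc β`, times its value at zero. It is exponentially small compared with this value
when the real part of `w` is small and the imaginary part is bounded away from `2πℤ`. Integrating
along the vertical line through `x = S/(Nτ)` and expanding `G` at zero gives
(`exists_levelMean_sub_le`, `exists_profileMoment_sub_le`)

`levelMean = G(0) + G'(0) x + G''(0)/2 (x² - 1/(Nτ)) + error`,

where the error terms are `O(ε²)` at first order and `O(ε³)` at second order, with `ε` of order
`N^{-1/2+δ}` as long as `|S| ≤ N^{1/2+δ}` for a small `δ`. Writing a local function as a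
combination of finitely many indicators makes the error proportional to the supremum norm of `f`
(`exists_levelMean_sub_le_mul`).

*Identification of the coefficients.* The closed form of the density as a function of the tilt
(`density_eq`) gives `λ'(1/2) = 1/τ`. The centered moments defining `φ_f'` and `φ_f''` are
derivatives of `G` at zero, by Cauchy estimates for the finite-volume generating functions
(`centeredMoment_half`). Hence `φ_f(1/2) = G(0)`, `φ_f'(1/2) = G'(0)/τ` and, if these two vanish,
`φ_f''(1/2) = G''(0)/τ²` (`phi_half`, `phi'_half`, `phi''_half`). As `y = S/N = τx` and the
variance `σ_n²` is `τ` up to `O(N^{-1/2})` (`eventually_abs_blockVariance_sub_le`), the expansion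
takes the required form.

*Norms.* On the event `|S| > N^{1/2+δ}`, which has superpolynomially small probability
(`exists_measureReal_blockSum_ge_le`), all the quantities are bounded by a multiple of the supremum
norm of `f`. Together with the pointwise estimate this gives the `L⁴` bounds
(`exists_eLpNorm_sub_le`). The bounds in terms of the `L⁵` norm follow because a local function
takes finitely many values, each on an event of positive probability (`exists_abs_le_mul_eLpNorm`),
and because the exponents `3/2 - ε/2` and `1 - ε/2` obtained from `ε/2` are precisely
`1 + (1 - ε)/2` and `1/2 + (1 - ε)/2`.
-/


namespace SpeedChange

/-! ### Generating functions and the transfer matrix -/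

/-- The spin `±1/2` of an occupation variable. -/
noncomputable def spin (b : Bool) : ℝ := if b then 1 / 2 else -1 / 2

lemma occ_sub_half (η : Config) (x : ℤ) : occ η x - 1 / 2 = spin (η x) := by
  unfold occ spin; split_ifs <;> norm_num

/-- A configuration equal to `a` on the left half-line and to `b` on the right one; it serves as
the boundary condition with `η(-n-1) = a` and `η(n+1) = b` for every `n`. -/
def bdry (a b : Bool) : Config := fun x => if x < 0 then a else b

/-- The total spin `∑_{x ∈ Λ_n} (η(x) - 1/2)` of the block. -/
noncomputable def blockSum (n : ℕ) (η : Config) : ℝ := ∑ x ∈ box n, (occ η x - 1 / 2)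

/-- The generating function `∑_e f(e) exp(-Q_{β,n}(e, ξ)) exp(w ∑_{x ∈ Λ_n} (e(x) - 1/2))` over
configurations `e` on `Λ_n`, as a matrix indexed by the two boundary values of `ξ`. -/
noncomputable def genFn (β : ℝ) (n : ℕ) (f : Config → ℝ) (w : ℂ) : Matrix Bool Bool ℂ :=
  fun a b => ∑ A ∈ (box n).powerset,
    ((f (indicatorConfig A) * Real.exp (-energy β n (indicatorConfig A) (bdry a b)) : ℝ) : ℂ) *
      Complex.exp (w * blockSum n (indicatorConfig A))

/-- The interaction matrix `exp(β s s')` of two neighbouring spins. -/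
noncomputable def edgeMatrix (β : ℝ) : Matrix Bool Bool ℂ :=
  fun a c => (Real.exp (β * spin a * spin c) : ℂ)

/-- The transfer matrix `exp(β s s' + w s')`. -/
noncomputable def transfer (β : ℝ) (w : ℂ) : Matrix Bool Bool ℂ :=
  fun a c => (Real.exp (β * spin a * spin c) : ℂ) * Complex.exp (w * spin c)

lemma box_succ (n : ℕ) :
    box (n + 1) = insert (-(n : ℤ) - 1) (insert ((n : ℤ) + 1) (box n)) := by
  ext x; simp only [mem_box, Finset.mem_insert]; push_cast; omega

lemma box_mono {m n : ℕ} (h : m ≤ n) : box m ⊆ box n := by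
  intro x; simp only [mem_box]; omega

lemma left_notMem_box (n : ℕ) : -(n : ℤ) - 1 ∉ box n := by simp [mem_box]

lemma right_notMem_box (n : ℕ) : (n : ℤ) + 1 ∉ box n := by simp [mem_box]

lemma left_notMem_insert (n : ℕ) : -(n : ℤ) - 1 ∉ insert ((n : ℤ) + 1) (box n) := by
  simp only [mem_box, Finset.mem_insert]; omega

lemma blockSum_congr {n : ℕ} {η ξ : Config} (h : ∀ x ∈ box n, η x = ξ x) :
    blockSum n η = blockSum n ξ :=
  Finset.sum_congr rfl fun x hx => by rw [occ_sub_half, occ_sub_half, h x hx]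

lemma blockSum_succ (n : ℕ) (η : Config) :
    blockSum (n + 1) η = spin (η (-(n : ℤ) - 1)) + spin (η ((n : ℤ) + 1)) + blockSum n η := by
  unfold blockSum
  rw [box_succ, Finset.sum_insert (left_notMem_insert n), Finset.sum_insert (right_notMem_box n),
    occ_sub_half, occ_sub_half]
  ring

lemma energy_congr (β : ℝ) {n : ℕ} {e e' ξ ξ' : Config} (h : ∀ x ∈ box n, e x = e' x)
    (h1 : ξ (-(n : ℤ) - 1) = ξ' (-(n : ℤ) - 1)) (h2 : ξ ((n : ℤ) + 1) = ξ' ((n : ℤ) + 1)) :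
    energy β n e ξ = energy β n e' ξ' := by
  unfold energy
  simp only [occ_sub_half]
  rw [h1, h2, h n (by simp [mem_box]), h (-n) (by simp [mem_box])]
  congr 3
  refine Finset.sum_congr rfl fun x hx => ?_
  rw [Finset.mem_Ico] at hx
  rw [h x (by rw [mem_box]; omega), h (x + 1) (by rw [mem_box]; omega)]

/-- The energy of a block splits off its two outermost sites. -/
lemma energy_succ (β : ℝ) (n : ℕ) (e ξ : Config) :
    -energy β (n + 1) e ξ = -energy β n e e
      + β * spin (ξ (-(n : ℤ) - 2)) * spin (e (-(n : ℤ) - 1))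
      + β * spin (ξ ((n : ℤ) + 2)) * spin (e ((n : ℤ) + 1)) := by
  unfold energy
  have : Finset.Ico (-((n + 1 : ℕ) : ℤ)) ((n + 1 : ℕ) : ℤ) =
      insert (-(n : ℤ) - 1) (insert (n : ℤ) (Finset.Ico (-(n : ℤ)) n)) := by
    ext x; simp only [Finset.mem_Ico, Finset.mem_insert]; push_cast; omega
  rw [this, Finset.sum_insert (by simp), Finset.sum_insert (by simp)]
  simp only [occ_sub_half]
  push_cast
  rw [show -(n : ℤ) - 1 + 1 = -n by ring, show -((n : ℤ) + 1) - 1 = -(n : ℤ) - 2 by ring,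
    show (n : ℤ) + 1 + 1 = n + 2 by ring, show -((n : ℤ) + 1) = -(n : ℤ) - 1 by ring]
  ring

lemma indicatorConfig_insert_of_ne (A : Finset ℤ) {x y : ℤ} (h : x ≠ y) :
    indicatorConfig (insert y A) x = indicatorConfig A x := by
  simp [indicatorConfig, h]

lemma indicatorConfig_insert_self (A : Finset ℤ) (y : ℤ) :
    indicatorConfig (insert y A) y = true := by
  simp [indicatorConfig]

lemma indicatorConfig_of_notMem {A : Finset ℤ} {y : ℤ} (h : y ∉ A) :
    indicatorConfig A y = false := by
  simp [indicatorConfig, h]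

/-- A term of the generating function on `Λ_{n+1}` in terms of its restriction to `Λ_n`. -/
lemma genFn_term_succ (β : ℝ) (n : ℕ) {f : Config → ℝ} (hf : DependsOn f (box n : Set ℤ)) (w : ℂ)
    (a b c d : Bool) {η e : Config} (hη : ∀ x ∈ box n, η x = e x)
    (hc : η (-(n : ℤ) - 1) = c) (hd : η ((n : ℤ) + 1) = d) :
    ((f η * Real.exp (-energy β (n + 1) η (bdry a b)) : ℝ) : ℂ) *
        Complex.exp (w * blockSum (n + 1) η) =
      transfer β w a c * (((f e * Real.exp (-energy β n e (bdry c d)) : ℝ) : ℂ) *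
        Complex.exp (w * blockSum n e)) * transfer β w b d := by
  have h0 : f η = f e := hf fun x hx => hη x hx
  have h1 : energy β n η η = energy β n e (bdry c d) :=
    energy_congr β hη (by rw [hc]; simp only [bdry]; rw [if_pos (by omega)])
      (by rw [hd]; simp only [bdry]; rw [if_neg (by omega)])
  rw [energy_succ, blockSum_succ, blockSum_congr hη, hc, hd, h0, h1]
  have h2 : bdry a b (-(n : ℤ) - 2) = a := by simp only [bdry]; rw [if_pos (by omega)]
  have h3 : bdry a b ((n : ℤ) + 2) = b := by simp only [bdry]; rw [if_neg (by omega)]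
  rw [h2, h3]
  simp only [transfer]
  push_cast
  rw [mul_add, mul_add, Complex.exp_add, Complex.exp_add, Complex.exp_add, Complex.exp_add]
  ring

lemma genFn_succ (β : ℝ) (n : ℕ) {f : Config → ℝ} (hf : DependsOn f (box n : Set ℤ)) (w : ℂ) :
    genFn β (n + 1) f w = transfer β w * genFn β n f w * (transfer β w).transpose := by
  ext a b
  simp only [Matrix.mul_apply, Fintype.sum_bool, Matrix.transpose_apply]
  unfold genFn
  rw [box_succ, Finset.sum_powerset_insert (left_notMem_insert n),
    Finset.sum_powerset_insert (right_notMem_box n),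
    Finset.sum_powerset_insert (right_notMem_box n)]
  simp only [add_mul, Finset.mul_sum, Finset.sum_mul, ← Finset.sum_add_distrib]
  refine Finset.sum_congr rfl fun A hA => ?_
  have hA' : A ⊆ box n := Finset.mem_powerset.1 hA
  have hl : -(n : ℤ) - 1 ∉ A := fun h => left_notMem_box n (hA' h)
  have hr : (n : ℤ) + 1 ∉ A := fun h => right_notMem_box n (hA' h)
  have hlr : -(n : ℤ) - 1 ≠ (n : ℤ) + 1 := by omega
  have hxl : ∀ x ∈ box n, x ≠ -(n : ℤ) - 1 := fun x hx h => left_notMem_box n (h ▸ hx)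
  have hxr : ∀ x ∈ box n, x ≠ (n : ℤ) + 1 := fun x hx h => right_notMem_box n (h ▸ hx)
  rw [genFn_term_succ β n hf w a b false false (η := indicatorConfig A) (e := indicatorConfig A)
      (fun _ _ => rfl) (indicatorConfig_of_notMem hl) (indicatorConfig_of_notMem hr),
    genFn_term_succ β n hf w a b false true (η := indicatorConfig (insert ((n : ℤ) + 1) A))
      (e := indicatorConfig A) (fun x hx => indicatorConfig_insert_of_ne A (hxr x hx))
      ((indicatorConfig_insert_of_ne A hlr).trans (indicatorConfig_of_notMem hl))
      (indicatorConfig_insert_self A _),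
    genFn_term_succ β n hf w a b true false (η := indicatorConfig (insert (-(n : ℤ) - 1) A))
      (e := indicatorConfig A) (fun x hx => indicatorConfig_insert_of_ne A (hxl x hx))
      (indicatorConfig_insert_self A _)
      ((indicatorConfig_insert_of_ne A hlr.symm).trans (indicatorConfig_of_notMem hr)),
    genFn_term_succ β n hf w a b true true
      (η := indicatorConfig (insert (-(n : ℤ) - 1) (insert ((n : ℤ) + 1) A)))
      (e := indicatorConfig A) (fun x hx => (indicatorConfig_insert_of_ne _ (hxl x hx)).trans
        (indicatorConfig_insert_of_ne A (hxr x hx)))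
      (indicatorConfig_insert_self _ _)
      ((indicatorConfig_insert_of_ne _ hlr.symm).trans (indicatorConfig_insert_self A _))]
  ring

lemma DependsOn.mono_box {f : Config → ℝ} {l n : ℕ} (hf : DependsOn f (box l : Set ℤ))
    (h : l ≤ n) : DependsOn f (box n : Set ℤ) :=
  fun _ _ hxy => hf fun x hx => hxy x (box_mono h hx)

/-- Summing out the spins outside `Λ_l` multiplies by transfer matrices on both sides. -/
lemma genFn_add (β : ℝ) (l m : ℕ) {f : Config → ℝ} (hf : DependsOn f (box l : Set ℤ)) (w : ℂ) :
    genFn β (l + m) f w = transfer β w ^ m * genFn β l f w * (transfer β w ^ m).transpose := by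
  induction m with
  | zero => simp
  | succ m ih =>
    rw [← add_assoc, genFn_succ β _ (DependsOn.mono_box hf (Nat.le_add_right l m)), ih, pow_succ',
      Matrix.transpose_mul]
    simp only [Matrix.mul_assoc]

lemma edgeMatrix_mul_transfer_transpose (β : ℝ) (w : ℂ) :
    edgeMatrix β * (transfer β w).transpose = transfer β w * edgeMatrix β := by
  ext a b
  simp only [Matrix.mul_apply, Matrix.transpose_apply, edgeMatrix, transfer]
  refine Finset.sum_congr rfl fun c _ => ?_
  rw [mul_right_comm β (spin b) (spin c)]
  ring

lemma genFn_zero_one (β : ℝ) (w : ℂ) :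
    genFn β 0 (fun _ => 1) w = transfer β w * edgeMatrix β := by
  ext a b
  have hb : box 0 = {0} := by ext x; simp only [mem_box, Finset.mem_singleton]; omega
  have hp : (box 0).powerset = {∅, {0}} := by rw [hb]; rfl
  simp only [genFn, hp, Matrix.mul_apply, Fintype.sum_bool]
  rw [Finset.sum_pair (by simp)]
  simp only [energy, blockSum, hb, occ_sub_half, indicatorConfig, transfer, edgeMatrix, bdry]
  simp only [spin]
  simp [Complex.exp_add]
  ring

/-- The partition function on `Λ_n` is a power of the transfer matrix. -/
lemma genFn_one (β : ℝ) (n : ℕ) (w : ℂ) :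
    genFn β n (fun _ => 1) w = transfer β w ^ (2 * n + 1) * edgeMatrix β := by
  have h := genFn_add β 0 n (f := fun _ => 1) (fun _ _ _ => rfl) w
  rw [zero_add] at h
  rw [h, genFn_zero_one]
  have : ∀ m, edgeMatrix β * (transfer β w ^ m).transpose = transfer β w ^ m * edgeMatrix β := by
    intro m
    induction m with
    | zero => simp
    | succ m ih =>
      rw [pow_succ, Matrix.transpose_mul, ← Matrix.mul_assoc, edgeMatrix_mul_transfer_transpose,
        Matrix.mul_assoc, ih, ← Matrix.mul_assoc, ← pow_succ', pow_succ]
  rw [Matrix.mul_assoc, Matrix.mul_assoc, this, ← Matrix.mul_assoc, ← Matrix.mul_assoc,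
    ← pow_succ, ← pow_add]
  congr 2; ring

end SpeedChange

namespace SpeedChange

/-! ### Spectral decomposition of the transfer matrix -/

/-- The weight `exp(β/4)` of a bond between equal spins. -/
noncomputable def bondEq (β : ℝ) : ℝ := Real.exp (β / 4)

/-- The weight `exp(-β/4)` of a bond between opposite spins. -/
noncomputable def bondNe (β : ℝ) : ℝ := Real.exp (-(β / 4))

lemma bondEq_pos (β : ℝ) : 0 < bondEq β := Real.exp_pos _

lemma bondNe_pos (β : ℝ) : 0 < bondNe β := Real.exp_pos _

/-- Half the difference of the two eigenvalues of the transfer matrix. The square root is the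
principal one, which is positive at real tilts and analytic near zero. -/
noncomputable def gap (β : ℝ) (w : ℂ) : ℂ :=
  ((bondEq β * Complex.sinh (w / 2)) ^ 2 + (bondNe β : ℂ) ^ 2) ^ (((2 : ℕ) : ℂ)⁻¹)

/-- The leading eigenvalue of the transfer matrix. -/
noncomputable def muPlus (β : ℝ) (w : ℂ) : ℂ := bondEq β * Complex.cosh (w / 2) + gap β w

/-- The subleading eigenvalue of the transfer matrix. -/
noncomputable def muMinus (β : ℝ) (w : ℂ) : ℂ := bondEq β * Complex.cosh (w / 2) - gap β w

lemma gap_sq (β : ℝ) (w : ℂ) :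
    gap β w ^ 2 = (bondEq β * Complex.sinh (w / 2)) ^ 2 + (bondNe β : ℂ) ^ 2 :=
  Complex.cpow_nat_inv_pow _ two_ne_zero

lemma gap_ofReal (β x : ℝ) :
    gap β x = (√((bondEq β * Real.sinh (x / 2)) ^ 2 + bondNe β ^ 2) : ℝ) := by
  unfold gap
  rw [Real.sqrt_eq_rpow, Complex.ofReal_cpow (by positivity)]
  push_cast
  norm_num

lemma gap_zero (β : ℝ) : gap β 0 = bondNe β := by
  have := gap_ofReal β 0
  simpa [Real.sqrt_sq (bondNe_pos β).le] using this

lemma analyticAt_gap (β : ℝ) : AnalyticAt ℂ (gap β) 0 := by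
  unfold gap
  refine AnalyticAt.cpow (by fun_prop) (by fun_prop) ?_
  have := bondNe_pos β
  left
  simp only [zero_div, Complex.sinh_zero, mul_zero]
  rw [show (0 : ℂ) ^ 2 + (bondNe β : ℂ) ^ 2 = ((bondNe β ^ 2 : ℝ) : ℂ) by push_cast; ring,
    Complex.ofReal_re]
  positivity

lemma continuousAt_gap (β : ℝ) : ContinuousAt (gap β) 0 := (analyticAt_gap β).continuousAt

lemma edgeMatrix_apply (β : ℝ) (a c : Bool) :
    edgeMatrix β a c = if a = c then (bondEq β : ℂ) else bondNe β := by
  unfold edgeMatrix spin bondEq bondNe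
  cases a <;> cases c <;> simp <;> congr 1 <;> ring

lemma transfer_apply (β : ℝ) (w : ℂ) (a c : Bool) :
    transfer β w a c = (if a = c then (bondEq β : ℂ) else bondNe β) *
      if c then Complex.exp (w / 2) else Complex.exp (-(w / 2)) := by
  have h := edgeMatrix_apply β a c
  unfold edgeMatrix at h
  unfold transfer
  rw [h]
  have h1 : w * (2 : ℂ)⁻¹ = w / 2 := by ring
  have h2 : w * (-1 / 2 : ℂ) = -(w / 2) := by ring
  cases c <;> simp [spin, h1, h2]

lemma exp_half_mul (w : ℂ) : Complex.exp (w / 2) * Complex.exp (-(w / 2)) = 1 := by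
  rw [← Complex.exp_add]; simp

/-- The spectral projection onto the leading eigenspace. -/
noncomputable def projPlus (β : ℝ) (w : ℂ) : Matrix Bool Bool ℂ :=
  (2 * gap β w)⁻¹ • (transfer β w - muMinus β w • 1)

/-- The spectral projection onto the subleading eigenspace. -/
noncomputable def projMinus (β : ℝ) (w : ℂ) : Matrix Bool Bool ℂ :=
  (2 * gap β w)⁻¹ • (muPlus β w • 1 - transfer β w)

/-- Cayley–Hamilton for the transfer matrix. -/
lemma transfer_sub_mul_transfer_sub (β : ℝ) (w : ℂ) :
    (transfer β w - muPlus β w • 1) * (transfer β w - muMinus β w • 1) = 0 := by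
  have h1 := gap_sq β w
  have h2 := exp_half_mul w
  have h3 : Complex.exp (w / 2) + Complex.exp (-(w / 2)) = 2 * Complex.cosh (w / 2) :=
    (Complex.two_cosh _).symm
  have h4 := Complex.cosh_sq (w / 2)
  ext a b
  simp only [Matrix.mul_apply, Fintype.sum_bool, Matrix.sub_apply, Matrix.smul_apply,
    transfer_apply, muPlus, muMinus, Matrix.zero_apply, Matrix.one_apply, smul_eq_mul]
  generalize Complex.exp (w / 2) = z at *
  generalize Complex.exp (-(w / 2)) = y at *
  generalize gap β w = g at *
  generalize Complex.cosh (w / 2) = ch at *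
  generalize Complex.sinh (w / 2) = sh at *
  obtain rfl : y = 2 * ch - z := by linear_combination h3
  cases a <;> cases b <;> simp <;> ring_nf <;> ring_nf at h1 h2 h4
  all_goals
    linear_combination (-1 : ℂ) * h1 + (-(bondEq β : ℂ) ^ 2 + bondNe β ^ 2) * h2 +
      (bondEq β : ℂ) ^ 2 * h4

lemma projPlus_add_projMinus (β : ℝ) {w : ℂ} (h : gap β w ≠ 0) :
    projPlus β w + projMinus β w = 1 := by
  unfold projPlus projMinus
  rw [← smul_add]
  have : transfer β w - muMinus β w • 1 + (muPlus β w • 1 - transfer β w) =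
      (2 * gap β w) • (1 : Matrix Bool Bool ℂ) := by
    rw [show 2 * gap β w = muPlus β w - muMinus β w by unfold muPlus muMinus; ring, sub_smul]
    abel
  rw [this, smul_smul, inv_mul_cancel₀ (by simpa using h), one_smul]

lemma transfer_mul_projPlus (β : ℝ) (w : ℂ) :
    transfer β w * projPlus β w = muPlus β w • projPlus β w := by
  have := transfer_sub_mul_transfer_sub β w
  rw [sub_mul, sub_eq_zero] at this
  unfold projPlus
  rw [mul_smul_comm, this, smul_mul_assoc, one_mul, smul_comm]

lemma transfer_mul_projMinus (β : ℝ) (w : ℂ) :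
    transfer β w * projMinus β w = muMinus β w • projMinus β w := by
  have := transfer_sub_mul_transfer_sub β w
  have h : (transfer β w - muMinus β w • 1) * (transfer β w - muPlus β w • 1) = 0 := by
    rw [← this]
    simp only [sub_mul, mul_sub, smul_mul_assoc, mul_smul_comm, one_mul, mul_one, smul_sub,
      smul_comm (muMinus β w) (muPlus β w)]
    abel
  rw [sub_mul, sub_eq_zero] at h
  unfold projMinus
  rw [mul_smul_comm, ← neg_sub (transfer β w), mul_neg, h, smul_mul_assoc, one_mul, smul_neg,
    smul_neg, smul_neg, smul_comm]

lemma transfer_pow (β : ℝ) {w : ℂ} (h : gap β w ≠ 0) (m : ℕ) :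
    transfer β w ^ m = muPlus β w ^ m • projPlus β w + muMinus β w ^ m • projMinus β w := by
  induction m with
  | zero => simp [projPlus_add_projMinus β h]
  | succ m ih =>
    rw [pow_succ', ih, mul_add, mul_smul_comm, mul_smul_comm, transfer_mul_projPlus,
      transfer_mul_projMinus, smul_smul, smul_smul, pow_succ, pow_succ]

/-- A left eigenvector of the transfer matrix for the leading eigenvalue. -/
noncomputable def leftVec (β : ℝ) (w : ℂ) (c : Bool) : ℂ :=
  if c then bondEq β * Complex.sinh (w / 2) + gap β w else bondNe β * Complex.exp (-(w / 2))

/-- The quadratic form `ℓᵀ X ℓ` of the left eigenvector `ℓ`. -/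
noncomputable def leftForm (β : ℝ) (w : ℂ) (X : Matrix Bool Bool ℂ) : ℂ :=
  ∑ c, ∑ d, leftVec β w c * X c d * leftVec β w d

lemma exp_half_eq (w : ℂ) :
    Complex.exp (w / 2) = Complex.cosh (w / 2) + Complex.sinh (w / 2) :=
  (Complex.cosh_add_sinh _).symm

lemma exp_neg_half_eq (w : ℂ) :
    Complex.exp (-(w / 2)) = Complex.cosh (w / 2) - Complex.sinh (w / 2) :=
  (Complex.cosh_sub_sinh _).symm

/-- The leading spectral projection has rank one. -/
lemma projPlus_apply (β : ℝ) {w : ℂ} (h : leftVec β w true ≠ 0) (a c : Bool) :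
    projPlus β w a c = projPlus β w a true / leftVec β w true * leftVec β w c := by
  cases c
  swap
  · rw [div_mul_cancel₀ _ h]
  have h1 := gap_sq β w
  have h2 := exp_half_mul w
  have e1 := exp_half_eq w
  have e2 := exp_neg_half_eq w
  rw [eq_comm, div_mul_eq_mul_div, div_eq_iff h]
  simp only [projPlus, Matrix.sub_apply, Matrix.smul_apply, transfer_apply, muMinus,
    Matrix.one_apply, smul_eq_mul, leftVec]
  rw [mul_assoc, mul_assoc]
  congr 1
  have h4 := Complex.cosh_sq (w / 2)
  rw [e1, e2] at h2 ⊢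
  generalize gap β w = g at *
  generalize Complex.cosh (w / 2) = ch at *
  generalize Complex.sinh (w / 2) = sh at *
  cases a <;> simp
  · linear_combination (-1 : ℂ) * h1 + (bondNe β : ℂ) ^ 2 * h2
  · ring

/-- The two-sided leading term of `X` vanishes with the quadratic form, since the projection has
rank one. -/
lemma projPlus_mul_mul_transpose (β : ℝ) {w : ℂ} (h : leftVec β w true ≠ 0)
    {X : Matrix Bool Bool ℂ} (hX : leftForm β w X = 0) :
    projPlus β w * X * (projPlus β w).transpose = 0 := by
  ext a b
  have : (projPlus β w * X * (projPlus β w).transpose) a b =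
      projPlus β w a true / leftVec β w true * (projPlus β w b true / leftVec β w true) *
        leftForm β w X := by
    simp only [Matrix.mul_apply, Matrix.transpose_apply, leftForm, Fintype.sum_bool]
    rw [projPlus_apply β h a true, projPlus_apply β h a false, projPlus_apply β h b true,
      projPlus_apply β h b false]
    field_simp
    ring
  rw [this, hX, mul_zero, Matrix.zero_apply]

/-- The tilted expectation of `f` (which depends on `Λ_l`) at a complex tilt, as a ratio of two
analytic functions. -/
noncomputable def tilted (β : ℝ) (l : ℕ) (f : Config → ℝ) (w : ℂ) : ℂ :=
  leftForm β w (genFn β l f w) / leftForm β w (genFn β l (fun _ => 1) w)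

lemma leftForm_sub_smul (β : ℝ) (w c : ℂ) (X Y : Matrix Bool Bool ℂ) :
    leftForm β w (X - c • Y) = leftForm β w X - c * leftForm β w Y := by
  simp only [leftForm, Fintype.sum_bool, Matrix.sub_apply, Matrix.smul_apply, smul_eq_mul]
  ring

/-- The part of the generating function not carried by the leading eigenvalue on both sides. -/
lemma genFn_sub_tilted_smul (β : ℝ) (l m : ℕ) {f : Config → ℝ}
    (hf : DependsOn f (box l : Set ℤ)) {w : ℂ} (h0 : gap β w ≠ 0) (h1 : leftVec β w true ≠ 0)
    (h2 : leftForm β w (genFn β l (fun _ => 1) w) ≠ 0) :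
    genFn β (l + m) f w - tilted β l f w • genFn β (l + m) (fun _ => 1) w =
      (muPlus β w * muMinus β w) ^ m •
        (projPlus β w * (genFn β l f w - tilted β l f w • genFn β l (fun _ => 1) w) *
            (projMinus β w).transpose
          + projMinus β w * (genFn β l f w - tilted β l f w • genFn β l (fun _ => 1) w) *
            (projPlus β w).transpose)
      + (muMinus β w ^ 2) ^ m •
        (projMinus β w * (genFn β l f w - tilted β l f w • genFn β l (fun _ => 1) w) *
            (projMinus β w).transpose) := by
  rw [genFn_add β l m hf, genFn_add β l m (f := fun _ => 1) (fun _ _ _ => rfl)]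
  have hX : leftForm β w (genFn β l f w - tilted β l f w • genFn β l (fun _ => 1) w) = 0 := by
    rw [leftForm_sub_smul, tilted, div_mul_cancel₀ _ h2, sub_self]
  have hL : ∀ T X Y : Matrix Bool Bool ℂ, ∀ c : ℂ,
      T * X * T.transpose - c • (T * Y * T.transpose) = T * (X - c • Y) * T.transpose := by
    intro T X Y c
    simp only [mul_sub, sub_mul, mul_smul_comm, smul_mul_assoc]
  rw [hL]
  generalize genFn β l f w - tilted β l f w • genFn β l (fun _ => 1) w = X at *
  rw [transfer_pow β h0]
  simp only [Matrix.transpose_add, Matrix.transpose_smul, add_mul, mul_add, smul_mul_assoc,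
    mul_smul_comm, projPlus_mul_mul_transpose β h1 hX, smul_smul, smul_zero, zero_add, smul_add,
    mul_pow, ← pow_mul]
  rw [mul_comm (muMinus β w ^ m) (muPlus β w ^ m), ← pow_add, two_mul]
  abel

lemma muPlus_mul_muMinus (β : ℝ) (w : ℂ) :
    muPlus β w * muMinus β w = (bondEq β : ℂ) ^ 2 - (bondNe β : ℂ) ^ 2 := by
  have h1 := gap_sq β w
  have h4 := Complex.cosh_sq (w / 2)
  unfold muPlus muMinus
  linear_combination (-1 : ℂ) * h1 + (bondEq β : ℂ) ^ 2 * h4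

end SpeedChange

namespace SpeedChange

/-! ### Expansions near tilt zero -/

/-- The limiting variance per site `exp(β/2)/4`, which is also `1/λ'(1/2)`. -/
noncomputable def susc (β : ℝ) : ℝ := bondEq β / (4 * bondNe β)

lemma susc_pos (β : ℝ) : 0 < susc β := div_pos (bondEq_pos β) (by linarith [bondNe_pos β])

/-- The leading eigenvalue at tilt zero. -/
noncomputable def mu0 (β : ℝ) : ℝ := bondEq β + bondNe β

lemma mu0_pos (β : ℝ) : 0 < mu0 β := add_pos (bondEq_pos β) (bondNe_pos β)

lemma muMinus_zero (β : ℝ) : muMinus β 0 = bondEq β - bondNe β := by simp [muMinus, gap_zero]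

lemma leftVec_zero (β : ℝ) (c : Bool) : leftVec β 0 c = bondNe β := by
  cases c <;> simp [leftVec, gap_zero]

/-- Second-order Taylor expansion at zero. -/
lemma AnalyticAt.isBigO_taylor_two {f : ℂ → ℂ} (hf : AnalyticAt ℂ f 0) :
    (fun w => f w - (f 0 + iteratedDeriv 1 f 0 * w + iteratedDeriv 2 f 0 / 2 * w ^ 2))
      =O[𝓝 0] fun w => w ^ 3 := by
  have h := (AnalyticAt.hasFPowerSeriesAt hf).isBigO_sub_partialSum_pow 3
  simp only [FormalMultilinearSeries.partialSum, Finset.sum_range_succ,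
    FormalMultilinearSeries.ofScalars_apply_eq, Finset.sum_range_zero, zero_add] at h
  exact (h.congr_left fun w => by simp [mul_comm]).trans
    (Asymptotics.isBigO_of_le _ fun w => by simp)

lemma cosh_isBigO (c : ℂ) :
    (fun w : ℂ => Complex.cosh (c * w) - 1 - c ^ 2 / 2 * w ^ 2) =O[𝓝 0] fun w => w ^ 3 := by
  have h := AnalyticAt.isBigO_taylor_two (f := fun w : ℂ => Complex.cosh (c * w)) (by fun_prop)
  have h1 : deriv (fun w : ℂ => Complex.cosh (c * w)) = fun w => c * Complex.sinh (c * w) := by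
    ext w
    have := (((hasDerivAt_id w).const_mul c).ccosh).deriv
    simpa [mul_comm] using this
  have h2 : deriv (fun w : ℂ => c * Complex.sinh (c * w)) 0 = c ^ 2 := by
    have := ((((hasDerivAt_id (0 : ℂ)).const_mul c).csinh).const_mul c).deriv
    simpa [sq] using this
  refine h.congr_left fun w => ?_
  rw [show iteratedDeriv 2 (fun w : ℂ => Complex.cosh (c * w)) = deriv (deriv _) by
    rw [iteratedDeriv_succ, iteratedDeriv_one], iteratedDeriv_one, h1, h2]
  simp
  ring

lemma sinh_sq_isBigO :
    (fun w : ℂ => Complex.sinh (w / 2) ^ 2 - w ^ 2 / 4) =O[𝓝 0] fun w => w ^ 3 := by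
  refine ((cosh_isBigO 1).const_mul_left (1 / 2)).congr_left fun w => ?_
  have h := Complex.cosh_two_mul (w / 2)
  have h' := Complex.cosh_sq (w / 2)
  rw [show 2 * (w / 2) = 1 * w by ring] at h
  rw [h, h']; ring

lemma gap_isBigO (β : ℝ) :
    (fun w : ℂ => gap β w - (bondNe β + bondEq β ^ 2 / (8 * bondNe β) * w ^ 2)) =O[𝓝 0]
      fun w => w ^ 3 := by
  have hr : (bondNe β : ℂ) ≠ 0 := by exact_mod_cast (bondNe_pos β).ne'
  have hs0 : Tendsto (fun w => gap β w + bondNe β) (𝓝 0) (𝓝 (2 * bondNe β)) := by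
    have := (continuousAt_gap β).tendsto.add_const (bondNe β : ℂ)
    rwa [gap_zero, ← two_mul] at this
  have hne : ∀ᶠ w in 𝓝 0, gap β w + bondNe β ≠ 0 := hs0.eventually_ne (by simpa using hr)
  have hinv : (fun w => (gap β w + bondNe β)⁻¹) =O[𝓝 0] fun _ => (1 : ℂ) :=
    (hs0.inv₀ (by simpa using hr)).isBigO_one ℂ
  have hgap : (fun w => gap β w - bondNe β) =O[𝓝 0] fun w => w := by
    have := (analyticAt_gap β).differentiableAt.isBigO_sub
    simpa [gap_zero] using this
  have h1 := (sinh_sq_isBigO.mul hinv).const_mul_left ((bondEq β : ℂ) ^ 2)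
  have h2 := (((Asymptotics.isBigO_refl (fun w : ℂ => w ^ 2) (𝓝 0)).mul
    (hgap.mul hinv)).const_mul_left (-(bondEq β : ℂ) ^ 2 / (8 * bondNe β)))
  refine Asymptotics.IsBigO.congr' ((h1.congr_right fun w => ?_).add (h2.congr_right fun w => ?_))
    ?_ (Filter.EventuallyEq.rfl (f := fun w : ℂ => w ^ 3))
  · ring
  · ring
  filter_upwards [hne] with w hw
  have := gap_sq β w
  field_simp
  linear_combination (-(32 : ℂ) * bondNe β) * this

/-- The leading eigenvalue is even in the tilt, so the expansion has no linear term; its quadratic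
coefficient is half the susceptibility. -/
lemma muPlus_isBigO (β : ℝ) :
    (fun w : ℂ => muPlus β w / mu0 β - (1 + susc β / 2 * w ^ 2)) =O[𝓝 0] fun w => w ^ 3 := by
  have hr : (bondNe β : ℂ) ≠ 0 := by exact_mod_cast (bondNe_pos β).ne'
  have hm : (mu0 β : ℂ) ≠ 0 := by exact_mod_cast (mu0_pos β).ne'
  refine ((((cosh_isBigO (1 / 2)).const_mul_left (bondEq β)).add
    (gap_isBigO β)).const_mul_left (mu0 β : ℂ)⁻¹).congr_left fun w => ?_
  unfold muPlus susc
  rw [show 1 / 2 * w = w / 2 by ring]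
  push_cast
  rw [mu0] at hm ⊢
  push_cast at hm ⊢
  field_simp
  ring

/-- The leading eigenvalue agrees to second order with `μ₀ exp(τ w²/2)`. -/
lemma muPlus_mul_exp_isBigO (β : ℝ) :
    (fun w : ℂ => muPlus β w / mu0 β * Complex.exp (-(susc β / 2 * w ^ 2)) - 1) =O[𝓝 0]
      fun w => w ^ 3 := by
  have h1 : (fun w : ℂ => Complex.exp (-(susc β / 2 * w ^ 2)) - (1 - susc β / 2 * w ^ 2)) =O[𝓝 0]
      fun w => w ^ 3 := by
    have ht : Tendsto (fun w : ℂ => -((susc β : ℂ) / 2 * w ^ 2)) (𝓝 0) (𝓝 0) := by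
      have : Continuous fun w : ℂ => -((susc β : ℂ) / 2 * w ^ 2) := by fun_prop
      simpa using this.tendsto 0
    have h2 : (fun w : ℂ => Complex.exp (-(susc β / 2 * w ^ 2)) - (1 - susc β / 2 * w ^ 2))
        =O[𝓝 0] fun w => w ^ 4 := by
      refine Asymptotics.IsBigO.of_bound (‖(susc β : ℂ) / 2‖ ^ 2) ?_
      filter_upwards [ht (Metric.closedBall_mem_nhds 0 one_pos)] with w hw
      have hw' : ‖-((susc β : ℂ) / 2 * w ^ 2)‖ ≤ 1 := by simpa using hw
      have := Complex.norm_exp_sub_one_sub_id_le hw'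
      rw [show Complex.exp (-(susc β / 2 * w ^ 2)) - (1 - susc β / 2 * w ^ 2) =
        Complex.exp (-(susc β / 2 * w ^ 2)) - 1 - -((susc β : ℂ) / 2 * w ^ 2) by ring]
      refine this.trans (le_of_eq ?_)
      rw [norm_neg, norm_mul, norm_pow, norm_pow]; ring
    refine h2.trans ?_
    have : (fun w : ℂ => w) =O[𝓝 0] fun _ => (1 : ℂ) := continuousAt_id.isBigO_one ℂ
    refine ((Asymptotics.isBigO_refl (fun w : ℂ => w ^ 3) (𝓝 0)).mul this).congr ?_ ?_ <;>
      intro w <;> ring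
  have hb : (fun w : ℂ => Complex.exp (-(susc β / 2 * w ^ 2))) =O[𝓝 0] fun _ => (1 : ℂ) :=
    (Continuous.continuousAt (by fun_prop)).isBigO_one ℂ
  have hb' : (fun w : ℂ => 1 + susc β / 2 * w ^ 2) =O[𝓝 0] fun _ => (1 : ℂ) :=
    (Continuous.continuousAt (by fun_prop)).isBigO_one ℂ
  have h3 : (fun w : ℂ => -((susc β : ℂ) / 2) ^ 2 * w ^ 4) =O[𝓝 0] fun w => w ^ 3 := by
    have : (fun w : ℂ => -((susc β : ℂ) / 2) ^ 2 * w) =O[𝓝 0] fun _ => (1 : ℂ) :=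
      (Continuous.continuousAt (by fun_prop)).isBigO_one ℂ
    refine ((Asymptotics.isBigO_refl (fun w : ℂ => w ^ 3) (𝓝 0)).mul this).congr ?_ ?_ <;>
      intro w <;> ring
  have h4 := ((((muPlus_isBigO β).mul hb).congr_right fun w => by ring).add
    ((hb'.mul h1).congr_right fun w => by ring)).add h3
  refine h4.congr_left fun w => ?_
  ring

end SpeedChange

namespace SpeedChange

/-! ### Bounds on the generating functions near tilt zero -/

lemma norm_mul_apply_le {A B : Matrix Bool Bool ℂ} {K M : ℝ} (hA : ∀ a b, ‖A a b‖ ≤ K)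
    (hB : ∀ a b, ‖B a b‖ ≤ M) (a b : Bool) : ‖(A * B) a b‖ ≤ 2 * (K * M) := by
  have hK : 0 ≤ K := (norm_nonneg _).trans (hA true true)
  have : ∀ c, ‖A a c * B c b‖ ≤ K * M := fun c => by
    rw [norm_mul]; exact mul_le_mul (hA _ _) (hB _ _) (norm_nonneg _) hK
  rw [Matrix.mul_apply, Fintype.sum_bool]
  linarith [norm_add_le (A a true * B true b) (A a false * B false b), this true, this false]

lemma eventually_norm_apply_le {M : ℂ → Matrix Bool Bool ℂ}
    (h : ∀ a b, ContinuousAt (fun w => M w a b) 0) :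
    ∃ K : ℝ, 0 < K ∧ ∀ᶠ w in 𝓝 0, ∀ a b, ‖M w a b‖ ≤ K := by
  refine ⟨∑ a, ∑ b, (‖M 0 a b‖ + 1), by positivity, ?_⟩
  have : ∀ a b, ∀ᶠ w in 𝓝 0, ‖M w a b‖ ≤ ‖M 0 a b‖ + 1 := fun a b =>
    (h a b).norm.eventually_le_const (by linarith)
  filter_upwards [this true true, this true false, this false true, this false false]
    with w h1 h2 h3 h4
  simp only [Fintype.sum_bool]
  have := norm_nonneg (M 0 true true)
  have := norm_nonneg (M 0 true false)
  have := norm_nonneg (M 0 false true)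
  have := norm_nonneg (M 0 false false)
  intro a b
  cases a <;> cases b <;> linarith

lemma analyticAt_genFn (β : ℝ) (n : ℕ) (f : Config → ℝ) (a b : Bool) (w : ℂ) :
    AnalyticAt ℂ (fun w => genFn β n f w a b) w := by
  unfold genFn
  exact Finset.analyticAt_fun_sum _ fun A _ => by fun_prop

lemma analyticAt_leftVec (β : ℝ) (c : Bool) : AnalyticAt ℂ (fun w => leftVec β w c) 0 := by
  have := analyticAt_gap β
  unfold leftVec
  cases c
  · simp; fun_prop
  · simp; fun_prop

lemma analyticAt_leftForm_genFn (β : ℝ) (n : ℕ) (f : Config → ℝ) :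
    AnalyticAt ℂ (fun w => leftForm β w (genFn β n f w)) 0 := by
  unfold leftForm
  exact Finset.analyticAt_fun_sum _ fun c _ => Finset.analyticAt_fun_sum _ fun d _ =>
    ((analyticAt_leftVec β c).mul (analyticAt_genFn β n f c d 0)).mul (analyticAt_leftVec β d)

lemma leftVec_ofReal_pos (β x : ℝ) (c : Bool) : ∃ v : ℝ, 0 < v ∧ leftVec β x c = v := by
  cases c
  · refine ⟨bondNe β * Real.exp (-(x / 2)), mul_pos (bondNe_pos β) (Real.exp_pos _), ?_⟩
    simp [leftVec]
  · refine ⟨bondEq β * Real.sinh (x / 2) +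
      √((bondEq β * Real.sinh (x / 2)) ^ 2 + bondNe β ^ 2), ?_, ?_⟩
    · have h : |bondEq β * Real.sinh (x / 2)| <
          √((bondEq β * Real.sinh (x / 2)) ^ 2 + bondNe β ^ 2) := by
        refine Real.lt_sqrt_of_sq_lt ?_
        have := bondNe_pos β
        rw [sq_abs]; nlinarith
      linarith [neg_abs_le (bondEq β * Real.sinh (x / 2))]
    · simp [leftVec, gap_ofReal]

lemma genFn_one_ofReal_pos (β x : ℝ) (n : ℕ) (a b : Bool) :
    ∃ v : ℝ, 0 < v ∧ genFn β n (fun _ => 1) x a b = v := by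
  refine ⟨∑ A ∈ (box n).powerset, Real.exp (-energy β n (indicatorConfig A) (bdry a b)) *
    Real.exp (x * blockSum n (indicatorConfig A)),
    Finset.sum_pos (fun _ _ => by positivity) ⟨∅, by simp⟩, ?_⟩
  simp [genFn]

lemma leftForm_one_ne_zero (β x : ℝ) (n : ℕ) :
    leftForm β x (genFn β n (fun _ => 1) x) ≠ 0 := by
  choose v hv hv' using leftVec_ofReal_pos β x
  choose u hu hu' using genFn_one_ofReal_pos β x n
  have : leftForm β x (genFn β n (fun _ => 1) x) = ((∑ c, ∑ d, v c * u c d * v d : ℝ) : ℂ) := by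
    simp only [leftForm, hv', hu']; push_cast; rfl
  rw [this]
  have : 0 < ∑ c, ∑ d, v c * u c d * v d := by
    refine Finset.sum_pos (fun c _ => Finset.sum_pos (fun d _ => ?_) ⟨true, by simp⟩)
      ⟨true, by simp⟩
    have := hv c; have := hv d; have := hu c d
    positivity
  exact_mod_cast this.ne'

lemma analyticAt_tilted (β : ℝ) (l : ℕ) (f : Config → ℝ) :
    AnalyticAt ℂ (tilted β l f) 0 :=
  (analyticAt_leftForm_genFn β l f).div (analyticAt_leftForm_genFn β l _)
    (by simpa using leftForm_one_ne_zero β 0 l)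

lemma continuousAt_muMinus (β : ℝ) : ContinuousAt (muMinus β) 0 := by
  have := continuousAt_gap β
  unfold muMinus; fun_prop

lemma gap_zero_ne (β : ℝ) : gap β 0 ≠ 0 := by
  rw [gap_zero]; exact_mod_cast (bondNe_pos β).ne'

lemma analyticAt_projPlus (β : ℝ) (a b : Bool) :
    AnalyticAt ℂ (fun w => projPlus β w a b) 0 := by
  have := analyticAt_gap β
  have h : AnalyticAt ℂ (fun w => (2 * gap β w)⁻¹) 0 :=
    (analyticAt_const.mul this).inv (by simpa using gap_zero_ne β)
  simp only [projPlus, Matrix.smul_apply, Matrix.sub_apply, smul_eq_mul]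
  refine h.mul ?_
  unfold transfer muMinus
  fun_prop

lemma continuousAt_projPlus (β : ℝ) (a b : Bool) :
    ContinuousAt (fun w => projPlus β w a b) 0 := (analyticAt_projPlus β a b).continuousAt

lemma continuousAt_projMinus (β : ℝ) (a b : Bool) :
    ContinuousAt (fun w => projMinus β w a b) 0 := by
  have := continuousAt_gap β
  have h : ContinuousAt (fun w => (2 * gap β w)⁻¹) 0 :=
    (continuousAt_const.mul this).inv₀ (by simpa using gap_zero_ne β)
  simp only [projMinus, Matrix.smul_apply, Matrix.sub_apply, smul_eq_mul]
  refine h.mul ?_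
  unfold transfer muPlus
  fun_prop

/-- The rate at which the subleading eigenvalue loses against the leading one. -/
noncomputable def decayRate (β : ℝ) : ℝ := max (bondEq β) (bondNe β) / mu0 β

lemma decayRate_pos (β : ℝ) : 0 < decayRate β :=
  div_pos (lt_max_of_lt_left (bondEq_pos β)) (mu0_pos β)

lemma decayRate_lt_one (β : ℝ) : decayRate β < 1 := by
  rw [decayRate, div_lt_one (mu0_pos β), mu0]
  exact max_lt (by linarith [bondNe_pos β]) (by linarith [bondEq_pos β])

lemma abs_bondEq_sub_bondNe_lt (β : ℝ) :
    |bondEq β - bondNe β| < mu0 β * decayRate β := by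
  rw [decayRate, mul_div_cancel₀ _ (mu0_pos β).ne', abs_lt]
  have := bondEq_pos β
  have := bondNe_pos β
  constructor <;> rcases le_total (bondEq β) (bondNe β) with h | h <;> simp [h] <;> linarith

lemma norm_muPlus_mul_muMinus_le (β : ℝ) (w : ℂ) :
    ‖muPlus β w * muMinus β w‖ ≤ mu0 β ^ 2 * decayRate β := by
  rw [muPlus_mul_muMinus, show (bondEq β : ℂ) ^ 2 - (bondNe β : ℂ) ^ 2 =
    ((mu0 β * (bondEq β - bondNe β) : ℝ) : ℂ) by unfold mu0; push_cast; ring, Complex.norm_real,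
    Real.norm_eq_abs, abs_mul, abs_of_pos (mu0_pos β), sq, mul_assoc]
  exact mul_le_mul_of_nonneg_left (abs_bondEq_sub_bondNe_lt β).le (mu0_pos β).le

lemma eventually_norm_muMinus_sq_le (β : ℝ) :
    ∀ᶠ w in 𝓝 0, ‖muMinus β w ^ 2‖ ≤ mu0 β ^ 2 * decayRate β := by
  have h : Tendsto (fun w => ‖muMinus β w ^ 2‖) (𝓝 0) (𝓝 ‖muMinus β 0 ^ 2‖) :=
    ((continuousAt_muMinus β).pow 2).norm
  refine h.eventually_le_const ?_
  rw [muMinus_zero, ← Complex.ofReal_sub, ← Complex.ofReal_pow, Complex.norm_real, norm_pow,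
    Real.norm_eq_abs]
  have h1 := abs_bondEq_sub_bondNe_lt β
  have h2 := decayRate_lt_one β
  have h3 := decayRate_pos β
  have h4 := mu0_pos β
  calc |bondEq β - bondNe β| ^ 2 < (mu0 β * decayRate β) ^ 2 :=
        pow_lt_pow_left₀ h1 (abs_nonneg _) two_ne_zero
    _ = mu0 β ^ 2 * decayRate β * decayRate β := by ring
    _ ≤ mu0 β ^ 2 * decayRate β := mul_le_of_le_one_right (by positivity) h2.le

/-- The size of the generating function of `1` at tilt zero, to leading order. -/
noncomputable def bulk (β : ℝ) (n : ℕ) : ℝ := mu0 β ^ (2 * n + 2) / 2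

lemma bulk_pos (β : ℝ) (n : ℕ) : 0 < bulk β n := by
  have := mu0_pos β
  unfold bulk; positivity

/-- Away from the block boundary, a local function enters the generating function only through
its tilted expectation. -/
lemma eventually_norm_genFn_sub_le (β : ℝ) (l : ℕ) {f : Config → ℝ}
    (hf : DependsOn f (box l : Set ℤ)) :
    ∃ D : ℝ, 0 ≤ D ∧ ∀ᶠ w in 𝓝 (0 : ℂ), ∀ n, l ≤ n → ∀ a b,
      ‖genFn β n f w a b - tilted β l f w * genFn β n (fun _ => 1) w a b‖
        ≤ D * bulk β n * decayRate β ^ n := by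
  have hθ := decayRate_pos β
  have hm := mu0_pos β
  obtain ⟨K, hK, hP⟩ := eventually_norm_apply_le (continuousAt_projPlus β)
  obtain ⟨K', hK', hQ⟩ := eventually_norm_apply_le (continuousAt_projMinus β)
  obtain ⟨M, hM, hY⟩ := eventually_norm_apply_le
    (M := fun w => genFn β l f w - tilted β l f w • genFn β l (fun _ => 1) w) (fun a b => by
      simp only [Matrix.sub_apply, Matrix.smul_apply, smul_eq_mul]
      exact (analyticAt_genFn β l f a b 0).continuousAt.sub
        ((analyticAt_tilted β l f).continuousAt.mul (analyticAt_genFn β l _ a b 0).continuousAt))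
  set E : ℝ := 2 * (2 * (K * M) * K') + 2 * (2 * (K' * M) * K) + 2 * (2 * (K' * M) * K') with hE
  have hE0 : 0 ≤ E := by positivity
  have hg : ∀ᶠ w in 𝓝 (0 : ℂ), gap β w ≠ 0 :=
    (continuousAt_gap β).eventually_ne (gap_zero_ne β)
  have hv : ∀ᶠ w in 𝓝 (0 : ℂ), leftVec β w true ≠ 0 :=
    (analyticAt_leftVec β true).continuousAt.eventually_ne (by
      rw [leftVec_zero]; exact_mod_cast (bondNe_pos β).ne')
  have hF : ∀ᶠ w in 𝓝 (0 : ℂ), leftForm β w (genFn β l (fun _ => 1) w) ≠ 0 :=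
    (analyticAt_leftForm_genFn β l _).continuousAt.eventually_ne
      (by simpa using leftForm_one_ne_zero β 0 l)
  refine ⟨E * (2 / (mu0 β ^ (2 * l + 2) * decayRate β ^ l)), by positivity, ?_⟩
  filter_upwards [hP, hQ, hY, hg, hv, hF, eventually_norm_muMinus_sq_le β]
    with w hP hQ hY hg hv hF hμ n hn a b
  obtain ⟨m, rfl⟩ := Nat.exists_eq_add_of_le hn
  have key := congrFun (congrFun (genFn_sub_tilted_smul β l m hf hg hv hF) a) b
  generalize genFn β l f w - tilted β l f w • genFn β l (fun _ => 1) w = Y at hY key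
  simp only [Matrix.sub_apply, Matrix.smul_apply, Matrix.add_apply, smul_eq_mul] at key
  rw [key]
  have t1 := norm_mul_apply_le (norm_mul_apply_le hP hY) (B := (projMinus β w).transpose)
    (fun a b => hQ b a) a b
  have t2 := norm_mul_apply_le (norm_mul_apply_le hQ hY) (B := (projPlus β w).transpose)
    (fun a b => hP b a) a b
  have t3 := norm_mul_apply_le (norm_mul_apply_le hQ hY) (B := (projMinus β w).transpose)
    (fun a b => hQ b a) a b
  have p1 : ‖(muPlus β w * muMinus β w) ^ m‖ ≤ (mu0 β ^ 2 * decayRate β) ^ m := by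
    rw [norm_pow]; exact pow_le_pow_left₀ (norm_nonneg _) (norm_muPlus_mul_muMinus_le β w) m
  have p2 : ‖(muMinus β w ^ 2) ^ m‖ ≤ (mu0 β ^ 2 * decayRate β) ^ m := by
    rw [norm_pow]; exact pow_le_pow_left₀ (norm_nonneg _) hμ m
  have e : E * (2 / (mu0 β ^ (2 * l + 2) * decayRate β ^ l)) * bulk β (l + m) *
      decayRate β ^ (l + m) = (mu0 β ^ 2 * decayRate β) ^ m * E := by
    unfold bulk
    rw [mul_pow, ← pow_mul, show 2 * (l + m) + 2 = 2 * l + 2 + 2 * m by ring, pow_add _ (2 * l + 2),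
      pow_add _ l]
    field_simp
  rw [e, hE, mul_add ((mu0 β ^ 2 * decayRate β) ^ m)]
  refine (norm_add_le _ _).trans (add_le_add ?_ ?_)
  · rw [norm_mul]
    refine mul_le_mul p1 ((norm_add_le _ _).trans (add_le_add t1 t2)) (norm_nonneg _)
      (by positivity)
  · rw [norm_mul]
    exact mul_le_mul p2 t3 (norm_nonneg _) (by positivity)

lemma projPlus_mul_edge_zero (β : ℝ) (a b : Bool) :
    (projPlus β 0 * edgeMatrix β) a b = mu0 β / 2 := by
  have hr : (bondNe β : ℂ) ≠ 0 := by exact_mod_cast (bondNe_pos β).ne'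
  simp only [Matrix.mul_apply, Fintype.sum_bool, projPlus, Matrix.smul_apply, Matrix.sub_apply,
    transfer_apply, Matrix.one_apply, smul_eq_mul, edgeMatrix_apply, muMinus_zero, gap_zero]
  unfold mu0
  cases a <;> cases b <;> simp <;> field_simp <;> ring

/-- Near tilt zero only the leading eigenvalue matters: the error is exponentially small compared
with the partition function at tilt zero. -/
lemma eventually_norm_genFn_one_sub_le (β : ℝ) :
    ∃ D : ℝ, 0 ≤ D ∧ ∀ᶠ w in 𝓝 (0 : ℂ), ∀ n a b,
      ‖genFn β n (fun _ => 1) w a b - muPlus β w ^ (2 * n + 1) * (projPlus β w * edgeMatrix β) a b‖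
        ≤ D * bulk β n * decayRate β ^ n := by
  have hθ := decayRate_pos β
  have hm := mu0_pos β
  obtain ⟨K, hK, hQ⟩ := eventually_norm_apply_le (M := fun w => projMinus β w * edgeMatrix β)
    (fun a b => by
      simp only [Matrix.mul_apply, Fintype.sum_bool]
      have h1 := continuousAt_projMinus β a true
      have h2 := continuousAt_projMinus β a false
      fun_prop)
  have hg : ∀ᶠ w in 𝓝 (0 : ℂ), gap β w ≠ 0 :=
    (continuousAt_gap β).eventually_ne (gap_zero_ne β)
  have hb : ∀ᶠ w in 𝓝 (0 : ℂ), ‖muMinus β w‖ ≤ ‖muMinus β 0‖ + 1 :=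
    (continuousAt_muMinus β).norm.eventually_le_const (by linarith)
  refine ⟨(‖muMinus β 0‖ + 1) * K * (2 / mu0 β ^ 2), by positivity, ?_⟩
  filter_upwards [hQ, hg, hb, eventually_norm_muMinus_sq_le β] with w hQ hg hb hμ n a b
  rw [genFn_one, transfer_pow β hg]
  simp only [Matrix.add_mul, Matrix.smul_mul, Matrix.add_apply, Matrix.smul_apply, smul_eq_mul,
    add_sub_cancel_left]
  have e : (‖muMinus β 0‖ + 1) * K * (2 / mu0 β ^ 2) * bulk β n * decayRate β ^ n =
      (mu0 β ^ 2 * decayRate β) ^ n * (‖muMinus β 0‖ + 1) * K := by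
    unfold bulk
    rw [mul_pow, ← pow_mul, pow_add]
    field_simp
  rw [e, norm_mul, pow_succ, pow_mul, norm_mul, norm_pow]
  gcongr
  exact hQ a b

end SpeedChange

namespace SpeedChange

/-- The number `2n+1` of sites of `Λ_n`. -/
noncomputable def vol (n : ℕ) : ℝ := 2 * (n : ℝ) + 1

lemma vol_pos (n : ℕ) : 0 < vol n := by unfold vol; positivity

lemma norm_pow_sub_one_le (z : ℂ) (N : ℕ) :
    ‖z ^ N - 1‖ ≤ N * ‖z - 1‖ * Real.exp (N * ‖z - 1‖) := by
  have hz : ‖z‖ ≤ Real.exp ‖z - 1‖ := by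
    have h1 : ‖z‖ ≤ ‖z - 1‖ + 1 := by
      have := norm_add_le (z - 1) 1
      simpa using this
    exact h1.trans (Real.add_one_le_exp _)
  induction N with
  | zero => simp
  | succ N ih =>
    have h1 : z ^ (N + 1) - 1 = z ^ N * (z - 1) + (z ^ N - 1) := by ring
    have h2 : ‖z ^ N‖ ≤ Real.exp (N * ‖z - 1‖) := by
      rw [norm_pow, Real.exp_nat_mul]
      exact pow_le_pow_left₀ (norm_nonneg _) hz N
    have h3 : Real.exp (N * ‖z - 1‖) ≤ Real.exp ((N + 1 : ℕ) * ‖z - 1‖) := by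
      apply Real.exp_le_exp.2
      push_cast
      nlinarith [norm_nonneg (z - 1)]
    rw [h1]
    calc ‖z ^ N * (z - 1) + (z ^ N - 1)‖ ≤ ‖z ^ N‖ * ‖z - 1‖ + ‖z ^ N - 1‖ := by
          rw [← norm_mul]; exact norm_add_le _ _
      _ ≤ Real.exp (N * ‖z - 1‖) * ‖z - 1‖ + N * ‖z - 1‖ * Real.exp (N * ‖z - 1‖) := by gcongr
      _ = (N + 1 : ℕ) * ‖z - 1‖ * Real.exp (N * ‖z - 1‖) := by push_cast; ring
      _ ≤ _ := by gcongr

/-- Near tilt zero the generating function of `1` is Gaussian to leading order. -/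
lemma eventually_norm_genFn_one_div_sub_le (β : ℝ) :
    ∃ C : ℝ, 0 ≤ C ∧ ∀ᶠ w in 𝓝 (0 : ℂ), ∀ n a b,
      ‖genFn β n (fun _ => 1) w a b / bulk β n - Complex.exp (vol n * (susc β / 2 * w ^ 2))‖
        ≤ C * (‖w‖ + vol n * ‖w‖ ^ 3) * Real.exp (C * (vol n * ‖w‖ ^ 3)) *
            ‖Complex.exp (vol n * (susc β / 2 * w ^ 2))‖ + C * decayRate β ^ n := by
  have hm := mu0_pos β
  have hmc : (mu0 β : ℂ) ≠ 0 := by exact_mod_cast hm.ne'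
  obtain ⟨D, hD, hone⟩ := eventually_norm_genFn_one_sub_le β
  obtain ⟨C₁, hC₁, he⟩ := (muPlus_mul_exp_isBigO β).exists_pos
  have hh : ∀ a b, ∃ C₂ : ℝ, 0 < C₂ ∧ ∀ᶠ w in 𝓝 (0 : ℂ),
      ‖(projPlus β w * edgeMatrix β) a b / (mu0 β / 2) - 1‖ ≤ C₂ * ‖w‖ := by
    intro a b
    have hd : DifferentiableAt ℂ (fun w => (projPlus β w * edgeMatrix β) a b / (mu0 β / 2)) 0 := by
      simp only [Matrix.mul_apply, Fintype.sum_bool]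
      have h1 := (analyticAt_projPlus β a true).differentiableAt
      have h2 := (analyticAt_projPlus β a false).differentiableAt
      fun_prop
    have := hd.isBigO_sub
    rw [projPlus_mul_edge_zero, div_self (by simpa using hmc)] at this
    simp only [sub_zero] at this
    obtain ⟨C, hC, h⟩ := this.exists_pos
    exact ⟨C, hC, h.bound⟩
  choose C₂ hC₂ hh using hh
  set K := C₂ true true + C₂ true false + C₂ false true + C₂ false false with hK
  have hKle : ∀ a b, C₂ a b ≤ K := by
    have := hC₂ true true; have := hC₂ true false
    have := hC₂ false true; have := hC₂ false false
    intro a b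
    cases a <;> cases b <;> linarith
  have hK0 : 0 < K := (hC₂ true true).trans_le (hKle _ _)
  refine ⟨C₁ * (1 + K) + K + D + C₁, by positivity, ?_⟩
  have hball : ∀ᶠ w in 𝓝 (0 : ℂ), ‖w‖ ≤ 1 := by
    filter_upwards [Metric.closedBall_mem_nhds (0 : ℂ) one_pos] with w hw using by simpa using hw
  filter_upwards [hone, he.bound, hh true true, hh true false, hh false true, hh false false, hball]
    with w hone he h1 h2 h3 h4 hw n a b
  have hh : ‖(projPlus β w * edgeMatrix β) a b / (mu0 β / 2) - 1‖ ≤ K * ‖w‖ := by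
    refine le_trans ?_ (mul_le_mul_of_nonneg_right (hKle a b) (norm_nonneg _))
    cases a <;> cases b <;> assumption
  clear h1 h2 h3 h4
  specialize hone n a b
  set h : ℂ := (projPlus β w * edgeMatrix β) a b / (mu0 β / 2) with hhdef
  set e : ℂ := muPlus β w / mu0 β * Complex.exp (-(susc β / 2 * w ^ 2)) with hedef
  set g : ℂ := Complex.exp (vol n * (susc β / 2 * w ^ 2)) with hg
  have hN : ((2 * n + 1 : ℕ) : ℝ) = vol n := by unfold vol; push_cast; ring
  have hNc : ((2 * n + 1 : ℕ) : ℂ) = vol n := by rw [← hN]; push_cast; rfl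
  have hv := vol_pos n
  have hb := bulk_pos β n
  have hbc : (bulk β n : ℂ) ≠ 0 := by exact_mod_cast hb.ne'
  have main : muPlus β w ^ (2 * n + 1) * (projPlus β w * edgeMatrix β) a b / bulk β n =
      e ^ (2 * n + 1) * g * h := by
    have : e ^ (2 * n + 1) * g = muPlus β w ^ (2 * n + 1) / mu0 β ^ (2 * n + 1) := by
      rw [hedef, mul_pow, ← Complex.exp_nat_mul, hg, mul_assoc, ← Complex.exp_add, hNc,
        show (vol n : ℂ) * -(susc β / 2 * w ^ 2) + vol n * (susc β / 2 * w ^ 2) = 0 by ring,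
        Complex.exp_zero, mul_one, div_pow]
    rw [this, hhdef]
    unfold bulk
    push_cast
    rw [show 2 * n + 2 = 2 * n + 1 + 1 by ring, pow_succ (mu0 β : ℂ) (2 * n + 1)]
    field_simp
  have hsplit : genFn β n (fun _ => 1) w a b / bulk β n - g =
      (e ^ (2 * n + 1) * h - 1) * g + (genFn β n (fun _ => 1) w a b -
        muPlus β w ^ (2 * n + 1) * (projPlus β w * edgeMatrix β) a b) / bulk β n := by
    rw [sub_div, main]; ring
  have herr : ‖(genFn β n (fun _ => 1) w a b -
        muPlus β w ^ (2 * n + 1) * (projPlus β w * edgeMatrix β) a b) / bulk β n‖ ≤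
      D * decayRate β ^ n := by
    rw [norm_div, Complex.norm_real, Real.norm_eq_abs, abs_of_pos hb, div_le_iff₀ hb]
    linarith
  have hhn : ‖h‖ ≤ 1 + K := by
    have := norm_add_le (h - 1) 1
    rw [sub_add_cancel, norm_one] at this
    nlinarith
  have hpow := norm_pow_sub_one_le e (2 * n + 1)
  rw [hN] at hpow
  rw [norm_pow] at he
  set X := vol n * ‖w‖ ^ 3 with hX
  have hX0 : 0 ≤ X := by positivity
  have hex : vol n * ‖e - 1‖ ≤ C₁ * X := by
    rw [hX]; nlinarith
  have hpow' : ‖e ^ (2 * n + 1) - 1‖ ≤ C₁ * X * Real.exp (C₁ * X) :=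
    hpow.trans (by gcongr)
  have hE1 : 1 ≤ Real.exp (C₁ * X) := Real.one_le_exp (by positivity)
  have hfirst : ‖e ^ (2 * n + 1) * h - 1‖ ≤
      (C₁ * (1 + K) + K) * (‖w‖ + X) * Real.exp (C₁ * X) := by
    rw [show e ^ (2 * n + 1) * h - 1 = (e ^ (2 * n + 1) - 1) * h + (h - 1) by ring]
    calc _ ≤ ‖e ^ (2 * n + 1) - 1‖ * ‖h‖ + ‖h - 1‖ := by
          rw [← norm_mul]; exact norm_add_le _ _
      _ ≤ C₁ * X * Real.exp (C₁ * X) * (1 + K) + K * ‖w‖ * 1 := by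
          rw [mul_one]; gcongr
      _ ≤ C₁ * X * Real.exp (C₁ * X) * (1 + K) + K * ‖w‖ * Real.exp (C₁ * X) := by gcongr
      _ = (C₁ * (1 + K) * X + K * ‖w‖) * Real.exp (C₁ * X) := by ring
      _ ≤ _ := by
          gcongr
          have : 0 ≤ C₁ * (1 + K) * ‖w‖ := by positivity
          have : 0 ≤ K * X := by positivity
          linarith
  rw [hsplit]
  refine (norm_add_le _ _).trans (add_le_add ?_ (herr.trans ?_))
  · rw [norm_mul]
    have hC1 : C₁ * (1 + K) + K ≤ C₁ * (1 + K) + K + D + C₁ := by linarith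
    have hC2 : C₁ ≤ C₁ * (1 + K) + K + D + C₁ := by
      have : 0 ≤ C₁ * (1 + K) + K + D := by positivity
      linarith
    refine mul_le_mul_of_nonneg_right (hfirst.trans ?_) (norm_nonneg _)
    gcongr
  · refine mul_le_mul_of_nonneg_right ?_ (pow_nonneg (decayRate_pos β).le n)
    have : 0 ≤ C₁ * (1 + K) + K + C₁ := by positivity
    linarith

/-! ### Bounds on the generating functions at large imaginary tilt -/

lemma sum_norm_mul_apply_le {A B : Matrix Bool Bool ℂ} {K M : ℝ}
    (hA : ∀ a, ∑ c, ‖A a c‖ ≤ K) (hB : ∀ a, ∑ c, ‖B a c‖ ≤ M) (a : Bool) :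
    ∑ c, ‖(A * B) a c‖ ≤ K * M := by
  have hM : 0 ≤ M := (Finset.sum_nonneg fun _ _ => norm_nonneg _).trans (hB true)
  calc ∑ c, ‖(A * B) a c‖ ≤ ∑ c, ∑ d, ‖A a d‖ * ‖B d c‖ := by
        refine Finset.sum_le_sum fun c _ => ?_
        rw [Matrix.mul_apply]
        exact (norm_sum_le _ _).trans (Finset.sum_le_sum fun d _ => (norm_mul _ _).le)
    _ = ∑ d, ‖A a d‖ * ∑ c, ‖B d c‖ := by
        rw [Finset.sum_comm]; simp only [Finset.mul_sum]
    _ ≤ ∑ d, ‖A a d‖ * M := Finset.sum_le_sum fun d _ => by gcongr; exact hB d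
    _ = (∑ d, ‖A a d‖) * M := by rw [Finset.sum_mul]
    _ ≤ K * M := by gcongr; exact hA a

lemma sum_norm_pow_apply_le {A : Matrix Bool Bool ℂ} {K : ℝ}
    (hA : ∀ a, ∑ c, ‖A a c‖ ≤ K) (m : ℕ) (a : Bool) : ∑ c, ‖(A ^ m) a c‖ ≤ K ^ m := by
  induction m generalizing a with
  | zero => cases a <;> simp [Matrix.one_apply]
  | succ m ih => rw [pow_succ, pow_succ]; exact sum_norm_mul_apply_le ih hA a

lemma norm_one_add_exp_I_le {δ y : ℝ} (hδ : 0 ≤ δ) (h1 : δ ≤ |y|) (h2 : |y| ≤ Real.pi) :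
    ‖1 + Complex.exp (y * Complex.I)‖ ≤ √(2 + 2 * Real.cos δ) := by
  refine Real.le_sqrt_of_sq_le ?_
  rw [← Complex.normSq_eq_norm_sq, Complex.exp_mul_I, ← Complex.ofReal_cos, ← Complex.ofReal_sin,
    Complex.normSq_apply]
  simp only [Complex.add_re, Complex.add_im, Complex.mul_re, Complex.mul_im, Complex.one_re,
    Complex.one_im, Complex.ofReal_re, Complex.ofReal_im, Complex.I_re, Complex.I_im]
  have := Real.sin_sq_add_cos_sq y
  have h3 : Real.cos |y| ≤ Real.cos δ := Real.cos_le_cos_of_nonneg_of_le_pi hδ h2 h1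
  rw [Real.cos_abs] at h3
  nlinarith

lemma norm_one_add_exp_le {δ x y : ℝ} (hδ : 0 ≤ δ) (h1 : δ ≤ |y|) (h2 : |y| ≤ Real.pi) :
    ‖1 + Complex.exp (x + y * Complex.I)‖ ≤
      √(2 + 2 * Real.cos δ) + (Real.exp |x| - 1) := by
  have h3 : Complex.exp (x + y * Complex.I) =
      Complex.exp (y * Complex.I) + ((Real.exp x - 1 : ℝ) : ℂ) * Complex.exp (y * Complex.I) := by
    rw [Complex.exp_add]; push_cast; ring
  rw [h3, ← add_assoc]
  refine (norm_add_le _ _).trans (add_le_add (norm_one_add_exp_I_le hδ h1 h2) ?_)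
  rw [norm_mul, Complex.norm_exp_ofReal_mul_I, mul_one, Complex.norm_real, Real.norm_eq_abs]
  rcases le_total 0 x with hx | hx
  · rw [abs_of_nonneg hx, abs_of_nonneg (by linarith [Real.add_one_le_exp x])]
  · rw [abs_of_nonpos hx, abs_of_nonpos (by linarith [Real.exp_le_one_iff.2 hx])]
    have h5 : Real.exp x * Real.exp (-x) = 1 := by rw [← Real.exp_add]; simp
    nlinarith [Real.exp_pos x, Real.exp_pos (-x), sq_nonneg (Real.exp x - 1),
      sq_nonneg (Real.exp (-x) - 1)]

lemma sum_norm_transfer_sq_le (β : ℝ) {δ x y : ℝ} (hδ : 0 ≤ δ) (h1 : δ ≤ |y|) (h2 : |y| ≤ Real.pi)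
    (a : Bool) : ∑ c, ‖(transfer β (x + y * Complex.I) ^ 2) a c‖ ≤
      bondEq β ^ 2 * Real.exp |x| + bondNe β ^ 2 +
        bondEq β * bondNe β * (√(2 + 2 * Real.cos δ) + (Real.exp |x| - 1)) := by
  have hp := bondEq_pos β
  have hr := bondNe_pos β
  set w : ℂ := x + y * Complex.I with hw
  have e1 : Complex.exp w = Complex.exp (w / 2) * Complex.exp (w / 2) := by
    rw [← Complex.exp_add]; congr 1; ring
  have e2 : Complex.exp (-w) = Complex.exp (-(w / 2)) * Complex.exp (-(w / 2)) := by
    rw [← Complex.exp_add]; congr 1; ring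
  have e3 := exp_half_mul w
  have n1 : ‖Complex.exp w‖ ≤ Real.exp |x| := by
    rw [Complex.norm_exp]; apply Real.exp_le_exp.2; simp [hw, le_abs_self]
  have n2 : ‖Complex.exp (-w)‖ ≤ Real.exp |x| := by
    rw [Complex.norm_exp]; apply Real.exp_le_exp.2; simp [hw, neg_le_abs]
  have n3 : ‖1 + Complex.exp w‖ ≤ √(2 + 2 * Real.cos δ) + (Real.exp |x| - 1) :=
    norm_one_add_exp_le hδ h1 h2
  have n4 : ‖1 + Complex.exp (-w)‖ ≤ √(2 + 2 * Real.cos δ) + (Real.exp |x| - 1) := by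
    have := norm_one_add_exp_le (x := -x) (y := -y) hδ (by simpa using h1) (by simpa using h2)
    rw [abs_neg] at this
    convert this using 3
    rw [hw]; push_cast; ring_nf
  have diag : ∀ u : ℂ, ‖u‖ ≤ Real.exp |x| →
      ‖(bondEq β : ℂ) ^ 2 * u + (bondNe β : ℂ) ^ 2‖ ≤
        bondEq β ^ 2 * Real.exp |x| + bondNe β ^ 2 := by
    intro u hu
    refine (norm_add_le _ _).trans ?_
    rw [norm_mul, norm_pow, norm_pow, Complex.norm_real, Complex.norm_real, Real.norm_eq_abs,
      Real.norm_eq_abs, sq_abs, sq_abs]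
    gcongr
  have off : ∀ u : ℂ, ‖1 + u‖ ≤ √(2 + 2 * Real.cos δ) + (Real.exp |x| - 1) →
      ‖(bondEq β : ℂ) * bondNe β * (1 + u)‖ ≤
        bondEq β * bondNe β * (√(2 + 2 * Real.cos δ) + (Real.exp |x| - 1)) := by
    intro u hu
    rw [norm_mul, norm_mul, Complex.norm_real, Complex.norm_real, Real.norm_eq_abs,
      Real.norm_eq_abs, abs_of_pos hp, abs_of_pos hr]
    gcongr
  cases a
  · rw [Fintype.sum_bool, add_comm]
    refine add_le_add ?_ ?_
    · refine le_of_eq_of_le (congrArg norm ?_) (diag _ n2)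
      rw [sq, Matrix.mul_apply, Fintype.sum_bool]
      simp only [transfer_apply]
      simp
      rw [e2]
      linear_combination (bondNe β : ℂ) ^ 2 * e3
    · refine le_of_eq_of_le (congrArg norm ?_) (off _ n3)
      rw [sq, Matrix.mul_apply, Fintype.sum_bool]
      simp only [transfer_apply]
      simp
      rw [e1]
      linear_combination (bondEq β : ℂ) * bondNe β * e3
  · rw [Fintype.sum_bool]
    refine add_le_add ?_ ?_
    · refine le_of_eq_of_le (congrArg norm ?_) (diag _ n1)
      rw [sq, Matrix.mul_apply, Fintype.sum_bool]
      simp only [transfer_apply]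
      simp
      rw [e1]
      linear_combination (bondNe β : ℂ) ^ 2 * e3
    · refine le_of_eq_of_le (congrArg norm ?_) (off _ n4)
      rw [sq, Matrix.mul_apply, Fintype.sum_bool]
      simp only [transfer_apply]
      simp
      rw [e2]
      linear_combination (bondEq β : ℂ) * bondNe β * e3

/-- Away from zero imaginary part, two steps of the transfer matrix lose a factor `κ < 1` against
`mu0`. One step does not suffice: its entries have the same moduli for all imaginary tilts. -/
lemma exists_sum_norm_transfer_sq_le (β : ℝ) {δ : ℝ} (hδ : 0 < δ) (hδ' : δ ≤ Real.pi) :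
    ∃ κ : ℝ, 0 < κ ∧ κ < 1 ∧ ∃ x₀ : ℝ, 0 < x₀ ∧ x₀ ≤ 1 ∧ ∀ x y : ℝ, |x| ≤ x₀ → δ ≤ |y| →
      |y| ≤ Real.pi → ∀ a, ∑ c, ‖(transfer β (x + y * Complex.I) ^ 2) a c‖ ≤ κ * mu0 β ^ 2 := by
  have hp := bondEq_pos β
  have hr := bondNe_pos β
  have hm := mu0_pos β
  set F : ℝ → ℝ := fun x => bondEq β ^ 2 * Real.exp |x| + bondNe β ^ 2 +
        bondEq β * bondNe β * (√(2 + 2 * Real.cos δ) + (Real.exp |x| - 1)) with hF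
  have hcos : Real.cos δ < 1 := by
    rw [← Real.cos_zero]
    exact Real.cos_lt_cos_of_nonneg_of_le_pi le_rfl hδ' hδ
  have hs : √(2 + 2 * Real.cos δ) < 2 := by
    rw [Real.sqrt_lt' two_pos]; linarith
  have hF0 : F 0 < mu0 β ^ 2 := by
    have hpr : 0 < bondEq β * bondNe β := mul_pos hp hr
    simp only [hF, abs_zero, Real.exp_zero, mu0]
    nlinarith
  have hF0' : 0 < F 0 := by
    simp only [hF, abs_zero, Real.exp_zero, sub_self]
    positivity
  obtain ⟨c, hc1, hc2⟩ := exists_between hF0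
  have hcont : Continuous F := by fun_prop
  have : ∀ᶠ x in 𝓝 (0 : ℝ), F x ≤ c := hcont.continuousAt.eventually_le_const hc1
  obtain ⟨ρ, hρ, hball⟩ := Metric.eventually_nhds_iff.1 this
  refine ⟨c / mu0 β ^ 2, div_pos (hF0'.trans hc1) (by positivity), ?_, min (ρ / 2) 1,
    by positivity, min_le_right _ _, ?_⟩
  · rw [div_lt_one (by positivity)]; exact hc2
  · intro x y hx h1 h2 a
    rw [div_mul_cancel₀ _ (by positivity)]
    refine (sum_norm_transfer_sq_le β hδ.le h1 h2 a).trans (hball ?_)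
    rw [Real.dist_eq, sub_zero]
    have := hx.trans (min_le_left _ _)
    linarith

lemma exists_norm_genFn_le_const (β : ℝ) (n : ℕ) (f : Config → ℝ) :
    ∃ M : ℝ, 0 ≤ M ∧ ∀ x y : ℝ, |x| ≤ 1 → ∀ a b, ‖genFn β n f (x + y * Complex.I) a b‖ ≤ M := by
  set F : Bool → Bool → ℝ := fun a b => ∑ A ∈ (box n).powerset,
      |f (indicatorConfig A) * Real.exp (-energy β n (indicatorConfig A) (bdry a b))| *
        Real.exp |blockSum n (indicatorConfig A)| with hF
  have hF0 : ∀ a b, 0 ≤ F a b := fun a b => Finset.sum_nonneg fun _ _ => by positivity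
  have h : ∀ x y : ℝ, |x| ≤ 1 → ∀ a b, ‖genFn β n f (x + y * Complex.I) a b‖ ≤ F a b := by
    intro x y hx a b
    refine (norm_sum_le _ _).trans (Finset.sum_le_sum fun A _ => ?_)
    rw [norm_mul, Complex.norm_real, Real.norm_eq_abs, Complex.norm_exp]
    refine mul_le_mul_of_nonneg_left (Real.exp_le_exp.2 ?_) (abs_nonneg _)
    simp only [Complex.mul_re, Complex.add_re, Complex.ofReal_re, Complex.I_re, mul_zero,
      Complex.ofReal_im, Complex.I_im, mul_one, sub_self, add_zero, sub_zero]
    refine (le_abs_self _).trans ?_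
    rw [abs_mul]
    exact mul_le_of_le_one_left (abs_nonneg _) hx
  refine ⟨F true true + F true false + F false true + F false false, ?_, fun x y hx a b =>
    (h x y hx a b).trans ?_⟩
  · linarith [hF0 true true, hF0 true false, hF0 false true, hF0 false false]
  · have := hF0 true true; have := hF0 true false
    have := hF0 false true; have := hF0 false false
    cases a <;> cases b <;> linarith

lemma sum_norm_transfer_le (β : ℝ) {x y : ℝ} (hx : |x| ≤ 1) (a : Bool) :
    ∑ c, ‖transfer β (x + y * Complex.I) a c‖ ≤ mu0 β * Real.exp 1 := by
  have hp := bondEq_pos β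
  have hr := bondNe_pos β
  have h : ∀ c, ‖transfer β (x + y * Complex.I) a c‖ ≤
      (if a = c then bondEq β else bondNe β) * Real.exp 1 := by
    intro c
    rw [transfer_apply, norm_mul]
    have := abs_le.1 hx
    gcongr
    · split_ifs <;> simp [abs_of_pos hp, abs_of_pos hr]
    · split_ifs <;> rw [Complex.norm_exp] <;> apply Real.exp_le_exp.2 <;> simp <;> linarith
  refine (Finset.sum_le_sum fun c _ => h c).trans (le_of_eq ?_)
  rw [← Finset.sum_mul]
  unfold mu0
  cases a <;> simp [add_comm]

/-- At imaginary tilts bounded away from zero, the generating functions are exponentially smaller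
than at tilt zero. -/
lemma exists_norm_genFn_le (β : ℝ) (l : ℕ) {f : Config → ℝ} (hf : DependsOn f (box l : Set ℤ))
    {δ : ℝ} (hδ : 0 < δ) (hδ' : δ ≤ Real.pi) :
    ∃ κ : ℝ, 0 < κ ∧ κ < 1 ∧ ∃ x₀ : ℝ, 0 < x₀ ∧ ∃ D : ℝ, 0 ≤ D ∧ ∀ x y : ℝ, |x| ≤ x₀ → δ ≤ |y| →
      |y| ≤ Real.pi → ∀ n, l ≤ n → ∀ a b, ‖genFn β n f (x + y * Complex.I) a b‖ ≤
        D * bulk β n * κ ^ n := by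
  obtain ⟨κ, hκ, hκ1, x₀, hx₀, hx₀', H⟩ := exists_sum_norm_transfer_sq_le β hδ hδ'
  have hm := mu0_pos β
  set ρ : ℝ := √κ * mu0 β with hρ
  have hρ0 : 0 < ρ := mul_pos (Real.sqrt_pos.2 hκ) hm
  have hρ2 : ρ ^ 2 = κ * mu0 β ^ 2 := by rw [hρ, mul_pow, Real.sq_sqrt hκ.le]
  set K : ℝ := 1 + mu0 β * Real.exp 1 / ρ with hK
  have hK0 : 0 < K := by positivity
  obtain ⟨M, hM0, hM⟩ := exists_norm_genFn_le_const β l f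
  refine ⟨κ, hκ, hκ1, x₀, hx₀, K ^ 2 * M * (2 / (mu0 β ^ (2 * l + 2) * κ ^ l)), by positivity, ?_⟩
  intro x y hx h1 h2 n hn a b
  obtain ⟨m, rfl⟩ := Nat.exists_eq_add_of_le hn
  set L := transfer β (x + y * Complex.I) with hL
  have hrow : ∀ a, ∑ c, ‖(L ^ m) a c‖ ≤ ρ ^ m * K := by
    intro a
    have hsq := fun j => sum_norm_pow_apply_le (H x y hx h1 h2) j
    rcases Nat.even_or_odd' m with ⟨j, rfl | rfl⟩
    · rw [pow_mul, pow_mul, hρ2]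
      refine (hsq j a).trans (le_mul_of_one_le_right (by positivity) ?_)
      rw [hK]
      have : 0 ≤ mu0 β * Real.exp 1 / ρ := by positivity
      linarith
    · rw [pow_succ L, pow_mul L]
      refine (sum_norm_mul_apply_le (hsq j)
        (sum_norm_transfer_le β (hx.trans hx₀')) a).trans ?_
      rw [← hρ2, ← pow_mul, pow_succ ρ, mul_assoc]
      refine mul_le_mul_of_nonneg_left ?_ (by positivity)
      rw [hK, mul_add, mul_one, mul_div_cancel₀ _ hρ0.ne']
      linarith
  have hX : ∀ a b, ‖genFn β l f (x + y * Complex.I) a b‖ ≤ M := fun a b =>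
    hM x y (hx.trans hx₀') a b
  rw [genFn_add β l m hf]
  have hexp : ‖(L ^ m * genFn β l f (x + y * Complex.I) * (L ^ m).transpose) a b‖ ≤
      (∑ c, ‖(L ^ m) a c‖) * M * ∑ d, ‖(L ^ m) b d‖ := by
    simp only [Matrix.mul_apply, Matrix.transpose_apply, Finset.sum_mul, Finset.mul_sum]
    refine (norm_sum_le _ _).trans ?_
    refine Finset.sum_le_sum fun d _ => (norm_sum_le _ _).trans (Finset.sum_le_sum fun c _ => ?_)
    rw [norm_mul, norm_mul]
    gcongr
    exact hX _ _
  refine hexp.trans ?_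
  calc _ ≤ (ρ ^ m * K) * M * (ρ ^ m * K) := by
        gcongr
        · exact hrow a
        · exact hrow b
    _ = (ρ ^ 2) ^ m * (K ^ 2 * M) := by rw [← pow_mul]; ring
    _ = _ := by
      unfold bulk
      rw [hρ2, mul_pow, ← pow_mul, show 2 * (l + m) + 2 = 2 * l + 2 + 2 * m by ring,
        pow_add _ (2 * l + 2), pow_add _ l]
      field_simp

end SpeedChange

namespace SpeedChange

/-! ### Ratios of nearly Gaussian integrals -/

lemma pow_le_mul_exp_sq {b : ℝ} (hb : 0 < b) (j : ℕ) (x : ℝ) :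
    x ^ j ≤ (1 + j.factorial / b ^ j) * Real.exp (b * x ^ 2) := by
  have h1 : x ^ j ≤ 1 + x ^ (2 * j) := by
    rw [mul_comm, pow_mul]; nlinarith [sq_nonneg (x ^ j - 1)]
  have h2 := Real.pow_div_factorial_le_exp (b * x ^ 2) (by positivity) j
  have h3 : x ^ (2 * j) = j.factorial / b ^ j * ((b * x ^ 2) ^ j / j.factorial) := by
    have : (j.factorial : ℝ) ≠ 0 := by positivity
    rw [mul_pow, pow_mul]; field_simp
  have h4 : 1 ≤ Real.exp (b * x ^ 2) := Real.one_le_exp (by positivity)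
  calc x ^ j ≤ 1 + x ^ (2 * j) := h1
    _ ≤ Real.exp (b * x ^ 2) + j.factorial / b ^ j * Real.exp (b * x ^ 2) := by
        rw [h3]; gcongr
    _ = _ := by ring

/-- Powers of `θ` cost powers of `N^{-1/2}` against a Gaussian. -/
lemma abs_pow_mul_exp_le {b N : ℝ} (hb : 0 < b) (hN : 0 < N) (j : ℕ) (θ : ℝ) :
    |θ| ^ j * Real.exp (-(b * N * θ ^ 2)) ≤
      (1 + j.factorial / (b / 2) ^ j) * (1 / √N) ^ j * Real.exp (-(b / 2 * N * θ ^ 2)) := by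
  have hs : 0 < √N := Real.sqrt_pos.2 hN
  have h := pow_le_mul_exp_sq (half_pos hb) j (√N * |θ|)
  have e1 : |θ| ^ j = (1 / √N) ^ j * (√N * |θ|) ^ j := by
    rw [← mul_pow]; congr 1; field_simp
  have e2 : (√N * |θ|) ^ 2 = N * θ ^ 2 := by rw [mul_pow, Real.sq_sqrt hN.le, sq_abs]
  rw [e2] at h
  have e3 : Real.exp (-(b / 2 * N * θ ^ 2)) =
      Real.exp (b / 2 * (N * θ ^ 2)) * Real.exp (-(b * N * θ ^ 2)) := by
    rw [← Real.exp_add]; congr 1; ring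
  rw [e1, e3]
  calc _ ≤ (1 / √N) ^ j * ((1 + j.factorial / (b / 2) ^ j) * Real.exp (b / 2 * (N * θ ^ 2))) *
        Real.exp (-(b * N * θ ^ 2)) := by gcongr
    _ = _ := by ring

lemma integral_exp_neg_le {b N : ℝ} (hb : 0 < b) (hN : 0 < N) :
    ∫ θ in -Real.pi..Real.pi, Real.exp (-(b * N * θ ^ 2)) ≤ √(Real.pi / b) * (1 / √N) := by
  have hpi := Real.pi_pos
  have hint : Integrable fun θ : ℝ => Real.exp (-(b * N) * θ ^ 2) :=
    integrable_exp_neg_mul_sq (mul_pos hb hN)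
  have h1 := integral_gaussian (b * N)
  rw [intervalIntegral.integral_of_le (by linarith)]
  have h2 : ∫ θ in Set.Ioc (-Real.pi) Real.pi, Real.exp (-(b * N) * θ ^ 2) ≤
      ∫ θ : ℝ, Real.exp (-(b * N) * θ ^ 2) :=
    setIntegral_le_integral hint (Eventually.of_forall fun _ => (Real.exp_pos _).le)
  rw [h1] at h2
  simp only [neg_mul] at h2
  refine h2.trans (le_of_eq ?_)
  rw [← div_div, Real.sqrt_div (by positivity)]
  ring

lemma norm_integral_le_gaussian {b N A B : ℝ} (hb : 0 < b) (hN : 0 < N) (hA : 0 ≤ A)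
    {F : ℝ → ℂ} (h : ∀ θ ∈ Set.Icc (-Real.pi) Real.pi,
      ‖F θ‖ ≤ A * Real.exp (-(b * N * θ ^ 2)) + B) :
    ‖∫ θ in -Real.pi..Real.pi, F θ‖ ≤ A * √(Real.pi / b) * (1 / √N) + 2 * Real.pi * B := by
  have hpi := Real.pi_pos
  have hc : Continuous fun θ : ℝ => A * Real.exp (-(b * N * θ ^ 2)) + B := by fun_prop
  have hc' : Continuous fun θ : ℝ => A * Real.exp (-(b * N * θ ^ 2)) := by fun_prop
  refine (intervalIntegral.norm_integral_le_of_norm_le (by linarith)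
    (Eventually.of_forall fun θ hθ => h θ ⟨hθ.1.le, hθ.2⟩)
    (hc.intervalIntegrable _ _)).trans ?_
  rw [intervalIntegral.integral_add (hc'.intervalIntegrable _ _) (by simp),
    intervalIntegral.integral_const_mul, intervalIntegral.integral_const, mul_assoc]
  have := mul_le_mul_of_nonneg_left (integral_exp_neg_le hb hN) hA
  rw [smul_eq_mul]
  linarith

lemma le_integral_exp_neg {c N : ℝ} (hc : 0 < c) (hN : 1 ≤ N) :
    2 * Real.exp (-c) * (1 / √N) ≤ ∫ θ in -Real.pi..Real.pi, Real.exp (-(c * N * θ ^ 2)) := by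
  have hpi := Real.pi_gt_three
  have hs : 1 ≤ √N := Real.one_le_sqrt.2 hN
  have hs' : 0 < 1 / √N := by positivity
  have hs1 : 1 / √N ≤ 1 := by rw [div_le_one (by positivity)]; exact hs
  have hcont : Continuous fun θ : ℝ => Real.exp (-(c * N * θ ^ 2)) := by fun_prop
  have h1 : ∫ θ in -(1 / √N)..(1 / √N), Real.exp (-(c * N * θ ^ 2)) ≤
      ∫ θ in -Real.pi..Real.pi, Real.exp (-(c * N * θ ^ 2)) :=
    intervalIntegral.integral_mono_interval (by linarith) (by linarith) (by linarith)
      (Eventually.of_forall fun _ => (Real.exp_pos _).le) (hcont.intervalIntegrable _ _)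
  refine le_trans ?_ h1
  have h2 : ∫ _ in -(1 / √N)..(1 / √N), Real.exp (-c) ≤
      ∫ θ in -(1 / √N)..(1 / √N), Real.exp (-(c * N * θ ^ 2)) := by
    refine intervalIntegral.integral_mono_on (by linarith) (by simp)
      (hcont.intervalIntegrable _ _) fun θ hθ => ?_
    apply Real.exp_le_exp.2
    have h3 : θ ^ 2 ≤ (1 / √N) ^ 2 := sq_le_sq' hθ.1 hθ.2
    rw [div_pow, Real.sq_sqrt (by linarith), one_pow] at h3
    have h4 : N * θ ^ 2 ≤ 1 := by
      have := mul_le_mul_of_nonneg_left h3 (by linarith : 0 ≤ N)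
      rwa [mul_one_div_cancel (by linarith)] at this
    nlinarith
  refine le_trans (le_of_eq ?_) h2
  rw [intervalIntegral.integral_const, smul_eq_mul]; ring

lemma integral_mul_exp_neg_eq_zero (c : ℝ) :
    ∫ θ in -Real.pi..Real.pi, (θ : ℂ) * (Real.exp (-(c * θ ^ 2)) : ℂ) = 0 := by
  have h := intervalIntegral.integral_comp_neg (a := -Real.pi) (b := Real.pi)
    (fun θ : ℝ => (θ : ℂ) * (Real.exp (-(c * θ ^ 2)) : ℂ))
  simp only [neg_neg, neg_sq, Complex.ofReal_neg, neg_mul, intervalIntegral.integral_neg] at h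
  have h2 : (2 : ℂ) * ∫ θ in -Real.pi..Real.pi, (θ : ℂ) * (Real.exp (-(c * θ ^ 2)) : ℂ) = 0 := by
    linear_combination -h
  simpa using h2

lemma integral_sq_sub_mul_exp_neg {a : ℝ} (ha : 0 < a) :
    ∫ θ in -Real.pi..Real.pi, (((θ ^ 2 - 1 / a) * Real.exp (-(a / 2 * θ ^ 2)) : ℝ) : ℂ) =
      ((-(2 * Real.pi / a * Real.exp (-(a / 2 * Real.pi ^ 2))) : ℝ) : ℂ) := by
  rw [intervalIntegral.integral_ofReal]
  congr 1
  have hd : ∀ θ ∈ Set.uIcc (-Real.pi) Real.pi,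
      HasDerivAt (fun θ : ℝ => -(θ / a * Real.exp (-(a / 2 * θ ^ 2))))
        ((θ ^ 2 - 1 / a) * Real.exp (-(a / 2 * θ ^ 2))) θ := by
    intro θ _
    have h1 : HasDerivAt (fun θ : ℝ => -(a / 2 * θ ^ 2)) (-(a * θ)) θ := by
      refine (((hasDerivAt_pow 2 θ).const_mul (a / 2)).neg).congr_deriv ?_
      simp; ring
    refine ((((hasDerivAt_id θ).div_const a).mul h1.exp).neg).congr_deriv ?_
    simp only [id]
    field_simp
    ring
  have hc : Continuous fun θ : ℝ => (θ ^ 2 - 1 / a) * Real.exp (-(a / 2 * θ ^ 2)) := by fun_prop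
  rw [intervalIntegral.integral_eq_sub_of_hasDerivAt hd (hc.intervalIntegrable _ _)]
  simp only [neg_sq]
  ring

set_option maxHeartbeats 1000000 in
/-- Moments along a vertical line `w = x + iθ` of a density that is Gaussian up to a relative
error `ε ≥ N^{-1/2}`. -/
theorem exists_gaussian_moment_ratio {τ b C : ℝ} (hτ : 0 < τ) (hb : 0 < b) (hC : 0 ≤ C) :
    ∃ K ε₀ : ℝ, 0 < K ∧ 0 < ε₀ ∧ ∀ (N x ε : ℝ) (Φ : ℝ → ℂ), 1 ≤ N → 1 / √N ≤ ε → |x| ≤ ε →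
      ε ≤ ε₀ → Continuous Φ →
      (∀ θ ∈ Set.Icc (-Real.pi) Real.pi, ‖Φ θ - (Real.exp (-(τ / 2 * N * θ ^ 2)) : ℂ)‖ ≤
        C * (ε * Real.exp (-(b * N * θ ^ 2)) + (1 / √N) ^ 4)) →
      1 / √N ≤ K * ‖∫ θ in -Real.pi..Real.pi, Φ θ‖ ∧
      ‖(∫ θ in -Real.pi..Real.pi, (x + θ * Complex.I) * Φ θ) /
        (∫ θ in -Real.pi..Real.pi, Φ θ) - x‖ ≤ K * ε ^ 2 ∧
      ‖(∫ θ in -Real.pi..Real.pi, (x + θ * Complex.I) ^ 2 * Φ θ) /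
        (∫ θ in -Real.pi..Real.pi, Φ θ) - (x ^ 2 - 1 / (N * τ))‖ ≤ K * ε ^ 3 := by
  have hpi := Real.pi_pos
  set A₀ : ℝ := √(Real.pi / b) with hA₀
  set A : ℝ := √(Real.pi / (b / 2)) with hA
  set P₁ : ℝ := 1 + (Nat.factorial 1 : ℝ) / (b / 2) ^ 1 with hP₁
  set P₂ : ℝ := 1 + (Nat.factorial 2 : ℝ) / (b / 2) ^ 2 with hP₂
  have hP₁0 : 0 ≤ P₁ := by positivity
  have hP₂0 : 0 ≤ P₂ := by positivity
  set C₀ : ℝ := C * (A₀ + 2 * Real.pi) with hC₀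
  set C₁ : ℝ := C * (P₁ * A + 2 * Real.pi ^ 2) with hC₁
  set C₂ : ℝ := C * (P₂ * A + A₀ / τ + 2 * Real.pi * (Real.pi ^ 2 + 1 / τ)) +
    4 / (τ ^ 2 * Real.pi) with hC₂
  set c : ℝ := Real.exp (-(τ / 2)) with hc
  have hc0 : 0 < c := Real.exp_pos _
  have hC₀0 : 0 ≤ C₀ := by positivity
  have hC₁0 : 0 ≤ C₁ := by positivity
  have hC₂0 : 0 ≤ C₂ := by positivity
  refine ⟨(1 + C₁ + 2 * C₁ + C₂) / c, c / (C₀ + 1), by positivity, by positivity, ?_⟩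
  intro N x ε Φ hN hsε hx hε hΦ hH
  have hN0 : 0 < N := by linarith
  have hsq : 0 < √N := Real.sqrt_pos.2 hN0
  set s : ℝ := 1 / √N with hs
  have hs0 : 0 < s := by positivity
  have hs1 : s ≤ 1 := by
    rw [hs, div_le_one hsq]; exact Real.one_le_sqrt.2 hN
  have hε0 : 0 < ε := hs0.trans_le hsε
  have hNs : N * s ^ 2 = 1 := by
    rw [hs, div_pow, Real.sq_sqrt hN0.le, one_pow, mul_one_div_cancel hN0.ne']
  have hNs' : 1 / (N * τ) = s ^ 2 / τ := by
    rw [hs, div_pow, Real.sq_sqrt hN0.le, one_pow, div_div]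
  -- powers of `s` are absorbed by `ε`
  have hs4 : s ^ 4 ≤ ε * s ^ 3 := by
    rw [show s ^ 4 = s * s ^ 3 by ring]; gcongr
  have hs3 : s ^ 3 ≤ s ^ 2 := pow_le_pow_of_le_one hs0.le hs1 (by norm_num)
  have hs2 : s ^ 2 ≤ s := by nlinarith
  have hs42 : s ^ 4 ≤ ε * s ^ 2 := hs4.trans (by gcongr)
  have hs41 : s ^ 4 ≤ ε * s := hs42.trans (by gcongr)
  set g : ℝ → ℂ := fun θ => (Real.exp (-(τ / 2 * N * θ ^ 2)) : ℂ) with hg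
  have hgc : Continuous g := by
    have : Continuous fun θ : ℝ => Real.exp (-(τ / 2 * N * θ ^ 2)) := by fun_prop
    exact Complex.continuous_ofReal.comp this
  have hii : ∀ {F : ℝ → ℂ}, Continuous F → IntervalIntegrable F volume (-Real.pi) Real.pi :=
    fun h => h.intervalIntegrable _ _
  -- the total mass
  set J : ℂ := ∫ θ in -Real.pi..Real.pi, Φ θ with hJ
  have hJg : ‖J - ∫ θ in -Real.pi..Real.pi, g θ‖ ≤ C₀ * (ε * s) := by
    rw [hJ, ← intervalIntegral.integral_sub (hii hΦ) (hii hgc)]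
    refine (norm_integral_le_gaussian (A := C * ε) (B := C * s ^ 4) hb hN0 (by positivity)
      fun θ hθ => ?_).trans ?_
    · have := hH θ hθ
      rw [mul_add, ← mul_assoc] at this
      linarith
    · calc C * ε * A₀ * s + 2 * Real.pi * (C * s ^ 4) ≤
          C * ε * A₀ * s + 2 * Real.pi * (C * (ε * s)) := by gcongr
        _ = C₀ * (ε * s) := by rw [hC₀]; ring
  have hgl : 2 * c * s ≤ ‖∫ θ in -Real.pi..Real.pi, g θ‖ := by
    have h1 := le_integral_exp_neg (half_pos hτ) hN
    rw [hg, intervalIntegral.integral_ofReal, Complex.norm_real, Real.norm_eq_abs]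
    exact h1.trans (le_abs_self _)
  have hJl : c * s ≤ ‖J‖ := by
    have h1 : C₀ * (ε * s) ≤ c * s := by
      rw [← mul_assoc]
      gcongr
      have : ε * (C₀ + 1) ≤ c := by rwa [le_div_iff₀ (by positivity)] at hε
      nlinarith
    have h2 := norm_sub_norm_le (∫ θ in -Real.pi..Real.pi, g θ) J
    rw [norm_sub_rev] at h2
    linarith
  have hJ0 : J ≠ 0 := by
    rw [← norm_pos_iff]; exact (mul_pos hc0 hs0).trans_le hJl
  -- the first moment
  set T₁ : ℂ := ∫ θ in -Real.pi..Real.pi, (θ : ℂ) * Φ θ with hT₁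
  have hT₁l : ‖T₁‖ ≤ C₁ * (ε * s ^ 2) := by
    have h0 : ∫ θ in -Real.pi..Real.pi, (θ : ℂ) * g θ = 0 :=
      integral_mul_exp_neg_eq_zero (τ / 2 * N)
    rw [← sub_zero T₁, ← h0, hT₁, ← intervalIntegral.integral_sub (hii (by fun_prop))
      (hii (by fun_prop))]
    refine (norm_integral_le_gaussian (b := b / 2) (A := C * ε * (P₁ * s))
      (B := C * s ^ 4 * Real.pi) (half_pos hb) hN0 (by positivity) fun θ hθ => ?_).trans ?_
    · rw [← mul_sub, norm_mul, Complex.norm_real, Real.norm_eq_abs]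
      have h1 : |θ| * Real.exp (-(b * N * θ ^ 2)) ≤
          P₁ * s * Real.exp (-(b / 2 * N * θ ^ 2)) := by
        have := abs_pow_mul_exp_le hb hN0 1 θ
        rwa [pow_one |θ|, pow_one (1 / √N)] at this
      have h2 : |θ| ≤ Real.pi := abs_le.2 hθ
      calc |θ| * ‖Φ θ - g θ‖ ≤ |θ| * (C * (ε * Real.exp (-(b * N * θ ^ 2)) + s ^ 4)) := by
            gcongr; exact hH θ hθ
        _ = C * ε * (|θ| * Real.exp (-(b * N * θ ^ 2))) + C * s ^ 4 * |θ| := by ring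
        _ ≤ C * ε * (P₁ * s * Real.exp (-(b / 2 * N * θ ^ 2))) + C * s ^ 4 * Real.pi :=
            add_le_add (mul_le_mul_of_nonneg_left h1 (by positivity)) (by gcongr)
        _ = _ := by ring
    · calc C * ε * (P₁ * s) * A * s + 2 * Real.pi * (C * s ^ 4 * Real.pi) ≤
          C * ε * (P₁ * s) * A * s + 2 * Real.pi * (C * (ε * s ^ 2) * Real.pi) := by gcongr
        _ = C₁ * (ε * s ^ 2) := by rw [hC₁]; ring
  -- the second moment
  set T₂ : ℂ := ∫ θ in -Real.pi..Real.pi, (θ : ℂ) ^ 2 * Φ θ with hT₂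
  have hT₂l : ‖T₂ - (s ^ 2 / τ : ℝ) * J‖ ≤ C₂ * (ε * s ^ 3) := by
    have h0 : ‖∫ θ in -Real.pi..Real.pi, ((θ : ℂ) ^ 2 - (s ^ 2 / τ : ℝ)) * g θ‖ ≤
        4 / (τ ^ 2 * Real.pi) * (ε * s ^ 3) := by
      have h1 := integral_sq_sub_mul_exp_neg (a := N * τ) (by positivity)
      have h2 : ∀ θ : ℝ, ((θ : ℂ) ^ 2 - (s ^ 2 / τ : ℝ)) * g θ =
          (((θ ^ 2 - 1 / (N * τ)) * Real.exp (-(N * τ / 2 * θ ^ 2)) : ℝ) : ℂ) := by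
        intro θ
        rw [hNs', hg]
        push_cast
        congr 2; ring
      simp only [h2]
      rw [h1, Complex.norm_real, norm_neg, Real.norm_eq_abs, abs_of_pos (by positivity)]
      have h3 : Real.exp (-(N * τ / 2 * Real.pi ^ 2)) ≤ 1 / (N * τ / 2 * Real.pi ^ 2) := by
        rw [Real.exp_neg, ← one_div]
        apply one_div_le_one_div_of_le (by positivity)
        linarith [Real.add_one_le_exp (N * τ / 2 * Real.pi ^ 2)]
      calc 2 * Real.pi / (N * τ) * Real.exp (-(N * τ / 2 * Real.pi ^ 2)) ≤
            2 * Real.pi / (N * τ) * (1 / (N * τ / 2 * Real.pi ^ 2)) := by gcongr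
        _ = 4 / (τ ^ 2 * Real.pi) * (1 / N) ^ 2 := by field_simp; ring
        _ = 4 / (τ ^ 2 * Real.pi) * s ^ 4 := by
            rw [show 1 / N = s ^ 2 by field_simp; linarith]; ring
        _ ≤ _ := by gcongr
    have hsplit : T₂ - (s ^ 2 / τ : ℝ) * J =
        (∫ θ in -Real.pi..Real.pi, ((θ : ℂ) ^ 2 - (s ^ 2 / τ : ℝ)) * (Φ θ - g θ)) +
        ∫ θ in -Real.pi..Real.pi, ((θ : ℂ) ^ 2 - (s ^ 2 / τ : ℝ)) * g θ := by
      rw [hT₂, hJ, ← intervalIntegral.integral_const_mul,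
        ← intervalIntegral.integral_sub (hii (by fun_prop)) (hii (by fun_prop)),
        ← intervalIntegral.integral_add (hii (by fun_prop)) (hii (by fun_prop))]
      congr 1
      ext θ
      ring
    rw [hsplit]
    refine (norm_add_le _ _).trans ?_
    rw [hC₂, add_mul]
    refine add_le_add ?_ h0
    have hsplit2 : ∫ θ in -Real.pi..Real.pi, ((θ : ℂ) ^ 2 - (s ^ 2 / τ : ℝ)) * (Φ θ - g θ) =
        (∫ θ in -Real.pi..Real.pi, (θ : ℂ) ^ 2 * (Φ θ - g θ)) -
          (s ^ 2 / τ : ℝ) * ∫ θ in -Real.pi..Real.pi, (Φ θ - g θ) := by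
      rw [← intervalIntegral.integral_const_mul,
        ← intervalIntegral.integral_sub (hii (by fun_prop)) (hii (by fun_prop))]
      congr 1
      ext θ
      ring
    have hI1 : ‖∫ θ in -Real.pi..Real.pi, (Φ θ - g θ)‖ ≤ C * (A₀ + 2 * Real.pi) * (ε * s) := by
      rw [intervalIntegral.integral_sub (hii hΦ) (hii hgc)]; exact hJg
    have hI2 : ‖∫ θ in -Real.pi..Real.pi, (θ : ℂ) ^ 2 * (Φ θ - g θ)‖ ≤
        C * (P₂ * A + 2 * Real.pi * Real.pi ^ 2) * (ε * s ^ 3) := by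
      refine (norm_integral_le_gaussian (b := b / 2) (A := C * ε * (P₂ * s ^ 2))
        (B := C * s ^ 4 * Real.pi ^ 2) (half_pos hb) hN0 (by positivity) fun θ hθ => ?_).trans ?_
      · rw [norm_mul, norm_pow, Complex.norm_real, Real.norm_eq_abs]
        have h1 : |θ| ^ 2 * Real.exp (-(b * N * θ ^ 2)) ≤
            P₂ * s ^ 2 * Real.exp (-(b / 2 * N * θ ^ 2)) := abs_pow_mul_exp_le hb hN0 2 θ
        have h2 : |θ| ≤ Real.pi := abs_le.2 hθ
        calc |θ| ^ 2 * ‖Φ θ - g θ‖ ≤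
              |θ| ^ 2 * (C * (ε * Real.exp (-(b * N * θ ^ 2)) + s ^ 4)) := by
              gcongr; exact hH θ hθ
          _ = C * ε * (|θ| ^ 2 * Real.exp (-(b * N * θ ^ 2))) + C * s ^ 4 * |θ| ^ 2 := by ring
          _ ≤ C * ε * (P₂ * s ^ 2 * Real.exp (-(b / 2 * N * θ ^ 2))) +
                C * s ^ 4 * Real.pi ^ 2 :=
              add_le_add (mul_le_mul_of_nonneg_left h1 (by positivity)) (by gcongr)
          _ = _ := by ring
      · calc C * ε * (P₂ * s ^ 2) * A * s + 2 * Real.pi * (C * s ^ 4 * Real.pi ^ 2) ≤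
            C * ε * (P₂ * s ^ 2) * A * s + 2 * Real.pi * (C * (ε * s ^ 3) * Real.pi ^ 2) := by
              gcongr
          _ = C * (P₂ * A + 2 * Real.pi * Real.pi ^ 2) * (ε * s ^ 3) := by ring
    rw [hsplit2]
    refine (norm_sub_le _ _).trans ?_
    rw [norm_mul, Complex.norm_real, Real.norm_eq_abs, abs_of_pos (by positivity)]
    calc _ ≤ C * (P₂ * A + 2 * Real.pi * Real.pi ^ 2) * (ε * s ^ 3) +
          s ^ 2 / τ * (C * (A₀ + 2 * Real.pi) * (ε * s)) := by gcongr
      _ = _ := by ring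
  have hJ1 : ∫ θ in -Real.pi..Real.pi, (x + θ * Complex.I) * Φ θ = x * J + Complex.I * T₁ := by
    rw [hT₁, hJ, ← intervalIntegral.integral_const_mul, ← intervalIntegral.integral_const_mul,
      ← intervalIntegral.integral_add (hii (by fun_prop)) (hii (by fun_prop))]
    congr 1
    ext θ
    ring
  have hJ2 : ∫ θ in -Real.pi..Real.pi, (x + θ * Complex.I) ^ 2 * Φ θ =
      x ^ 2 * J + 2 * Complex.I * x * T₁ - T₂ := by
    rw [hT₁, hT₂, hJ, ← intervalIntegral.integral_const_mul, ← intervalIntegral.integral_const_mul,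
      ← intervalIntegral.integral_add (hii (by fun_prop)) (hii (by fun_prop)),
      ← intervalIntegral.integral_sub (hii (by fun_prop)) (hii (by fun_prop))]
    congr 1
    ext θ
    linear_combination (θ : ℂ) ^ 2 * Φ θ * Complex.I_sq
  have hdiv : ∀ {z : ℂ} {B t : ℝ}, ‖z‖ ≤ B * (t * s) → 0 ≤ B → 0 ≤ t →
      B ≤ 1 + C₁ + 2 * C₁ + C₂ → ‖z / J‖ ≤ (1 + C₁ + 2 * C₁ + C₂) / c * t := by
    intro z B t hz hB ht hB'
    rw [norm_div, div_le_iff₀ (norm_pos_iff.2 hJ0)]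
    calc ‖z‖ ≤ B * (t * s) := hz
      _ ≤ (1 + C₁ + 2 * C₁ + C₂) * (t * s) := by gcongr
      _ = (1 + C₁ + 2 * C₁ + C₂) / c * t * (c * s) := by field_simp
      _ ≤ _ := by gcongr
  refine ⟨?_, ?_, ?_⟩
  · rw [div_mul_eq_mul_div, le_div_iff₀ hc0]
    nlinarith [norm_nonneg J]
  · rw [hJ1, show (x * J + Complex.I * T₁) / J - x = Complex.I * T₁ / J by field_simp; ring]
    refine hdiv (B := C₁) ?_ hC₁0 (by positivity) (by linarith)
    rw [norm_mul, Complex.norm_I, one_mul]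
    calc ‖T₁‖ ≤ C₁ * (ε * s * s) := hT₁l.trans_eq (by ring)
      _ ≤ C₁ * (ε * ε * s) := by gcongr
      _ = C₁ * (ε ^ 2 * s) := by ring
  · have e : (x ^ 2 * J + 2 * Complex.I * x * T₁ - T₂) / J - (x ^ 2 - 1 / (N * τ)) =
        (2 * Complex.I * x * T₁ - (T₂ - (s ^ 2 / τ : ℝ) * J)) / J := by
      have : (1 / (N * τ) : ℂ) = ((s ^ 2 / τ : ℝ) : ℂ) := by rw [← hNs']; push_cast; rfl
      rw [this]
      field_simp
      ring
    rw [hJ2, e]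
    refine hdiv (B := 2 * C₁ + C₂) ?_ (by positivity) (by positivity) (by linarith)
    refine (norm_sub_le _ _).trans ?_
    have h1 : ‖2 * Complex.I * x * T₁‖ ≤ 2 * ε * (C₁ * (ε * s ^ 2)) := by
      rw [norm_mul, norm_mul, norm_mul, Complex.norm_I, Complex.norm_real, Real.norm_eq_abs]
      simp only [Complex.norm_ofNat, mul_one]
      gcongr
    calc _ ≤ 2 * ε * (C₁ * (ε * s ^ 2)) + C₂ * (ε * s ^ 3) := add_le_add h1 hT₂l
      _ = 2 * C₁ * (ε ^ 2 * s * s) + C₂ * (ε * s * s * s) := by ring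
      _ ≤ 2 * C₁ * (ε ^ 2 * ε * s) + C₂ * (ε * ε * ε * s) := by gcongr
      _ = _ := by ring

end SpeedChange

namespace SpeedChange

/-! ### Fourier inversion at the saddle point -/

/-- The tilt at which the mean total spin of `Λ_n` is `S`, to leading order. -/
noncomputable def saddle (β : ℝ) (n : ℕ) (S : ℝ) : ℝ := S / (susc β * vol n)

lemma saddle_mul (β : ℝ) (n : ℕ) (S : ℝ) : S = vol n * susc β * saddle β n S := by
  have := (susc_pos β).ne'
  have := (vol_pos n).ne'
  unfold saddle; field_simp

/-- The normalized integrand of the Fourier inversion formula for `{∑_{x ∈ Λ_n} (η(x) - 1/2) = S}`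
along the vertical line through the saddle point. -/
noncomputable def profile (β : ℝ) (n : ℕ) (f : Config → ℝ) (a b : Bool) (S θ : ℝ) : ℂ :=
  genFn β n f (saddle β n S + θ * Complex.I) a b *
    (Complex.exp (-(saddle β n S + θ * Complex.I) * S) *
      Complex.exp (vol n * (susc β / 2 * saddle β n S ^ 2))) / bulk β n

/-- `ε` bounds `N^{-1/2}` and the saddle point `x`, as well as the cubic error `N |x|³`. -/
def IsScale (β : ℝ) (n : ℕ) (S ε : ℝ) : Prop :=
  1 / √(vol n) ≤ ε ∧ |saddle β n S| ≤ ε ∧ vol n * |saddle β n S| ^ 3 ≤ ε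

lemma one_le_vol (n : ℕ) : 1 ≤ vol n := by
  unfold vol
  have : (0 : ℝ) ≤ n := n.cast_nonneg
  linarith

lemma exists_pow_le_inv_sqrt_vol {q : ℝ} (hq : 0 < q) (hq1 : q < 1) :
    ∃ C : ℝ, 0 < C ∧ ∀ n : ℕ, q ^ n ≤ C * (1 / √(vol n)) ^ 4 := by
  have h := tendsto_pow_const_mul_const_pow_of_abs_lt_one 2 (abs_lt.2 ⟨by linarith, hq1⟩)
  obtain ⟨B, hB⟩ := h.bddAbove_range
  refine ⟨9 * (|B| + 1), by positivity, fun n => ?_⟩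
  have h4 : (1 / √(vol n)) ^ 4 = 1 / vol n ^ 2 := by
    rw [div_pow, one_pow, show (√(vol n)) ^ 4 = ((√(vol n)) ^ 2) ^ 2 by ring,
      Real.sq_sqrt (vol_pos n).le]
  rw [h4, mul_one_div, le_div_iff₀ (by have := vol_pos n; positivity)]
  have h1 : (n : ℝ) ^ 2 * q ^ n ≤ |B| := (hB ⟨n, rfl⟩).trans (le_abs_self B)
  have h2 : q ^ n ≤ 1 := pow_le_one₀ hq.le hq1.le
  have h3 : vol n ^ 2 ≤ 9 * (n : ℝ) ^ 2 + 9 := by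
    unfold vol; nlinarith [sq_nonneg ((n : ℝ) - 1)]
  have h5 : 0 < q ^ n := pow_pos hq n
  nlinarith

lemma exp_neg_mul_vol_le {c : ℝ} (hc : 0 < c) (n : ℕ) :
    Real.exp (-(c * vol n)) ≤ 2 / c ^ 2 * (1 / √(vol n)) ^ 4 := by
  have hv := vol_pos n
  have h4 : (1 / √(vol n)) ^ 4 = 1 / vol n ^ 2 := by
    rw [div_pow, one_pow, show (√(vol n)) ^ 4 = ((√(vol n)) ^ 2) ^ 2 by ring,
      Real.sq_sqrt hv.le]
  have h := Real.pow_div_factorial_le_exp (c * vol n) (by positivity) 2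
  rw [Real.exp_neg, h4]
  calc (Real.exp (c * vol n))⁻¹ ≤ ((c * vol n) ^ 2 / (Nat.factorial 2 : ℝ))⁻¹ :=
        inv_anti₀ (by positivity) h
    _ = _ := by
        simp [Nat.factorial]
        field_simp

/-- At `w = x + iθ`, with `x` the saddle point, the factor multiplying the generating function in
`profile` turns the Gaussian `exp(Nτw²/2)` into `exp(-Nτθ²/2)`. -/
lemma exp_saddle_mul (β : ℝ) (n : ℕ) (S θ : ℝ) :
    Complex.exp (vol n * (susc β / 2 * (saddle β n S + θ * Complex.I) ^ 2)) *
      (Complex.exp (-(saddle β n S + θ * Complex.I) * S) *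
        Complex.exp (vol n * (susc β / 2 * saddle β n S ^ 2))) =
      (Real.exp (-(susc β / 2 * vol n * θ ^ 2)) : ℂ) := by
  rw [← Complex.exp_add, ← Complex.exp_add, Complex.ofReal_exp]
  congr 1
  have hS : (S : ℂ) = vol n * susc β * saddle β n S := by
    exact_mod_cast congrArg (fun x : ℝ => (x : ℂ)) (saddle_mul β n S)
  rw [hS]
  push_cast
  linear_combination ((vol n : ℂ) * susc β * θ ^ 2 / 2) * Complex.I_sq

/-- The factor multiplying the generating function in `profile` has modulus at most one. -/
lemma norm_exp_saddle_le (β : ℝ) (n : ℕ) (S θ : ℝ) :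
    ‖Complex.exp (-(saddle β n S + θ * Complex.I) * S) *
      Complex.exp (vol n * (susc β / 2 * saddle β n S ^ 2))‖ ≤ 1 := by
  rw [← Complex.exp_add, Complex.norm_exp, Real.exp_le_one_iff]
  have hS := saddle_mul β n S
  have e : -((saddle β n S : ℂ) + θ * Complex.I) * S + vol n * (susc β / 2 * saddle β n S ^ 2) =
      ((-(saddle β n S * S) + vol n * (susc β / 2 * saddle β n S ^ 2) : ℝ) : ℂ) +
        ((-(θ * S) : ℝ) : ℂ) * Complex.I := by push_cast; ring
  rw [e]
  simp only [Complex.add_re, Complex.ofReal_re, Complex.mul_re, Complex.ofReal_im, Complex.I_re,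
    Complex.I_im, mul_zero, zero_mul, sub_self, add_zero]
  have h := vol_pos n
  have h' := susc_pos β
  have : saddle β n S * S = vol n * susc β * saddle β n S ^ 2 := by
    nth_rewrite 2 [hS]; ring
  rw [this]
  have : 0 ≤ vol n * susc β * saddle β n S ^ 2 := by positivity
  nlinarith

lemma continuous_profile (β : ℝ) (n : ℕ) (f : Config → ℝ) (a b : Bool) (S : ℝ) :
    Continuous (profile β n f a b S) := by
  have h : Continuous fun w => genFn β n f w a b :=
    continuous_iff_continuousAt.2 fun w => (analyticAt_genFn β n f a b w).continuousAt
  unfold profile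
  fun_prop

lemma norm_saddle_add_le (x θ : ℝ) : ‖(x : ℂ) + θ * Complex.I‖ ≤ |x| + |θ| := by
  refine (norm_add_le _ _).trans (le_of_eq ?_)
  simp

lemma add_pow_three_le {x y : ℝ} (hx : 0 ≤ x) (hy : 0 ≤ y) :
    (x + y) ^ 3 ≤ 4 * (x ^ 3 + y ^ 3) := by
  nlinarith [mul_nonneg (add_nonneg hx hy) (sq_nonneg (x - y))]

set_option maxHeartbeats 1000000 in
/-- The profile of `1` is Gaussian up to a relative error `ε`. -/
lemma exists_norm_profile_one_sub_le (β : ℝ) :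
    ∃ C ε₀ : ℝ, 0 ≤ C ∧ 0 < ε₀ ∧ ∀ n a b S ε, IsScale β n S ε → ε ≤ ε₀ →
      ∀ θ ∈ Set.Icc (-Real.pi) Real.pi,
        ‖profile β n (fun _ => 1) a b S θ - (Real.exp (-(susc β / 2 * vol n * θ ^ 2)) : ℂ)‖ ≤
          C * (ε * Real.exp (-(susc β / 8 * vol n * θ ^ 2)) + (1 / √(vol n)) ^ 4) := by
  have hτ := susc_pos β
  have hpi := Real.pi_pos
  obtain ⟨C, hC, hnear⟩ := eventually_norm_genFn_one_div_sub_le β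
  obtain ⟨ρ, hρ, hnear⟩ := Metric.eventually_nhds_iff.1 hnear
  obtain ⟨Q, hQ, hq⟩ := exists_pow_le_inv_sqrt_vol (decayRate_pos β) (decayRate_lt_one β)
  set δ : ℝ := min (min (ρ / 2) (susc β / (16 * (C + 1)))) Real.pi with hδ
  have hδ0 : 0 < δ := by positivity
  have hδ1 : δ ≤ ρ / 2 := (min_le_left _ _).trans (min_le_left _ _)
  have hδ2 : 4 * C * δ ≤ susc β / 4 := by
    have h1 : δ ≤ susc β / (16 * (C + 1)) := (min_le_left _ _).trans (min_le_right _ _)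
    rw [le_div_iff₀ (by positivity)] at h1
    nlinarith
  have hδ3 : δ ≤ Real.pi := min_le_right _ _
  obtain ⟨κ, hκ, hκ1, x₀, hx₀, D, hD, hfar⟩ := exists_norm_genFn_le β 0 (f := fun _ => 1)
    (fun _ _ _ => rfl) hδ0 hδ3
  obtain ⟨Q', hQ', hq'⟩ := exists_pow_le_inv_sqrt_vol hκ hκ1
  set P₁ : ℝ := 1 + (Nat.factorial 1 : ℝ) / (susc β / 4 / 2) ^ 1 with hP₁
  set P₃ : ℝ := 1 + (Nat.factorial 3 : ℝ) / (susc β / 4 / 2) ^ 3 with hP₃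
  have hP₁0 : 0 < P₁ := by positivity
  have hP₃0 : 0 < P₃ := by positivity
  clear_value P₁ P₃ δ
  set c : ℝ := susc β / 2 * δ ^ 2 with hc
  have hc0 : 0 < c := by positivity
  refine ⟨C * Real.exp (4 * C) * (5 + P₁ + 4 * P₃) + C * Q + D * Q' + 2 / c ^ 2,
    min 1 (min (ρ / 4) x₀), by positivity, by positivity, ?_⟩
  rintro n a b S ε ⟨hs, hx, hx3⟩ hε θ hθ
  have hε1 : ε ≤ 1 := hε.trans (min_le_left _ _)
  have hε2 : ε ≤ ρ / 4 := hε.trans ((min_le_right _ _).trans (min_le_left _ _))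
  have hε3 : ε ≤ x₀ := hε.trans ((min_le_right _ _).trans (min_le_right _ _))
  have hv := vol_pos n
  have hb := bulk_pos β n
  have hsq : 0 < √(vol n) := Real.sqrt_pos.2 hv
  have hs0 : 0 < 1 / √(vol n) := by positivity
  have hε0 : 0 < ε := hs0.trans_le hs
  have hm := norm_exp_saddle_le β n S θ
  have hg := exp_saddle_mul β n S θ
  have hθπ : |θ| ≤ Real.pi := abs_le.2 hθ
  unfold profile
  set m : ℂ := Complex.exp (-(saddle β n S + θ * Complex.I) * S) *
      Complex.exp (vol n * (susc β / 2 * saddle β n S ^ 2)) with hmdef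
  set x := saddle β n S with hxdef
  set w : ℂ := x + θ * Complex.I with hw
  have hs4 : 0 ≤ (1 / √(vol n)) ^ 4 := by positivity
  have hexp8 : 0 < Real.exp (-(susc β / 8 * vol n * θ ^ 2)) := Real.exp_pos _
  rcases le_total |θ| δ with hθδ | hθδ
  · -- near the saddle point
    have hwn : ‖w‖ ≤ |x| + |θ| := norm_saddle_add_le x θ
    have hn := hnear (y := w) (by rw [dist_zero_right]; linarith) n a b
    have e : genFn β n (fun _ => 1) w a b * m / bulk β n -
        (Real.exp (-(susc β / 2 * vol n * θ ^ 2)) : ℂ) =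
        (genFn β n (fun _ => 1) w a b / bulk β n -
          Complex.exp (vol n * (susc β / 2 * w ^ 2))) * m := by
      rw [← hg]; ring
    have hgn : ‖Complex.exp (vol n * (susc β / 2 * w ^ 2))‖ * ‖m‖ =
        Real.exp (-(susc β / 2 * vol n * θ ^ 2)) := by
      rw [← norm_mul, hg, Complex.norm_real, Real.norm_eq_abs, Real.abs_exp]
    have hw3 : vol n * ‖w‖ ^ 3 ≤ 4 * ε + 4 * (vol n * |θ| ^ 3) := by
      have h1 : ‖w‖ ^ 3 ≤ 4 * (|x| ^ 3 + |θ| ^ 3) :=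
        (pow_le_pow_left₀ (norm_nonneg _) hwn 3).trans
          (add_pow_three_le (abs_nonneg _) (abs_nonneg _))
      calc vol n * ‖w‖ ^ 3 ≤ vol n * (4 * (|x| ^ 3 + |θ| ^ 3)) :=
            mul_le_mul_of_nonneg_left h1 hv.le
        _ = 4 * (vol n * |x| ^ 3) + 4 * (vol n * |θ| ^ 3) := by ring
        _ ≤ _ := by linarith
    have hθ3 : vol n * |θ| ^ 3 ≤ vol n * θ ^ 2 * δ := by
      rw [pow_succ, sq_abs, mul_assoc]
      gcongr
    have hE : Real.exp (C * (vol n * ‖w‖ ^ 3)) * Real.exp (-(susc β / 2 * vol n * θ ^ 2)) ≤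
        Real.exp (4 * C) * Real.exp (-(susc β / 4 * vol n * θ ^ 2)) := by
      rw [← Real.exp_add, ← Real.exp_add]
      apply Real.exp_le_exp.2
      have h1 : C * (vol n * ‖w‖ ^ 3) ≤ C * (4 * 1 + 4 * (vol n * θ ^ 2 * δ)) := by
        refine mul_le_mul_of_nonneg_left (hw3.trans ?_) hC
        linarith
      have h2 : 4 * C * δ * (vol n * θ ^ 2) ≤ susc β / 4 * (vol n * θ ^ 2) :=
        mul_le_mul_of_nonneg_right hδ2 (by positivity)
      linarith
    have t1 := abs_pow_mul_exp_le (b := susc β / 4) (by positivity) hv 1 θ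
    have t3 := abs_pow_mul_exp_le (b := susc β / 4) (by positivity) hv 3 θ
    rw [← hP₁, pow_one |θ|, pow_one (1 / √(vol n)), show susc β / 4 / 2 = susc β / 8 by ring] at t1
    rw [← hP₃, show susc β / 4 / 2 = susc β / 8 by ring] at t3
    set E4 := Real.exp (-(susc β / 4 * vol n * θ ^ 2)) with hE4
    set E8 := Real.exp (-(susc β / 8 * vol n * θ ^ 2)) with hE8
    have hE48 : E4 ≤ E8 := by
      apply Real.exp_le_exp.2
      have : 0 ≤ susc β * vol n * θ ^ 2 := by positivity
      linarith
    have t1' : |θ| * E4 ≤ P₁ * ε * E8 := t1.trans (by gcongr)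
    have t3' : vol n * (|θ| ^ 3 * E4) ≤ P₃ * ε * E8 := by
      have h1 : vol n * (1 / √(vol n)) ^ 3 = 1 / √(vol n) := by
        rw [show (1 / √(vol n)) ^ 3 = (1 / (√(vol n)) ^ 2) * (1 / √(vol n)) by
          field_simp, Real.sq_sqrt hv.le]
        field_simp
      calc vol n * (|θ| ^ 3 * E4) ≤ vol n * (P₃ * (1 / √(vol n)) ^ 3 * E8) := by gcongr
        _ = P₃ * (vol n * (1 / √(vol n)) ^ 3) * E8 := by ring
        _ ≤ _ := by rw [h1]; gcongr
    have hfirst : (‖w‖ + vol n * ‖w‖ ^ 3) * E4 ≤ (5 + P₁ + 4 * P₃) * ε * E8 := by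
      calc (‖w‖ + vol n * ‖w‖ ^ 3) * E4 ≤ (ε + |θ| + (4 * ε + 4 * (vol n * |θ| ^ 3))) * E4 := by
            have : ‖w‖ ≤ ε + |θ| := by linarith
            gcongr
        _ = 5 * ε * E4 + |θ| * E4 + 4 * (vol n * (|θ| ^ 3 * E4)) := by ring
        _ ≤ 5 * ε * E8 + P₁ * ε * E8 + 4 * (P₃ * ε * E8) := by gcongr
        _ = _ := by ring
    rw [e, norm_mul]
    have hstep : ‖genFn β n (fun _ => 1) w a b / bulk β n -
          Complex.exp (vol n * (susc β / 2 * w ^ 2))‖ * ‖m‖ ≤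
        C * Real.exp (4 * C) * (5 + P₁ + 4 * P₃) * (ε * E8) +
          C * Q * (1 / √(vol n)) ^ 4 := by
      calc _ ≤ (C * (‖w‖ + vol n * ‖w‖ ^ 3) * Real.exp (C * (vol n * ‖w‖ ^ 3)) *
            ‖Complex.exp (vol n * (susc β / 2 * w ^ 2))‖ + C * decayRate β ^ n) * ‖m‖ := by gcongr
        _ = C * (‖w‖ + vol n * ‖w‖ ^ 3) * (Real.exp (C * (vol n * ‖w‖ ^ 3)) *
            Real.exp (-(susc β / 2 * vol n * θ ^ 2))) + C * decayRate β ^ n * ‖m‖ := by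
            rw [← hgn]; ring
        _ ≤ C * (‖w‖ + vol n * ‖w‖ ^ 3) * (Real.exp (4 * C) * E4) +
            C * (Q * (1 / √(vol n)) ^ 4) * 1 := by
            have := (decayRate_pos β).le
            have := hq n
            gcongr
        _ = C * Real.exp (4 * C) * ((‖w‖ + vol n * ‖w‖ ^ 3) * E4) +
            C * Q * (1 / √(vol n)) ^ 4 := by ring
        _ ≤ C * Real.exp (4 * C) * ((5 + P₁ + 4 * P₃) * ε * E8) +
            C * Q * (1 / √(vol n)) ^ 4 := by gcongr
        _ = _ := by ring
    refine hstep.trans ?_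
    rw [mul_add _ (ε * E8)]
    have i1 : 0 ≤ C * Q + D * Q' + 2 / c ^ 2 := by positivity
    have i2 : 0 ≤ C * Real.exp (4 * C) * (5 + P₁ + 4 * P₃) + D * Q' + 2 / c ^ 2 := by positivity
    refine add_le_add (mul_le_mul_of_nonneg_right (by linarith) (by positivity))
      (mul_le_mul_of_nonneg_right (by linarith) hs4)
  · -- away from the saddle point
    have h1 : ‖genFn β n (fun _ => 1) w a b * m / bulk β n‖ ≤ D * Q' * (1 / √(vol n)) ^ 4 := by
      rw [norm_div, norm_mul, Complex.norm_real, Real.norm_eq_abs, abs_of_pos hb, div_le_iff₀ hb]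
      calc _ ≤ D * bulk β n * κ ^ n * 1 := by
            gcongr
            exact hfar x θ (hx.trans hε3) hθδ hθπ n (Nat.zero_le n) a b
        _ ≤ D * bulk β n * (Q' * (1 / √(vol n)) ^ 4) * 1 := by
            have := hq' n
            gcongr
        _ = _ := by ring
    have h2 : ‖(Real.exp (-(susc β / 2 * vol n * θ ^ 2)) : ℂ)‖ ≤
        2 / c ^ 2 * (1 / √(vol n)) ^ 4 := by
      rw [Complex.norm_real, Real.norm_eq_abs, Real.abs_exp]
      refine le_trans ?_ (exp_neg_mul_vol_le hc0 n)
      apply Real.exp_le_exp.2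
      have h3 : δ ^ 2 ≤ θ ^ 2 := by rw [← sq_abs θ]; gcongr
      have h4 : susc β / 2 * vol n * δ ^ 2 ≤ susc β / 2 * vol n * θ ^ 2 := by gcongr
      have h5 : c * vol n = susc β / 2 * vol n * δ ^ 2 := by rw [hc]; ring
      linarith
    refine (norm_sub_le _ _).trans ((add_le_add h1 h2).trans ?_)
    rw [← add_mul, mul_add _ (ε * Real.exp (-(susc β / 8 * vol n * θ ^ 2)))]
    have i1 : 0 ≤ C * Real.exp (4 * C) * (5 + P₁ + 4 * P₃) + C * Q := by positivity
    have i2 : 0 ≤ (C * Real.exp (4 * C) * (5 + P₁ + 4 * P₃) + C * Q + D * Q' + 2 / c ^ 2) *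
      (ε * Real.exp (-(susc β / 8 * vol n * θ ^ 2))) := by positivity
    have i3 : (D * Q' + 2 / c ^ 2) * (1 / √(vol n)) ^ 4 ≤
        (C * Real.exp (4 * C) * (5 + P₁ + 4 * P₃) + C * Q + D * Q' + 2 / c ^ 2) *
          (1 / √(vol n)) ^ 4 := mul_le_mul_of_nonneg_right (by linarith) hs4
    linarith

end SpeedChange

namespace SpeedChange

set_option maxHeartbeats 1000000 in
/-- The profile of a local function is that of `1` times the second order expansion of its tilted
expectation. -/
lemma exists_norm_profile_sub_le (β : ℝ) (l : ℕ) {f : Config → ℝ}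
    (hf : DependsOn f (box l : Set ℤ)) :
    ∃ C ε₀ : ℝ, 0 ≤ C ∧ 0 < ε₀ ∧ ∀ n, l ≤ n → ∀ a b S ε, IsScale β n S ε → ε ≤ ε₀ →
      ∀ θ ∈ Set.Icc (-Real.pi) Real.pi,
        ‖profile β n f a b S θ -
          (tilted β l f 0 + iteratedDeriv 1 (tilted β l f) 0 * (saddle β n S + θ * Complex.I) +
            iteratedDeriv 2 (tilted β l f) 0 / 2 * (saddle β n S + θ * Complex.I) ^ 2) *
              profile β n (fun _ => 1) a b S θ‖ ≤
          C * (ε ^ 3 * Real.exp (-(susc β / 16 * vol n * θ ^ 2)) + (1 / √(vol n)) ^ 4) := by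
  have hτ := susc_pos β
  have hpi := Real.pi_pos
  obtain ⟨C, ε₁, hC, hε₁, hone⟩ := exists_norm_profile_one_sub_le β
  obtain ⟨D, hD, hnear⟩ := eventually_norm_genFn_sub_le β l hf
  obtain ⟨B, hB, htay⟩ :=
    (AnalyticAt.isBigO_taylor_two (analyticAt_tilted β l f)).exists_pos
  obtain ⟨ρ, hρ, hnear⟩ := Metric.eventually_nhds_iff.1 (hnear.and htay.bound)
  obtain ⟨Q, hQ, hq⟩ := exists_pow_le_inv_sqrt_vol (decayRate_pos β) (decayRate_lt_one β)
  set δ : ℝ := min (ρ / 2) Real.pi with hδ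
  have hδ0 : 0 < δ := by positivity
  have hδ1 : δ ≤ ρ / 2 := min_le_left _ _
  have hδ3 : δ ≤ Real.pi := min_le_right _ _
  clear_value δ
  obtain ⟨κ, hκ, hκ1, x₀, hx₀, D', hD', hfar⟩ := exists_norm_genFn_le β l hf hδ0 hδ3
  obtain ⟨Q', hQ', hq'⟩ := exists_pow_le_inv_sqrt_vol hκ hκ1
  obtain ⟨κ₁, hκ₁, hκ₁1, x₁, hx₁, D₁, hD₁, hfar₁⟩ := exists_norm_genFn_le β 0 (f := fun _ => 1)
    (fun _ _ _ => rfl) hδ0 hδ3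
  obtain ⟨Q₁, hQ₁, hq₁⟩ := exists_pow_le_inv_sqrt_vol hκ₁ hκ₁1
  generalize tilted β l f 0 = g₀ at *
  generalize iteratedDeriv 1 (tilted β l f) 0 = g₁ at *
  generalize iteratedDeriv 2 (tilted β l f) 0 = g₂ at *
  set P₃ : ℝ := 1 + (Nat.factorial 3 : ℝ) / (susc β / 8 / 2) ^ 3 with hP₃
  have hP₃0 : 0 < P₃ := by positivity
  clear_value P₃
  set M : ℝ := ‖g₀‖ + ‖g₁‖ * (1 + Real.pi) + ‖g₂‖ / 2 * (1 + Real.pi) ^ 2 with hM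
  have hM0 : 0 ≤ M := by positivity
  clear_value M
  set R₁ : ℝ := 4 * B * (C + 1) * (1 + P₃) with hR₁
  set R₂ : ℝ := D * Q + 4 * B * C * (1 + Real.pi ^ 3) with hR₂
  set R₃ : ℝ := D' * Q' + M * (D₁ * Q₁) with hR₃
  have hR₁0 : 0 ≤ R₁ := by positivity
  have hR₂0 : 0 ≤ R₂ := by positivity
  have hR₃0 : 0 ≤ R₃ := by positivity
  refine ⟨R₁ + R₂ + R₃, min (min 1 ε₁) (min (ρ / 4) (min x₀ x₁)), by positivity, by positivity, ?_⟩
  rintro n hn a b S ε hS hε θ hθ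
  have hε1 : ε ≤ 1 := hε.trans ((min_le_left _ _).trans (min_le_left _ _))
  have hεε : ε ≤ ε₁ := hε.trans ((min_le_left _ _).trans (min_le_right _ _))
  have hε2 : ε ≤ ρ / 4 := hε.trans ((min_le_right _ _).trans (min_le_left _ _))
  have hε3 : ε ≤ x₀ :=
    hε.trans ((min_le_right _ _).trans ((min_le_right _ _).trans (min_le_left _ _)))
  have hε4 : ε ≤ x₁ :=
    hε.trans ((min_le_right _ _).trans ((min_le_right _ _).trans (min_le_right _ _)))
  have hone := hone n a b S ε hS hεε θ hθ
  obtain ⟨hs, hx, -⟩ := hS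
  have hv := vol_pos n
  have hb := bulk_pos β n
  have hsq : 0 < √(vol n) := Real.sqrt_pos.2 hv
  set s : ℝ := 1 / √(vol n) with hsdef
  have hs0 : 0 < s := by positivity
  have hε0 : 0 < ε := hs0.trans_le hs
  have hm := norm_exp_saddle_le β n S θ
  have hθπ : |θ| ≤ Real.pi := abs_le.2 hθ
  have hwn := norm_saddle_add_le (saddle β n S) θ
  unfold profile at hone ⊢
  set m : ℂ := Complex.exp (-(saddle β n S + θ * Complex.I) * S) *
      Complex.exp (vol n * (susc β / 2 * saddle β n S ^ 2)) with hmdef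
  set x := saddle β n S with hxdef
  set w : ℂ := x + θ * Complex.I with hw
  clear_value s m x w
  have hs4 : 0 ≤ s ^ 4 := by positivity
  set E16 := Real.exp (-(susc β / 16 * vol n * θ ^ 2)) with hE16
  have hE160 : 0 < E16 := Real.exp_pos _
  suffices h : ‖genFn β n f w a b * m / bulk β n -
      (g₀ + g₁ * w + g₂ / 2 * w ^ 2) * (genFn β n (fun _ => 1) w a b * m / bulk β n)‖ ≤
      R₁ * (ε ^ 3 * E16) + (R₂ + R₃) * s ^ 4 by
    refine h.trans ?_
    have h1 : 0 ≤ (R₂ + R₃) * (ε ^ 3 * E16) := by positivity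
    have h2 : 0 ≤ R₁ * s ^ 4 := by positivity
    linarith
  rcases le_total |θ| δ with hθδ | hθδ
  · -- near the saddle point
    obtain ⟨hn1, hn2⟩ := hnear (y := w) (by rw [dist_zero_right]; linarith)
    have hn1 := hn1 n hn a b
    rw [norm_pow] at hn2
    set G := tilted β l f w with hG
    set Φ₁ : ℂ := genFn β n (fun _ => 1) w a b * m / bulk β n with hΦ₁
    have e : genFn β n f w a b * m / bulk β n - (g₀ + g₁ * w + g₂ / 2 * w ^ 2) * Φ₁ =
        (genFn β n f w a b - G * genFn β n (fun _ => 1) w a b) * m / bulk β n +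
          (G - (g₀ + g₁ * w + g₂ / 2 * w ^ 2)) * Φ₁ := by rw [hΦ₁]; ring
    have h1 : ‖(genFn β n f w a b - G * genFn β n (fun _ => 1) w a b) * m / bulk β n‖ ≤
        D * Q * s ^ 4 := by
      rw [norm_div, norm_mul, Complex.norm_real, Real.norm_eq_abs, abs_of_pos hb, div_le_iff₀ hb]
      calc _ ≤ D * bulk β n * decayRate β ^ n * 1 :=
            mul_le_mul hn1 hm (norm_nonneg _) ((norm_nonneg _).trans hn1)
        _ ≤ D * bulk β n * (Q * s ^ 4) * 1 := by
            gcongr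
            rw [hsdef]; exact hq n
        _ = _ := by ring
    have hw3 : ‖w‖ ^ 3 ≤ 4 * (ε ^ 3 + |θ| ^ 3) := by
      refine (pow_le_pow_left₀ (norm_nonneg _) (hwn.trans (add_le_add_left hx _)) 3).trans
          (add_pow_three_le hε0.le (abs_nonneg _))
    have hE2 : ‖((Real.exp (-(susc β / 2 * vol n * θ ^ 2)) : ℝ) : ℂ)‖ ≤
        Real.exp (-(susc β / 8 * vol n * θ ^ 2)) := by
      rw [Complex.norm_real, Real.norm_eq_abs, Real.abs_exp]
      apply Real.exp_le_exp.2
      have : 0 ≤ susc β * vol n * θ ^ 2 := by positivity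
      linarith
    have t3 := abs_pow_mul_exp_le (b := susc β / 8) (by positivity) hv 3 θ
    rw [← hP₃, show susc β / 8 / 2 = susc β / 16 by ring, ← hE16, ← hsdef] at t3
    have hE8 : Real.exp (-(susc β / 8 * vol n * θ ^ 2)) ≤ E16 := by
      apply Real.exp_le_exp.2
      have : 0 ≤ susc β * vol n * θ ^ 2 := by positivity
      linarith
    set E8 := Real.exp (-(susc β / 8 * vol n * θ ^ 2)) with hE8def
    have hE80 : 0 < E8 := Real.exp_pos _
    have hΦn : ‖Φ₁‖ ≤ (C + 1) * E8 + C * s ^ 4 := by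
      have h2 := norm_add_le (Φ₁ - ((Real.exp (-(susc β / 2 * vol n * θ ^ 2)) : ℝ) : ℂ))
        ((Real.exp (-(susc β / 2 * vol n * θ ^ 2)) : ℝ) : ℂ)
      rw [sub_add_cancel] at h2
      have h3 : C * (ε * E8) ≤ C * (1 * E8) := by gcongr
      linarith
    have h2 : ‖(G - (g₀ + g₁ * w + g₂ / 2 * w ^ 2)) * Φ₁‖ ≤
        R₁ * (ε ^ 3 * E16) + 4 * B * C * (1 + Real.pi ^ 3) * s ^ 4 := by
      rw [norm_mul]
      have i1 : (ε ^ 3 + |θ| ^ 3) * E8 ≤ (1 + P₃) * (ε ^ 3 * E16) := by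
        calc (ε ^ 3 + |θ| ^ 3) * E8 = ε ^ 3 * E8 + |θ| ^ 3 * E8 := by ring
          _ ≤ ε ^ 3 * E16 + P₃ * ε ^ 3 * E16 := by
              refine add_le_add (by gcongr) (t3.trans ?_)
              gcongr
          _ = _ := by ring
      have i2 : ε ^ 3 + |θ| ^ 3 ≤ 1 + Real.pi ^ 3 :=
        add_le_add (pow_le_one₀ hε0.le hε1) (pow_le_pow_left₀ (abs_nonneg _) hθπ 3)
      calc _ ≤ B * (4 * (ε ^ 3 + |θ| ^ 3)) * ((C + 1) * E8 + C * s ^ 4) := by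
            refine mul_le_mul (hn2.trans ?_) hΦn (norm_nonneg _) (by positivity)
            gcongr
        _ = 4 * B * (C + 1) * ((ε ^ 3 + |θ| ^ 3) * E8) +
            4 * B * C * (ε ^ 3 + |θ| ^ 3) * s ^ 4 := by ring
        _ ≤ 4 * B * (C + 1) * ((1 + P₃) * (ε ^ 3 * E16)) +
            4 * B * C * (1 + Real.pi ^ 3) * s ^ 4 := by gcongr
        _ = _ := by rw [hR₁]; ring
    rw [e]
    refine (norm_add_le _ _).trans ((add_le_add h1 h2).trans ?_)
    rw [hR₂]
    have : 0 ≤ R₃ * s ^ 4 := by positivity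
    linarith
  · -- away from the saddle point
    have h1 : ‖genFn β n f w a b * m / bulk β n‖ ≤ D' * Q' * s ^ 4 := by
      rw [norm_div, norm_mul, Complex.norm_real, Real.norm_eq_abs, abs_of_pos hb, div_le_iff₀ hb]
      have h0 := hfar x θ (hx.trans hε3) hθδ hθπ n hn a b
      rw [← hw] at h0
      calc _ ≤ D' * bulk β n * κ ^ n * 1 :=
            mul_le_mul h0 hm (norm_nonneg _) ((norm_nonneg _).trans h0)
        _ ≤ D' * bulk β n * (Q' * s ^ 4) * 1 := by
            gcongr
            rw [hsdef]; exact hq' n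
        _ = _ := by ring
    have h2 : ‖genFn β n (fun _ => 1) w a b * m / bulk β n‖ ≤ D₁ * Q₁ * s ^ 4 := by
      rw [norm_div, norm_mul, Complex.norm_real, Real.norm_eq_abs, abs_of_pos hb, div_le_iff₀ hb]
      have h0 := hfar₁ x θ (hx.trans hε4) hθδ hθπ n (Nat.zero_le n) a b
      rw [← hw] at h0
      calc _ ≤ D₁ * bulk β n * κ₁ ^ n * 1 :=
            mul_le_mul h0 hm (norm_nonneg _) ((norm_nonneg _).trans h0)
        _ ≤ D₁ * bulk β n * (Q₁ * s ^ 4) * 1 := by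
            gcongr
            rw [hsdef]; exact hq₁ n
        _ = _ := by ring
    have hw1 : ‖w‖ ≤ 1 + Real.pi := by linarith
    have h3 : ‖g₀ + g₁ * w + g₂ / 2 * w ^ 2‖ ≤ M := by
      rw [hM]
      refine (norm_add₃_le).trans ?_
      rw [norm_mul, norm_mul, norm_div, norm_pow, Complex.norm_ofNat]
      gcongr
    refine (norm_sub_le _ _).trans ?_
    rw [norm_mul]
    have h4 := mul_le_mul h3 h2 (norm_nonneg _) hM0
    have h5 : 0 ≤ R₁ * (ε ^ 3 * E16) := by positivity
    have h6 : 0 ≤ R₂ * s ^ 4 := by positivity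
    have h7 : R₃ * s ^ 4 = D' * Q' * s ^ 4 + M * (D₁ * Q₁ * s ^ 4) := by rw [hR₃]; ring
    linarith

/-! ### Block sums of finite configurations -/

lemma card_box (n : ℕ) : ((box n).card : ℝ) = vol n := by
  unfold box vol
  rw [Int.card_Icc]
  have : ((n : ℤ) + 1 - -(n : ℤ)).toNat = 2 * n + 1 := by omega
  rw [this]; push_cast; ring

lemma blockSum_indicatorConfig {n : ℕ} {A : Finset ℤ} (hA : A ⊆ box n) :
    blockSum n (indicatorConfig A) = A.card - vol n / 2 := by
  unfold blockSum
  rw [Finset.sum_sub_distrib, Finset.sum_const, nsmul_eq_mul, card_box]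
  have : ∑ x ∈ box n, occ (indicatorConfig A) x = A.card := by
    simp only [occ, indicatorConfig, decide_eq_true_eq]
    rw [Finset.sum_ite_mem, Finset.inter_eq_right.2 hA]
    simp
  rw [this]; ring

/-- The total weight of `f` over configurations on `Λ_n` with total spin `S`. -/
noncomputable def levelSum (β : ℝ) (n : ℕ) (f : Config → ℝ) (a b : Bool) (S : ℝ) : ℝ :=
  ∑ A ∈ (box n).powerset with blockSum n (indicatorConfig A) = S,
    f (indicatorConfig A) * Real.exp (-energy β n (indicatorConfig A) (bdry a b))

/-- The conditional expectation of `f` given the boundary values and the total spin `S`. -/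
noncomputable def levelMean (β : ℝ) (n : ℕ) (f : Config → ℝ) (a b : Bool) (S : ℝ) : ℝ :=
  levelSum β n f a b S / levelSum β n (fun _ => 1) a b S

lemma integral_exp_mul_int (z : ℂ) (j : ℤ) :
    ∫ θ in -Real.pi..Real.pi, Complex.exp ((z + θ * Complex.I) * j) =
      if j = 0 then 2 * (Real.pi : ℂ) else 0 := by
  split_ifs with hj
  · subst hj
    simp; ring
  · have hc : (Complex.I * j : ℂ) ≠ 0 := by simp [hj]
    have e : ∀ θ : ℝ, Complex.exp ((z + θ * Complex.I) * j) =
        Complex.exp (z * j) * Complex.exp (Complex.I * j * θ) := by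
      intro θ; rw [← Complex.exp_add]; congr 1; ring
    simp only [e]
    rw [intervalIntegral.integral_const_mul, integral_exp_mul_complex hc]
    have : Complex.exp (Complex.I * j * (Real.pi : ℝ)) =
        Complex.exp (Complex.I * j * (-Real.pi : ℝ)) := by
      rw [Complex.exp_eq_exp_iff_exists_int]
      exact ⟨j, by push_cast; ring⟩
    rw [this, sub_self, zero_div, mul_zero]

lemma integral_genFn_mul_exp (β : ℝ) (n : ℕ) (f : Config → ℝ) (a b : Bool) (z : ℂ)
    {A₀ : Finset ℤ} (hA₀ : A₀ ⊆ box n) :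
    ∫ θ in -Real.pi..Real.pi, genFn β n f (z + θ * Complex.I) a b *
      Complex.exp (-(z + θ * Complex.I) * blockSum n (indicatorConfig A₀)) =
      2 * Real.pi * levelSum β n f a b (blockSum n (indicatorConfig A₀)) := by
  unfold genFn
  simp only [Finset.sum_mul]
  rw [intervalIntegral.integral_finsetSum (fun A _ => Continuous.intervalIntegrable
    (by fun_prop) _ _)]
  unfold levelSum
  rw [Finset.sum_filter, Complex.ofReal_sum, Finset.mul_sum]
  refine Finset.sum_congr rfl fun A hA => ?_
  have hA' := Finset.mem_powerset.1 hA
  have e : ∀ θ : ℝ, Complex.exp ((z + θ * Complex.I) * blockSum n (indicatorConfig A)) *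
      Complex.exp (-(z + θ * Complex.I) * blockSum n (indicatorConfig A₀)) =
      Complex.exp ((z + θ * Complex.I) * ((A.card - A₀.card : ℤ) : ℂ)) := by
    intro θ
    rw [← Complex.exp_add, blockSum_indicatorConfig hA', blockSum_indicatorConfig hA₀]
    congr 1; push_cast; ring
  simp only [mul_assoc, e]
  rw [intervalIntegral.integral_const_mul, integral_exp_mul_int]
  have hiff : (A.card : ℤ) - A₀.card = 0 ↔
      blockSum n (indicatorConfig A) = blockSum n (indicatorConfig A₀) := by
    rw [blockSum_indicatorConfig hA', blockSum_indicatorConfig hA₀, sub_left_inj, sub_eq_zero]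
    norm_cast
  by_cases h : blockSum n (indicatorConfig A) = blockSum n (indicatorConfig A₀)
  · rw [if_pos (hiff.2 h), if_pos h]; push_cast; ring
  · rw [if_neg (fun h' => h (hiff.1 h')), if_neg h]; simp

/-- Fourier inversion: integrating the profile over a period extracts the weight of one value of
the total spin. -/
lemma integral_profile (β : ℝ) (n : ℕ) (f : Config → ℝ) (a b : Bool)
    {A₀ : Finset ℤ} (hA₀ : A₀ ⊆ box n) :
    ∫ θ in -Real.pi..Real.pi, profile β n f a b (blockSum n (indicatorConfig A₀)) θ =
      2 * Real.pi * levelSum β n f a b (blockSum n (indicatorConfig A₀)) *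
        (Complex.exp (vol n * (susc β / 2 *
          saddle β n (blockSum n (indicatorConfig A₀)) ^ 2)) / bulk β n) := by
  rw [← integral_genFn_mul_exp β n f a b (saddle β n (blockSum n (indicatorConfig A₀))) hA₀,
    ← intervalIntegral.integral_mul_const]
  congr 1
  ext θ
  unfold profile
  ring

lemma levelMean_eq (β : ℝ) (n : ℕ) (f : Config → ℝ) (a b : Bool)
    {A₀ : Finset ℤ} (hA₀ : A₀ ⊆ box n) :
    ((levelMean β n f a b (blockSum n (indicatorConfig A₀)) : ℝ) : ℂ) =
      (∫ θ in -Real.pi..Real.pi, profile β n f a b (blockSum n (indicatorConfig A₀)) θ) /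
      ∫ θ in -Real.pi..Real.pi, profile β n (fun _ => 1) a b
        (blockSum n (indicatorConfig A₀)) θ := by
  rw [integral_profile β n f a b hA₀, integral_profile β n _ a b hA₀, levelMean]
  have h1 : (bulk β n : ℂ) ≠ 0 := by exact_mod_cast (bulk_pos β n).ne'
  have h2 : (Real.pi : ℂ) ≠ 0 := by exact_mod_cast Real.pi_ne_zero
  rw [mul_div_mul_right _ _ (div_ne_zero (Complex.exp_ne_zero _) h1),
    mul_div_mul_left _ _ (mul_ne_zero two_ne_zero h2)]
  push_cast
  rfl

/-- The `i`-th moment of the profile of `1`, normalized. It does not depend on the local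
function whose conditional expectation is expanded. -/
noncomputable def profileMoment (β : ℝ) (n : ℕ) (a b : Bool) (S : ℝ) (i : ℕ) : ℂ :=
  (∫ θ in -Real.pi..Real.pi, (saddle β n S + θ * Complex.I) ^ i *
    profile β n (fun _ => 1) a b S θ) /
  ∫ θ in -Real.pi..Real.pi, profile β n (fun _ => 1) a b S θ

/-- The first two moments of the profile are those of a complex Gaussian with mean the saddle point
`x` and variance `-1/(Nτ)`. The normalizing integral is at least of order `N^{-1/2}`. -/
lemma exists_profileMoment_sub_le (β : ℝ) :
    ∃ K ε₀ : ℝ, 0 < K ∧ 0 < ε₀ ∧ ∀ n a b S ε, IsScale β n S ε → ε ≤ ε₀ →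
      1 / √(vol n) ≤ K * ‖∫ θ in -Real.pi..Real.pi, profile β n (fun _ => 1) a b S θ‖ ∧
      ‖profileMoment β n a b S 1 - saddle β n S‖ ≤ K * ε ^ 2 ∧
      ‖profileMoment β n a b S 2 - (saddle β n S ^ 2 - 1 / (vol n * susc β))‖ ≤ K * ε ^ 3 := by
  obtain ⟨C, ε₁, hC, hε₁, h⟩ := exists_norm_profile_one_sub_le β
  obtain ⟨K, ε₂, hK, hε₂, H⟩ := exists_gaussian_moment_ratio (susc_pos β)
    (b := susc β / 8) (by have := susc_pos β; positivity) hC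
  refine ⟨K, min ε₁ ε₂, hK, by positivity, fun n a b S ε hS hε => ?_⟩
  have := H (vol n) (saddle β n S) ε (profile β n (fun _ => 1) a b S) (one_le_vol n) hS.1 hS.2.1
    (hε.trans (min_le_right _ _)) (continuous_profile ..)
    (h n a b S ε hS (hε.trans (min_le_left _ _)))
  simpa only [profileMoment, pow_one] using this

/-- Expansion of conditional expectations given the total spin. -/
lemma exists_levelMean_sub_le (β : ℝ) (l : ℕ) {f : Config → ℝ}
    (hf : DependsOn f (box l : Set ℤ)) :
    ∃ K ε₀ : ℝ, 0 < K ∧ 0 < ε₀ ∧ ∀ n, l ≤ n → ∀ a b, ∀ A ⊆ box n, ∀ S ε,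
      S = blockSum n (indicatorConfig A) → IsScale β n S ε → ε ≤ ε₀ →
      ‖(levelMean β n f a b S : ℂ) - (tilted β l f 0 +
        iteratedDeriv 1 (tilted β l f) 0 * profileMoment β n a b S 1 +
        iteratedDeriv 2 (tilted β l f) 0 / 2 * profileMoment β n a b S 2)‖ ≤ K * ε ^ 3 := by
  have hpi := Real.pi_pos
  have hτ := susc_pos β
  obtain ⟨K, ε₁, hK, hε₁, h1⟩ := exists_profileMoment_sub_le β
  obtain ⟨C, ε₂, hC, hε₂, h2⟩ := exists_norm_profile_sub_le β l hf
  set A₀ : ℝ := √(Real.pi / (susc β / 16)) with hA₀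
  refine ⟨K * (C * A₀ + 2 * Real.pi * C) + 1, min ε₁ ε₂, by positivity, by positivity, ?_⟩
  rintro n hn a b A hA S ε rfl hS hε
  set S := blockSum n (indicatorConfig A) with hSdef
  obtain ⟨hJ, -, -⟩ := h1 n a b S ε hS (hε.trans (min_le_left _ _))
  have h2 := h2 n hn a b S ε hS (hε.trans (min_le_right _ _))
  have hv := vol_pos n
  have hsq : 0 < √(vol n) := Real.sqrt_pos.2 hv
  set s : ℝ := 1 / √(vol n) with hsdef
  have hs0 : 0 < s := by positivity
  have hs : s ≤ ε := hS.1
  have hε0 : 0 < ε := hs0.trans_le hs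
  rw [levelMean_eq β n f a b hA, ← hSdef]
  unfold profileMoment
  set Φ := profile β n (fun _ => 1) a b S with hΦ
  set Φf := profile β n f a b S with hΦf
  have hc : Continuous Φ := continuous_profile ..
  have hcf : Continuous Φf := continuous_profile ..
  set J := ∫ θ in -Real.pi..Real.pi, Φ θ with hJdef
  have hJ0 : J ≠ 0 := by
    rintro h0
    rw [h0, norm_zero, mul_zero] at hJ
    linarith
  generalize tilted β l f 0 = g₀ at *
  generalize iteratedDeriv 1 (tilted β l f) 0 = g₁ at *
  generalize iteratedDeriv 2 (tilted β l f) 0 = g₂ at *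
  have hii : ∀ {F : ℝ → ℂ}, Continuous F → IntervalIntegrable F volume (-Real.pi) Real.pi :=
    fun h => h.intervalIntegrable _ _
  have e : (∫ θ in -Real.pi..Real.pi, Φf θ) / J - (g₀ +
      g₁ * ((∫ θ in -Real.pi..Real.pi, (saddle β n S + θ * Complex.I) ^ 1 * Φ θ) / J) +
      g₂ / 2 * ((∫ θ in -Real.pi..Real.pi, (saddle β n S + θ * Complex.I) ^ 2 * Φ θ) / J)) =
      (∫ θ in -Real.pi..Real.pi, (Φf θ - (g₀ + g₁ * (saddle β n S + θ * Complex.I) +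
        g₂ / 2 * (saddle β n S + θ * Complex.I) ^ 2) * Φ θ)) / J := by
    rw [eq_div_iff hJ0]
    have : ∀ X Y Z : ℂ, (X / J - (g₀ + g₁ * (Y / J) + g₂ / 2 * (Z / J))) * J =
        X - (g₀ * J + g₁ * Y + g₂ / 2 * Z) := by
      intro X Y Z; field_simp
    rw [this, hJdef, ← intervalIntegral.integral_const_mul, ← intervalIntegral.integral_const_mul,
      ← intervalIntegral.integral_const_mul, ← intervalIntegral.integral_add (hii (by fun_prop))
      (hii (by fun_prop)), ← intervalIntegral.integral_add (hii (by fun_prop))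
      (hii (by fun_prop)), ← intervalIntegral.integral_sub (hii (by fun_prop)) (hii (by fun_prop))]
    congr 1
    ext θ
    ring
  rw [e, norm_div, div_le_iff₀ (norm_pos_iff.2 hJ0)]
  have h3 := norm_integral_le_gaussian (b := susc β / 16) (N := vol n) (A := C * ε ^ 3)
    (B := C * s ^ 4) (by positivity) hv (by positivity)
    (fun θ hθ => (h2 θ hθ).trans_eq (by ring))
  refine h3.trans ?_
  rw [← hsdef, ← hA₀]
  calc C * ε ^ 3 * A₀ * s + 2 * Real.pi * (C * s ^ 4)
      = C * ε ^ 3 * A₀ * s + 2 * Real.pi * (C * (s ^ 3 * s)) := by ring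
    _ ≤ C * ε ^ 3 * A₀ * s + 2 * Real.pi * (C * (ε ^ 3 * s)) := by gcongr
    _ = (C * A₀ + 2 * Real.pi * C) * ε ^ 3 * s := by ring
    _ ≤ (C * A₀ + 2 * Real.pi * C) * ε ^ 3 * (K * ‖J‖) := by gcongr
    _ = K * (C * A₀ + 2 * Real.pi * C) * ε ^ 3 * ‖J‖ := by ring
    _ ≤ _ := by
      have : 0 ≤ ε ^ 3 * ‖J‖ := by positivity
      linarith

end SpeedChange

namespace SpeedChange

/-! ### The DLR equation -/

/-- The finite-volume expectation of `f` with boundary values `a` and `b`. -/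
noncomputable def specMean (β lam : ℝ) (n : ℕ) (f : Config → ℝ) (a b : Bool) : ℝ :=
  ∑ A ∈ (box n).powerset, f (indicatorConfig A) *
    localSpec β lam n (indicatorConfig A) (bdry a b)

lemma bdry_left (a b : Bool) (n : ℕ) : bdry a b (-(n : ℤ) - 1) = a := by
  simp only [bdry]; rw [if_pos (by omega)]

lemma bdry_right (a b : Bool) (n : ℕ) : bdry a b ((n : ℤ) + 1) = b := by
  simp only [bdry]; rw [if_neg (by omega)]

lemma boltzmann_eq_bdry (β lam : ℝ) (n : ℕ) (e η : Config) :
    boltzmann β lam n e η =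
      boltzmann β lam n e (bdry (η (-(n : ℤ) - 1)) (η ((n : ℤ) + 1))) := by
  unfold boltzmann
  rw [energy_congr β (e := e) (e' := e) (ξ := η)
    (ξ' := bdry (η (-(n : ℤ) - 1)) (η ((n : ℤ) + 1))) (fun _ _ => rfl)
    (bdry_left _ _ n).symm (bdry_right _ _ n).symm]

lemma localSpec_eq_bdry (β lam : ℝ) (n : ℕ) (e η : Config) :
    localSpec β lam n e η =
      localSpec β lam n e (bdry (η (-(n : ℤ) - 1)) (η ((n : ℤ) + 1))) := by
  unfold localSpec partitionFn
  rw [boltzmann_eq_bdry]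
  simp only [boltzmann_eq_bdry β lam n _ η]

lemma ofReal_specMean (β lam : ℝ) (n : ℕ) (f : Config → ℝ) (a b : Bool) :
    (specMean β lam n f a b : ℂ) = genFn β n f lam a b / genFn β n (fun _ => 1) lam a b := by
  unfold specMean localSpec partitionFn boltzmann genFn
  push_cast
  simp only [← mul_div_assoc]
  rw [← Finset.sum_div]
  congr 1
  · exact Finset.sum_congr rfl fun A _ => by unfold blockSum; push_cast; ring
  · exact Finset.sum_congr rfl fun A _ => by unfold blockSum; push_cast; ring

/-- The set of occupied sites of `η` in `Λ_n`. -/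
noncomputable def occupied (n : ℕ) (η : Config) : Finset ℤ := (box n).filter fun x => η x = true

lemma occupied_subset (n : ℕ) (η : Config) : occupied n η ⊆ box n := Finset.filter_subset _ _

lemma indicatorConfig_occupied {n : ℕ} (η : Config) {x : ℤ} (hx : x ∈ box n) :
    indicatorConfig (occupied n η) x = η x := by
  simp [indicatorConfig, occupied, hx]

lemma eq_occupied_iff {n : ℕ} {A : Finset ℤ} (hA : A ⊆ box n) (η : Config) :
    A = occupied n η ↔ ∀ x ∈ box n, η x = indicatorConfig A x := by
  constructor
  · rintro rfl x hx
    rw [indicatorConfig_occupied η hx]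
  · intro h
    ext x
    constructor
    · intro hx
      simp [occupied, hA hx, h x (hA hx), indicatorConfig, hx]
    · intro hx
      simp only [occupied, Finset.mem_filter] at hx
      have := h x hx.1
      rw [hx.2] at this
      simpa [indicatorConfig] using this.symm

/-- The indicator function of the event that `η` agrees on `Λ_n` with the configuration with
occupied sites `A`. -/
noncomputable def cyl (n : ℕ) (A : Finset ℤ) : Config → ℝ :=
  Set.indicator {η : Config | ∀ x ∈ box n, η x = indicatorConfig A x} fun _ => (1 : ℝ)

lemma cyl_apply {n : ℕ} {A : Finset ℤ} (hA : A ⊆ box n) (η : Config) :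
    cyl n A η = if A = occupied n η then 1 else 0 := by
  unfold cyl
  simp only [Set.indicator_apply, Set.mem_ofPred_eq, ← eq_occupied_iff hA]

lemma dependsOn_cyl (n : ℕ) (A : Finset ℤ) : DependsOn (cyl n A) (box n : Set ℤ) := by
  intro η ξ h
  unfold cyl
  simp only [Set.indicator_apply, Set.mem_ofPred_eq]
  congr 1
  exact propext (forall₂_congr fun x hx => by rw [h x hx])

/-- A local function is a linear combination of cylinder indicators. -/
lemma eq_sum_cyl {n : ℕ} {f : Config → ℝ} (hf : DependsOn f (box n : Set ℤ)) (η : Config) :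
    f η = ∑ A ∈ (box n).powerset, f (indicatorConfig A) * cyl n A η := by
  rw [Finset.sum_eq_single (occupied n η)]
  · rw [cyl_apply (occupied_subset n η), if_pos rfl, mul_one]
    exact hf fun x hx => (indicatorConfig_occupied η hx).symm
  · intro A hA hne
    rw [cyl_apply (Finset.mem_powerset.1 hA), if_neg hne, mul_zero]
  · intro h
    exact absurd (Finset.mem_powerset.2 (occupied_subset n η)) h

lemma measurableSet_cyl (n : ℕ) (e : Config) :
    MeasurableSet {η : Config | ∀ x ∈ box n, η x = e x} := by
  have : {η : Config | ∀ x ∈ box n, η x = e x} = ⋂ x ∈ box n, (fun η : Config => η x) ⁻¹' {e x} := by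
    ext; simp
  rw [this]
  exact Finset.measurableSet_biInter _ fun x _ => measurable_pi_apply x (measurableSet_singleton _)

lemma measurable_cyl (n : ℕ) (A : Finset ℤ) : Measurable (cyl n A) :=
  measurable_const.indicator (measurableSet_cyl n _)

lemma DependsOn.measurable_of_box {n : ℕ} {f : Config → ℝ} (hf : DependsOn f (box n : Set ℤ)) :
    Measurable f := by
  rw [funext (eq_sum_cyl hf)]
  exact Finset.measurable_fun_sum _ fun A _ => (measurable_cyl n A).const_mul _

lemma measurable_bdry_fun (n : ℕ) (u : Bool → Bool → ℝ) :
    Measurable[outsideAlg n] fun η : Config => u (η (-(n : ℤ) - 1)) (η ((n : ℤ) + 1)) := by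
  have h1 : ∀ x : ℤ, x ∉ box n → Measurable[outsideAlg n, ⊤] fun η : Config => η x := by
    intro x hx
    apply Measurable.mono (comap_measurable _) _ le_rfl
    exact le_iSup₂_of_le x (by simpa using hx) le_rfl
  have h2 : Measurable[outsideAlg n] fun η : Config =>
      (η (-(n : ℤ) - 1), η ((n : ℤ) + 1)) :=
    Measurable.prodMk (h1 _ (left_notMem_box n)) (h1 _ (right_notMem_box n))
  exact (measurable_of_countable fun p : Bool × Bool => u p.1 p.2).comp h2

lemma integrable_bdry_fun (n : ℕ) (u : Bool → Bool → ℝ) (ν : Measure Config)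
    [IsFiniteMeasure ν] :
    Integrable (fun η : Config => u (η (-(n : ℤ) - 1)) (η ((n : ℤ) + 1))) ν := by
  refine Integrable.of_bound (C := ∑ a, ∑ b, |u a b|)
    ((measurable_bdry_fun n u).mono (outsideAlg_le n) le_rfl).aestronglyMeasurable
    (Eventually.of_forall fun η => ?_)
  refine le_trans ?_ (Finset.single_le_sum (f := fun a => ∑ b, |u a b|)
    (fun _ _ => by positivity) (Finset.mem_univ (η (-(n : ℤ) - 1))))
  exact Finset.single_le_sum (f := fun b => |u (η (-(n : ℤ) - 1)) b|)
    (fun _ _ => abs_nonneg _) (Finset.mem_univ (η ((n : ℤ) + 1)))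

lemma integrable_of_dependsOn {n : ℕ} {f : Config → ℝ} (hf : DependsOn f (box n : Set ℤ))
    (ν : Measure Config) [IsFiniteMeasure ν] : Integrable f ν := by
  rw [funext (eq_sum_cyl hf)]
  exact integrable_finsetSum _ fun A _ =>
    ((integrable_const 1).indicator (measurableSet_cyl n _)).const_mul _

/-- The DLR equation, integrated over an event outside the block. -/
lemma setIntegral_eq_specMean {β lam : ℝ} {ν : Measure Config} (hν : IsIsing β lam ν) {n : ℕ}
    {f : Config → ℝ} (hf : DependsOn f (box n : Set ℤ)) {B : Set Config}
    (hB : MeasurableSet[outsideAlg n] B) :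
    ∫ η in B, f η ∂ν = ∫ η in B, specMean β lam n f (η (-(n : ℤ) - 1)) (η ((n : ℤ) + 1)) ∂ν := by
  have := hν.1
  have e : ∫ η in B, f η ∂ν =
      ∫ η in B, ∑ A ∈ (box n).powerset, f (indicatorConfig A) * cyl n A η ∂ν :=
    integral_congr_ae (Eventually.of_forall (eq_sum_cyl hf))
  rw [e]
  unfold specMean
  have hint : ∀ A, Integrable (cyl n A) ν := fun A =>
    (integrable_const 1).indicator (measurableSet_cyl n _)
  have hint' : ∀ A : Finset ℤ, Integrable (fun η : Config => localSpec β lam n (indicatorConfig A)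
      (bdry (η (-(n : ℤ) - 1)) (η ((n : ℤ) + 1)))) ν := fun A =>
    integrable_bdry_fun n (fun a b => localSpec β lam n (indicatorConfig A) (bdry a b)) ν
  rw [integral_finsetSum _ fun A _ => ((hint A).const_mul _).integrableOn,
    integral_finsetSum _ fun A _ => ((hint' A).const_mul _).integrableOn]
  refine Finset.sum_congr rfl fun A hA => ?_
  rw [integral_const_mul, integral_const_mul]
  congr 1
  rw [← setIntegral_condExp (outsideAlg_le n) (hint A) hB]
  refine integral_congr_ae (ae_restrict_of_ae ?_)
  filter_upwards [hν.2 n (indicatorConfig A)] with η hη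
  rw [← localSpec_eq_bdry]
  exact hη

lemma measurableSet_bdry (n : ℕ) (a b : Bool) :
    MeasurableSet[outsideAlg n] {η : Config | η (-(n : ℤ) - 1) = a ∧ η ((n : ℤ) + 1) = b} := by
  have h := measurable_bdry_fun n (fun a' b' => if a' = a ∧ b' = b then 1 else 0)
    (measurableSet_singleton (1 : ℝ))
  convert h using 1
  ext η
  simp

/-- A version of the DLR equation for functions that also depend on the boundary values. -/
lemma setIntegral_eq_specMean_bdry {β lam : ℝ} {ν : Measure Config} (hν : IsIsing β lam ν) {n : ℕ}
    {H : Bool → Bool → Config → ℝ} (hH : ∀ a b, DependsOn (H a b) (box n : Set ℤ))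
    {B : Set Config} (hB : MeasurableSet[outsideAlg n] B) :
    ∫ η in B, H (η (-(n : ℤ) - 1)) (η ((n : ℤ) + 1)) η ∂ν = ∫ η in B, specMean β lam n
      (H (η (-(n : ℤ) - 1)) (η ((n : ℤ) + 1))) (η (-(n : ℤ) - 1)) (η ((n : ℤ) + 1)) ∂ν := by
  have := hν.1
  classical
  set U : Bool → Bool → Set Config := fun a b =>
    {η | η (-(n : ℤ) - 1) = a ∧ η ((n : ℤ) + 1) = b} with hU
  have hUm : ∀ a b, MeasurableSet[outsideAlg n] (U a b) := measurableSet_bdry n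
  have hUmem : ∀ a b η, η ∈ U a b ↔ η (-(n : ℤ) - 1) = a ∧ η ((n : ℤ) + 1) = b :=
    fun _ _ _ => Iff.rfl
  have sum_eq : ∀ (v : Bool → Bool → ℝ) (η : Config),
      ∑ a, ∑ b, (if η ∈ U a b then v a b else 0) = v (η (-(n : ℤ) - 1)) (η ((n : ℤ) + 1)) := by
    intro v η
    simp only [hUmem, Fintype.sum_bool]
    generalize η (-(n : ℤ) - 1) = a
    generalize η ((n : ℤ) + 1) = b
    cases a <;> cases b <;> simp
  have key : ∀ F : Config → ℝ, Integrable F ν → ∫ η in B, F η ∂ν =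
      ∑ a, ∑ b, ∫ η in B ∩ U a b, F η ∂ν := by
    intro F hF
    have : ∀ η, B.indicator F η = ∑ a, ∑ b, (B ∩ U a b).indicator F η := by
      intro η
      simp only [Set.indicator_apply, Set.mem_inter_iff]
      by_cases hB : η ∈ B
      · simp only [hB, true_and, if_true]
        exact (sum_eq (fun _ _ => F η) η).symm
      · simp [hB]
    have hBm := outsideAlg_le n _ hB
    have hm : ∀ a b, MeasurableSet (B ∩ U a b) := fun a b =>
      hBm.inter (outsideAlg_le n _ (hUm a b))
    rw [← integral_indicator hBm, integral_congr_ae (Eventually.of_forall this),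
      integral_finsetSum _ fun a _ => integrable_finsetSum _ fun b _ => hF.indicator (hm a b)]
    refine Finset.sum_congr rfl fun a _ => ?_
    rw [integral_finsetSum _ fun b _ => hF.indicator (hm a b)]
    exact Finset.sum_congr rfl fun b _ => integral_indicator (hm a b)
  have hint : Integrable (fun η => H (η (-(n : ℤ) - 1)) (η ((n : ℤ) + 1)) η) ν := by
    have : (fun η : Config => H (η (-(n : ℤ) - 1)) (η ((n : ℤ) + 1)) η) =
        fun η => ∑ a, ∑ b, (U a b).indicator (H a b) η := by
      ext η
      simp only [Set.indicator_apply]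
      exact (sum_eq (fun a b => H a b η) η).symm
    rw [this]
    exact integrable_finsetSum _ fun a _ => integrable_finsetSum _ fun b _ =>
      (integrable_of_dependsOn (hH a b) ν).indicator (outsideAlg_le n _ (hUm a b))
  rw [key _ hint, key _ (integrable_bdry_fun n
    (fun a b => specMean β lam n (H a b) a b) ν)]
  refine Finset.sum_congr rfl fun a _ => Finset.sum_congr rfl fun b _ => ?_
  have h := setIntegral_eq_specMean hν (hH a b) (hB.inter (hUm a b))
  have hm := outsideAlg_le n _ (hB.inter (hUm a b))
  rw [setIntegral_congr_fun hm (g := H a b) (fun η hη => by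
    rw [((hUmem a b η).1 hη.2).1, ((hUmem a b η).1 hη.2).2]), h]
  exact setIntegral_congr_fun hm fun η hη => by
    rw [((hUmem a b η).1 hη.2).1, ((hUmem a b η).1 hη.2).2]

lemma integral_eq_specMean {β lam : ℝ} {ν : Measure Config} (hν : IsIsing β lam ν) {n : ℕ}
    {f : Config → ℝ} (hf : DependsOn f (box n : Set ℤ)) :
    ∫ η, f η ∂ν = ∫ η, specMean β lam n f (η (-(n : ℤ) - 1)) (η ((n : ℤ) + 1)) ∂ν := by
  have := setIntegral_eq_specMean hν hf (B := Set.univ) MeasurableSet.univ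
  simpa only [setIntegral_univ] using this

/-- An average over the boundary values inherits a uniform bound. -/
lemma abs_integral_bdry_sub_le (ν : Measure Config) [IsProbabilityMeasure ν] (n : ℕ)
    (u : Bool → Bool → ℝ) {c K : ℝ} (h : ∀ a b, |u a b - c| ≤ K) :
    |∫ η : Config, u (η (-(n : ℤ) - 1)) (η ((n : ℤ) + 1)) ∂ν - c| ≤ K := by
  have h1 : ∫ η : Config, u (η (-(n : ℤ) - 1)) (η ((n : ℤ) + 1)) ∂ν - c =
      ∫ η : Config, (u (η (-(n : ℤ) - 1)) (η ((n : ℤ) + 1)) - c) ∂ν := by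
    rw [integral_sub (integrable_bdry_fun n u ν) (integrable_const c)]
    simp
  rw [h1]
  have := norm_integral_le_of_norm_le_const (μ := ν) (C := K)
    (f := fun η : Config => u (η (-(n : ℤ) - 1)) (η ((n : ℤ) + 1)) - c)
    (Eventually.of_forall fun η => h _ _)
  simpa using this

lemma tendsto_integral_bdry (ν : Measure Config) [IsProbabilityMeasure ν]
    {u : ℕ → Bool → Bool → ℝ} {c : ℝ} (h : ∀ a b, Tendsto (fun n => u n a b) atTop (𝓝 c)) :
    Tendsto (fun n : ℕ => ∫ η : Config, u n (η (-(n : ℤ) - 1)) (η ((n : ℤ) + 1)) ∂ν)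
      atTop (𝓝 c) := by
  rw [tendsto_iff_norm_sub_tendsto_zero]
  have h0 : Tendsto (fun n => ∑ a, ∑ b, ‖u n a b - c‖) atTop (𝓝 0) := by
    have : Tendsto (fun n => ∑ a : Bool, ∑ b : Bool, ‖u n a b - c‖) atTop
        (𝓝 (∑ a : Bool, ∑ b : Bool, 0)) :=
      tendsto_finsetSum _ fun a _ => tendsto_finsetSum _ fun b _ =>
        tendsto_iff_norm_sub_tendsto_zero.1 (h a b)
    simpa using this
  refine squeeze_zero (fun _ => norm_nonneg _) (fun n => ?_) h0
  refine abs_integral_bdry_sub_le ν n (u n) fun a b => ?_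
  refine le_trans ?_ (Finset.single_le_sum (f := fun a => ∑ b, ‖u n a b - c‖)
    (fun _ _ => by positivity) (Finset.mem_univ a))
  exact Finset.single_le_sum (f := fun b => ‖u n a b - c‖)
    (fun _ _ => norm_nonneg _) (Finset.mem_univ b)

/-- Every cylinder has positive probability. -/
lemma cyl_pos {β lam : ℝ} {ν : Measure Config} (hν : IsIsing β lam ν) (n : ℕ) {A : Finset ℤ}
    (hA : A ⊆ box n) : 0 < ∫ η, cyl n A η ∂ν := by
  have := hν.1
  rw [integral_eq_specMean hν (dependsOn_cyl n A)]
  have hu : ∀ a b, 0 < specMean β lam n (cyl n A) a b := by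
    intro a b
    have h1 : specMean β lam n (cyl n A) a b = localSpec β lam n (indicatorConfig A) (bdry a b) := by
      unfold specMean
      rw [Finset.sum_eq_single A]
      · rw [cyl_apply hA, if_pos, one_mul]
        exact (eq_occupied_iff hA _).2 fun _ _ => rfl
      · intro A' hA' hne
        rw [cyl_apply hA, if_neg, zero_mul]
        intro h
        refine hne ?_
        rw [h]
        exact (eq_occupied_iff (Finset.mem_powerset.1 hA') _).2 fun _ _ => rfl
      · exact fun h => absurd (Finset.mem_powerset.2 hA) h
    rw [h1]
    exact div_pos (boltzmann_pos ..) (partitionFn_pos ..)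
  rw [integral_pos_iff_support_of_nonneg (fun η => (hu _ _).le)
    (integrable_bdry_fun n (specMean β lam n (cyl n A)) ν)]
  have : Function.support (fun η : Config => specMean β lam n (cyl n A) (η (-(n : ℤ) - 1))
      (η ((n : ℤ) + 1))) = Set.univ := by
    ext η; simp [(hu _ _).ne']
  rw [this]; simp

end SpeedChange

namespace SpeedChange

/-! ### Expectations under the tilted measures and the tilt as a function of the density -/

/-- At a real tilt all entries of `projPlus * edgeMatrix` are nonzero. -/
lemma projPlus_mul_edge_ofReal_ne (β x : ℝ) (a b : Bool) :
    (projPlus β x * edgeMatrix β) a b ≠ 0 := by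
  have hp := bondEq_pos β
  have hr := bondNe_pos β
  obtain ⟨vt, hvt, ht⟩ := leftVec_ofReal_pos β x true
  obtain ⟨vf, hvf, hf⟩ := leftVec_ofReal_pos β x false
  set g : ℝ := √((bondEq β * Real.sinh (x / 2)) ^ 2 + bondNe β ^ 2) with hg
  have hg0 : 0 < g := Real.sqrt_pos.2 (by positivity)
  have hgx : gap β x = g := gap_ofReal β x
  have hP : ∃ u : ℝ, 0 < u ∧ projPlus β x a true = u := by
    cases a
    · refine ⟨(2 * g)⁻¹ * (bondNe β * Real.exp (x / 2)), by positivity, ?_⟩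
      simp [projPlus, Matrix.sub_apply, transfer_apply, hgx]
    · refine ⟨(2 * g)⁻¹ * vt, by positivity, ?_⟩
      have h1 := exp_half_eq (x : ℂ)
      push_cast
      rw [← ht]
      simp only [projPlus, Matrix.smul_apply, Matrix.sub_apply, transfer_apply, muMinus, hgx,
        leftVec, smul_eq_mul, Matrix.one_apply_eq, if_true, h1]
      ring
  obtain ⟨u, hu, hPu⟩ := hP
  have hne : leftVec β x true ≠ 0 := by rw [ht]; exact_mod_cast hvt.ne'
  simp only [Matrix.mul_apply, Fintype.sum_bool, edgeMatrix_apply]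
  rw [projPlus_apply β hne a false, hPu, ht, hf]
  cases b <;> simp only [if_true, if_false, Bool.true_eq_false, Bool.false_eq_true] <;> norm_cast <;>
    positivity

lemma norm_muMinus_ofReal_lt (β x : ℝ) : ‖muMinus β x‖ < ‖muPlus β x‖ := by
  have hp := bondEq_pos β
  have hr := bondNe_pos β
  set g : ℝ := √((bondEq β * Real.sinh (x / 2)) ^ 2 + bondNe β ^ 2) with hg
  have hg0 : 0 < g := Real.sqrt_pos.2 (by positivity)
  have hgx : gap β x = g := gap_ofReal β x
  have hc := Real.cosh_pos (x / 2)
  have h1 : muMinus β x = ((bondEq β * Real.cosh (x / 2) - g : ℝ) : ℂ) := by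
    unfold muMinus; rw [hgx]; push_cast; ring
  have h2 : muPlus β x = ((bondEq β * Real.cosh (x / 2) + g : ℝ) : ℂ) := by
    unfold muPlus; rw [hgx]; push_cast; ring
  have h3 := mul_pos hp hc
  rw [h1, h2, Complex.norm_real, Complex.norm_real, Real.norm_eq_abs, Real.norm_eq_abs,
    abs_of_pos (by linarith : 0 < bondEq β * Real.cosh (x / 2) + g), abs_lt]
  constructor <;> linarith

/-- The thermodynamic limit of finite-volume expectations at a real tilt does not depend on the
boundary values. -/
lemma tendsto_specMean (β x : ℝ) (l : ℕ) {f : Config → ℝ} (hf : DependsOn f (box l : Set ℤ))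
    (a b : Bool) : Tendsto (fun m => (specMean β x (l + m) f a b : ℂ)) atTop
      (𝓝 (tilted β l f x)) := by
  have hlt := norm_muMinus_ofReal_lt β x
  have hμ : muPlus β x ≠ 0 := norm_pos_iff.1 (lt_of_le_of_lt (norm_nonneg _) hlt)
  have hg : gap β x ≠ 0 := by
    rw [gap_ofReal]
    have hr := bondNe_pos β
    exact_mod_cast (Real.sqrt_pos.2 (by positivity)).ne'
  have hv : leftVec β x true ≠ 0 := by
    obtain ⟨vt, hvt, ht⟩ := leftVec_ofReal_pos β x true
    rw [ht]; exact_mod_cast hvt.ne'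
  have hP := projPlus_mul_edge_ofReal_ne β x a b
  have key := fun m => congrFun (congrFun (genFn_sub_tilted_smul β l m hf hg hv
    (leftForm_one_ne_zero β x l)) a) b
  have hden := fun m => congrFun (congrFun (genFn_one β (l + m) x) a) b
  simp only [transfer_pow β hg, Matrix.add_mul, Matrix.smul_mul, Matrix.add_apply,
    Matrix.smul_apply, smul_eq_mul] at hden
  simp only [Matrix.sub_apply, Matrix.smul_apply, Matrix.add_apply, smul_eq_mul] at key
  have hne : ∀ n, genFn β n (fun _ => 1) x a b ≠ 0 := by
    intro n
    obtain ⟨v, hv, h⟩ := genFn_one_ofReal_pos β x n a b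
    rw [h]; exact_mod_cast hv.ne'
  set ρ := muMinus β x / muPlus β x with hρ
  have hρ1 : ‖ρ‖ < 1 := by
    rw [hρ, norm_div, div_lt_one (norm_pos_iff.2 hμ)]; exact hlt
  have hlim := tendsto_pow_atTop_nhds_zero_of_norm_lt_one hρ1
  generalize (projPlus β x * (genFn β l f x - tilted β l f x • genFn β l (fun _ => 1) x) *
    (projMinus β x).transpose) a b + (projMinus β x * (genFn β l f x - tilted β l f x •
    genFn β l (fun _ => 1) x) * (projPlus β x).transpose) a b = X at key
  generalize (projMinus β x * (genFn β l f x - tilted β l f x • genFn β l (fun _ => 1) x) *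
    (projMinus β x).transpose) a b = Y at key
  generalize (projPlus β x * edgeMatrix β) a b = P at hden hP
  generalize (projMinus β x * edgeMatrix β) a b = Q at hden
  have e : ∀ m, (specMean β x (l + m) f a b : ℂ) = tilted β l f x +
      (ρ ^ m * X + ρ ^ m * ρ ^ m * Y) / (muPlus β x ^ (2 * l + 1) * P +
        ρ ^ m * ρ ^ m * (muMinus β x ^ (2 * l + 1) * Q)) := by
    intro m
    rw [ofReal_specMean]
    have h1 : genFn β (l + m) f x a b = tilted β l f x * genFn β (l + m) (fun _ => 1) x a b +
        muPlus β x ^ (2 * m) * (ρ ^ m * X + ρ ^ m * ρ ^ m * Y) := by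
      have e1 : muPlus β x ^ (2 * m) * (ρ ^ m * X + ρ ^ m * ρ ^ m * Y) =
          (muPlus β x * muMinus β x) ^ m * X + (muMinus β x ^ 2) ^ m * Y := by
        have : muMinus β x = ρ * muPlus β x := by rw [hρ, div_mul_cancel₀ _ hμ]
        rw [this]; ring
      rw [e1]
      linear_combination key m
    have h2 : genFn β (l + m) (fun _ => 1) x a b = muPlus β x ^ (2 * m) *
        (muPlus β x ^ (2 * l + 1) * P + ρ ^ m * ρ ^ m * (muMinus β x ^ (2 * l + 1) * Q)) := by
      have e2 : muMinus β x ^ (2 * (l + m) + 1) =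
          muPlus β x ^ (2 * m) * (ρ ^ m * ρ ^ m) * muMinus β x ^ (2 * l + 1) := by
        have : muMinus β x = ρ * muPlus β x := by rw [hρ, div_mul_cancel₀ _ hμ]
        rw [this]; ring
      rw [hden m, e2]; ring
    rw [h1, add_div, mul_div_cancel_right₀ _ (hne _), h2, mul_div_mul_left _ _ (pow_ne_zero _ hμ)]
  simp only [e]
  have hz : Tendsto (fun m => tilted β l f x +
      (ρ ^ m * X + ρ ^ m * ρ ^ m * Y) / (muPlus β x ^ (2 * l + 1) * P +
        ρ ^ m * ρ ^ m * (muMinus β x ^ (2 * l + 1) * Q))) atTop (𝓝 (tilted β l f x +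
      (0 * X + 0 * 0 * Y) / (muPlus β x ^ (2 * l + 1) * P +
        0 * 0 * (muMinus β x ^ (2 * l + 1) * Q)))) := by
    refine tendsto_const_nhds.add (Tendsto.div ?_ ?_ ?_)
    · exact (hlim.mul_const X).add ((hlim.mul hlim).mul_const Y)
    · exact tendsto_const_nhds.add ((hlim.mul hlim).mul_const _)
    · simp [hP, hμ]
  simpa using hz

/-- Local expectations under the tilted Ising measure. -/
lemma ofReal_integral_eq_tilted {β lam : ℝ} {ν : Measure Config} (hν : IsIsing β lam ν) (l : ℕ)
    {f : Config → ℝ} (hf : DependsOn f (box l : Set ℤ)) :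
    ((∫ η, f η ∂ν : ℝ) : ℂ) = tilted β l f lam := by
  have := hν.1
  have hre : ∀ a b, Tendsto (fun n => specMean β lam n f a b) atTop
      (𝓝 (tilted β l f lam).re) := by
    intro a b
    have h := (Complex.continuous_re.tendsto _).comp (tendsto_specMean β lam l hf a b)
    rw [← tendsto_add_atTop_iff_nat l]
    simpa only [Function.comp_def, Complex.ofReal_re, add_comm l] using h
  have him : (tilted β l f lam).im = 0 := by
    have h := (Complex.continuous_im.tendsto _).comp (tendsto_specMean β lam l hf true true)
    simp only [Function.comp_def, Complex.ofReal_im] at h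
    exact tendsto_nhds_unique h tendsto_const_nhds
  have h1 := tendsto_integral_bdry ν (u := fun n => specMean β lam n f) hre
  have h2 : ∫ η, f η ∂ν = (tilted β l f lam).re := by
    refine tendsto_nhds_unique ((tendsto_congr' ?_).1 tendsto_const_nhds) h1
    filter_upwards [eventually_ge_atTop l] with n hn
    exact integral_eq_specMean hν (DependsOn.mono_box hf hn)
  rw [h2]
  exact Complex.ext (by simp) (by simp [him])

lemma leftVec_mul_transfer (β : ℝ) (w : ℂ) (c : Bool) :
    ∑ a, leftVec β w a * transfer β w a c = muPlus β w * leftVec β w c := by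
  have h1 := gap_sq β w
  have h2 := exp_half_mul w
  have e1 := exp_half_eq w
  have e2 := exp_neg_half_eq w
  simp only [Fintype.sum_bool, transfer_apply, leftVec, muPlus]
  rw [e1, e2] at h2 ⊢
  generalize gap β w = g at *
  generalize Complex.cosh (w / 2) = ch at *
  generalize Complex.sinh (w / 2) = sh at *
  cases c <;> simp
  · ring
  · linear_combination (-1 : ℂ) * h1 + (bondNe β : ℂ) ^ 2 * h2

lemma transfer_eq_edgeMatrix_mul (β : ℝ) (w : ℂ) (a c : Bool) :
    transfer β w a c = edgeMatrix β c a * Complex.exp (w * spin c) := by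
  unfold transfer edgeMatrix
  rw [mul_right_comm β (spin c)]

lemma genFn_zero_apply (β : ℝ) (f : Config → ℝ) (w : ℂ) (a b : Bool) :
    genFn β 0 f w a b = f (indicatorConfig ∅) * transfer β w a false * edgeMatrix β false b +
      f (indicatorConfig {0}) * transfer β w a true * edgeMatrix β true b := by
  have hb : box 0 = {0} := by ext x; simp only [mem_box, Finset.mem_singleton]; omega
  have hp : (box 0).powerset = {∅, {0}} := by rw [hb]; rfl
  simp only [genFn, hp]
  rw [Finset.sum_pair (by simp)]
  simp only [energy, blockSum, hb, occ_sub_half, transfer, edgeMatrix, bdry]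
  have h1 : indicatorConfig ∅ 0 = false := by simp [indicatorConfig]
  have h2 : indicatorConfig {0} 0 = true := by simp [indicatorConfig]
  simp [Complex.exp_add, h1, h2]
  ring

/-- On a single site the quadratic form is explicit, which gives the density in closed form. -/
lemma leftForm_genFn_zero (β : ℝ) (f : Config → ℝ) (w : ℂ) :
    leftForm β w (genFn β 0 f w) = muPlus β w ^ 2 *
      (f (indicatorConfig ∅) * leftVec β w false ^ 2 * Complex.exp (w / 2) +
        f (indicatorConfig {0}) * leftVec β w true ^ 2 * Complex.exp (-(w / 2))) := by
  have ht := leftVec_mul_transfer β w true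
  have hf := leftVec_mul_transfer β w false
  have e : ∀ c b, edgeMatrix β c b = transfer β w b c * Complex.exp (-(w * spin c)) := by
    intro c b
    rw [transfer_eq_edgeMatrix_mul, mul_assoc, ← Complex.exp_add, add_neg_cancel, Complex.exp_zero,
      mul_one]
  have s1 : Complex.exp (-(w * spin true)) = Complex.exp (-(w / 2)) := by
    congr 1; simp [spin]; ring
  have s2 : Complex.exp (-(w * spin false)) = Complex.exp (w / 2) := by
    congr 1; simp [spin]; ring
  have e1 : ∀ a b, genFn β 0 f w a b = f (indicatorConfig ∅) * transfer β w a false *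
      (transfer β w b false * Complex.exp (w / 2)) + f (indicatorConfig {0}) *
      transfer β w a true * (transfer β w b true * Complex.exp (-(w / 2))) := by
    intro a b
    rw [genFn_zero_apply, e, e, s1, s2]
  simp only [leftForm, e1, Fintype.sum_bool]
  rw [Fintype.sum_bool] at ht hf
  generalize leftVec β w true = vt at *
  generalize leftVec β w false = vf at *
  generalize Complex.exp (-(w / 2)) = z at *
  generalize Complex.exp (w / 2) = y at *
  generalize (f (indicatorConfig ∅) : ℂ) = f0 at *
  generalize (f (indicatorConfig {0}) : ℂ) = f1 at *
  have ht2 := congrArg (· ^ 2) ht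
  have hf2 := congrArg (· ^ 2) hf
  beta_reduce at ht2 hf2
  linear_combination f1 * z * ht2 + f0 * y * hf2

lemma dependsOn_occ_zero : DependsOn (fun η => occ η 0) (box 0 : Set ℤ) := by
  intro η ξ h
  have := h 0 (by simp [box])
  simp [occ, this]

lemma density_eq_of_isIsing {β lam : ℝ} {ν : Measure Config} (hν : IsIsing β lam ν) :
    ∫ η, occ η 0 ∂ν =
      1 / 2 + Real.sin (Real.arctan (bondEq β / bondNe β * Real.sinh (lam / 2))) / 2 := by
  have h := ofReal_integral_eq_tilted hν 0 dependsOn_occ_zero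
  have hp := bondEq_pos β
  have hr := bondNe_pos β
  set g : ℝ := √((bondEq β * Real.sinh (lam / 2)) ^ 2 + bondNe β ^ 2) with hg
  have hg0 : 0 < g := Real.sqrt_pos.2 (by positivity)
  have hg2 : g ^ 2 = (bondEq β * Real.sinh (lam / 2)) ^ 2 + bondNe β ^ 2 :=
    Real.sq_sqrt (by positivity)
  have hμ : muPlus β lam ≠ 0 :=
    norm_pos_iff.1 (lt_of_le_of_lt (norm_nonneg _) (norm_muMinus_ofReal_lt β lam))
  obtain ⟨v, hv, hv'⟩ := leftVec_ofReal_pos β lam true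
  have hvg : v = bondEq β * Real.sinh (lam / 2) + g := by
    have : (v : ℂ) = ((bondEq β * Real.sinh (lam / 2) + g : ℝ) : ℂ) := by
      rw [← hv']; simp [leftVec, gap_ofReal, hg]
    exact_mod_cast this
  have hf : leftVec β lam false = ((bondNe β * Real.exp (-(lam / 2)) : ℝ) : ℂ) := by
    simp [leftVec]
  have key : ∫ η, occ η 0 ∂ν = v ^ 2 / (v ^ 2 + bondNe β ^ 2) := by
    have e0 : occ (indicatorConfig ∅) 0 = 0 := by simp [occ, indicatorConfig]
    have e1 : occ (indicatorConfig {0}) 0 = 1 := by simp [occ, indicatorConfig]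
    rw [tilted, leftForm_genFn_zero, leftForm_genFn_zero, mul_div_mul_left _ _ (pow_ne_zero 2 hμ),
      hv', hf] at h
    simp only [e0, e1] at h
    have e2 : Real.exp (lam / 2) = (Real.exp (-(lam / 2)))⁻¹ := by rw [← Real.exp_neg, neg_neg]
    have h' : ∫ η, occ η 0 ∂ν = (0 * (bondNe β * Real.exp (-(lam / 2))) ^ 2 * Real.exp (lam / 2) +
        1 * v ^ 2 * Real.exp (-(lam / 2))) /
        (1 * (bondNe β * Real.exp (-(lam / 2))) ^ 2 * Real.exp (lam / 2) +
        1 * v ^ 2 * Real.exp (-(lam / 2))) := by exact_mod_cast h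
    rw [h', e2]
    have := Real.exp_pos (-(lam / 2))
    field_simp
    ring
  rw [key, Real.sin_arctan]
  have hs : √(1 + (bondEq β / bondNe β * Real.sinh (lam / 2)) ^ 2) = g / bondNe β := by
    rw [← Real.sqrt_sq (div_pos hg0 hr).le, div_pow, hg2]
    congr 1
    field_simp
    ring
  rw [hs]
  have hden : v ^ 2 + bondNe β ^ 2 = 2 * g * v := by rw [hvg]; linear_combination (-1 : ℝ) * hg2
  rw [hden, hvg]
  have : bondEq β * Real.sinh (lam / 2) + g ≠ 0 := by rw [← hvg]; exact hv.ne'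
  field_simp
  ring

/-- The density of the tilted measure in closed form. -/
lemma density_eq (β lam : ℝ) : density β lam =
    1 / 2 + Real.sin (Real.arctan (bondEq β / bondNe β * Real.sinh (lam / 2))) / 2 :=
  density_eq_of_isIsing (ising_isIsing β lam)

/-- The inverse of the density in closed form. -/
noncomputable def densityInv (β z : ℝ) : ℝ :=
  2 * Real.arsinh (bondNe β / bondEq β * Real.tan (Real.arcsin (2 * z - 1)))

lemma densityInv_density (β lam : ℝ) : densityInv β (density β lam) = lam := by
  have hp := (bondEq_pos β).ne'
  have hr := (bondNe_pos β).ne'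
  rw [density_eq, densityInv]
  rw [show ∀ s : ℝ, 2 * (1 / 2 + s / 2) - 1 = s by intro s; ring,
    Real.arcsin_sin (Real.neg_pi_div_two_lt_arctan _).le (Real.arctan_lt_pi_div_two _).le,
    Real.tan_arctan, ← mul_assoc, div_mul_div_cancel₀ hp, div_self hr, one_mul, Real.arsinh_sinh]
  ring

lemma density_densityInv (β : ℝ) {z : ℝ} (h0 : 0 < z) (h1 : z < 1) :
    density β (densityInv β z) = z := by
  have hp := (bondEq_pos β).ne'
  have hr := (bondNe_pos β).ne'
  rw [density_eq, densityInv, mul_div_cancel_left₀ _ two_ne_zero, Real.sinh_arsinh, ← mul_assoc,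
    div_mul_div_cancel₀ hr, div_self hp, one_mul, Real.arctan_tan, Real.sin_arcsin]
  · ring
  · linarith
  · linarith
  · exact Real.neg_pi_div_two_lt_arcsin.2 (by linarith)
  · exact Real.arcsin_lt_pi_div_two.2 (by linarith)

lemma tilt_eq_densityInv (β : ℝ) {z : ℝ} (h0 : 0 < z) (h1 : z < 1) :
    tilt β z = densityInv β z := by
  have hinj : Function.Injective (density β) :=
    Function.LeftInverse.injective (densityInv_density β)
  conv_lhs => rw [← density_densityInv β h0 h1]
  exact Function.leftInverse_invFun hinj _

lemma tilt_half (β : ℝ) : tilt β (1 / 2) = 0 := by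
  rw [tilt_eq_densityInv β (by norm_num) (by norm_num), densityInv]
  norm_num

lemma hasDerivAt_densityInv (β : ℝ) : HasDerivAt (densityInv β) (1 / susc β) (1 / 2) := by
  have hp := (bondEq_pos β).ne'
  have hr := (bondNe_pos β).ne'
  have h1 : HasDerivAt (fun z : ℝ => 2 * z - 1) 2 (1 / 2) := by
    simpa using ((hasDerivAt_id (1 / 2 : ℝ)).const_mul 2).sub_const 1
  have e0 : (2 : ℝ) * (1 / 2) - 1 = 0 := by norm_num
  have h2 : HasDerivAt (fun z : ℝ => Real.arcsin (2 * z - 1)) 2 (1 / 2) := by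
    have := (Real.hasDerivAt_arcsin (x := 0) (by norm_num) (by norm_num))
    rw [← e0] at this
    simpa [Function.comp_def] using this.comp (1 / 2) h1
  have h3 : HasDerivAt (fun z : ℝ => Real.tan (Real.arcsin (2 * z - 1))) 2 (1 / 2) := by
    have := (Real.hasDerivAt_tan (x := Real.arcsin (2 * (1 / 2) - 1)) (by norm_num))
    simpa [Function.comp_def] using this.comp (1 / 2) h2
  have h4 := (h3.const_mul (bondNe β / bondEq β)).arsinh.const_mul 2
  refine h4.congr_deriv ?_
  rw [susc, e0]
  simp only [Real.arcsin_zero, Real.tan_zero, mul_zero]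
  norm_num
  field_simp
  norm_num

lemma deriv_tilt_half (β : ℝ) : deriv (tilt β) (1 / 2) = 1 / susc β := by
  have : tilt β =ᶠ[𝓝 (1 / 2)] densityInv β := by
    filter_upwards [Ioo_mem_nhds (by norm_num : (0 : ℝ) < 1 / 2) (by norm_num : (1 / 2 : ℝ) < 1)]
      with z hz
    exact tilt_eq_densityInv β hz.1 hz.2
  rw [this.deriv_eq, (hasDerivAt_densityInv β).deriv]

lemma nu_half (β : ℝ) : nu β (1 / 2) = ising β 0 := by rw [nu, tilt_half]

end SpeedChange

namespace SpeedChange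

/-! ### Moments of the block sum -/

lemma genFn_hasDerivAt (β : ℝ) (n : ℕ) (f : Config → ℝ) (a b : Bool) (w : ℂ) :
    HasDerivAt (fun w => genFn β n f w a b) (genFn β n (fun η => f η * blockSum n η) w a b) w := by
  unfold genFn
  refine HasDerivAt.fun_sum fun A _ => ?_
  have h := (((hasDerivAt_id w).mul_const (blockSum n (indicatorConfig A) : ℂ)).cexp).const_mul
    ((f (indicatorConfig A) * Real.exp (-energy β n (indicatorConfig A) (bdry a b)) : ℝ) : ℂ)
  refine h.congr_deriv ?_
  push_cast
  simp only [id]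
  ring

lemma iteratedDeriv_genFn (β : ℝ) (n : ℕ) (f : Config → ℝ) (a b : Bool) (i : ℕ) :
    iteratedDeriv i (fun w => genFn β n f w a b) =
      fun w => genFn β n (fun η => f η * blockSum n η ^ i) w a b := by
  induction i with
  | zero => simp
  | succ i ih =>
    rw [iteratedDeriv_succ, ih]
    ext w
    rw [(genFn_hasDerivAt β n _ a b w).deriv]
    simp only [pow_succ, mul_assoc]

lemma dependsOn_blockSum (n : ℕ) : DependsOn (blockSum n) (box n : Set ℤ) :=
  fun _ _ h => blockSum_congr fun x hx => h x hx

lemma tendsto_vol : Tendsto vol atTop atTop := by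
  unfold vol
  exact tendsto_atTop_add_const_right _ _
    (tendsto_natCast_atTop_atTop.const_mul_atTop two_pos)

lemma tendsto_inv_sqrt_vol : Tendsto (fun n : ℕ => 1 / √(vol n)) atTop (𝓝 0) := by
  simp only [one_div]
  exact (Real.tendsto_sqrt_atTop.comp tendsto_vol).inv_tendsto_atTop

/-- On the scale `N^{-1/2}` the generating function of `1` is Gaussian up to `O(N^{-1/2})`. -/
lemma eventually_norm_genFn_one_div_sub_le_inv_sqrt (β : ℝ) :
    ∃ C : ℝ, 0 < C ∧ ∀ᶠ n : ℕ in atTop, ∀ a b, ∀ w : ℂ, ‖w‖ ≤ 1 / √(vol n) →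
      ‖genFn β n (fun _ => 1) w a b / bulk β n - Complex.exp (vol n * (susc β / 2 * w ^ 2))‖
        ≤ C * (1 / √(vol n)) ∧ ‖Complex.exp (vol n * (susc β / 2 * w ^ 2))‖ ≤
          Real.exp (susc β / 2) := by
  obtain ⟨C, hC, h⟩ := eventually_norm_genFn_one_div_sub_le β
  obtain ⟨K, hK, hq⟩ := exists_pow_le_inv_sqrt_vol (decayRate_pos β) (decayRate_lt_one β)
  have hτ := susc_pos β
  obtain ⟨r, hr, hball⟩ := Metric.eventually_nhds_iff.1 h
  refine ⟨C * 2 * Real.exp C * Real.exp (susc β / 2) + C * K + 1, by positivity, ?_⟩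
  filter_upwards [tendsto_inv_sqrt_vol.eventually_lt_const hr] with n hn a b w hw
  have hN := vol_pos n
  have hN1 := one_le_vol n
  set s : ℝ := 1 / √(vol n) with hs
  have hs0 : 0 < s := by positivity
  have hs1 : s ≤ 1 := by
    rw [hs, div_le_one (Real.sqrt_pos.2 hN)]
    exact Real.one_le_sqrt.2 hN1
  have hNs : vol n * s ^ 2 = 1 := by
    rw [hs, div_pow, one_pow, Real.sq_sqrt hN.le, mul_one_div_cancel hN.ne']
  have h3 : vol n * ‖w‖ ^ 3 ≤ s := by
    calc vol n * ‖w‖ ^ 3 ≤ vol n * s ^ 3 := by gcongr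
      _ = vol n * s ^ 2 * s := by ring
      _ = s := by rw [hNs, one_mul]
  have hexp : ‖Complex.exp (vol n * (susc β / 2 * w ^ 2))‖ ≤ Real.exp (susc β / 2) := by
    refine (Complex.norm_exp_le_exp_norm _).trans (Real.exp_le_exp.2 ?_)
    rw [norm_mul, norm_mul, norm_pow, Complex.norm_real, Real.norm_of_nonneg hN.le,
      show ((susc β : ℂ) / 2) = ((susc β / 2 : ℝ) : ℂ) by push_cast; rfl, Complex.norm_real,
      Real.norm_of_nonneg (by positivity)]
    calc vol n * (susc β / 2 * ‖w‖ ^ 2) ≤ vol n * (susc β / 2 * s ^ 2) := by gcongr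
      _ = vol n * s ^ 2 * (susc β / 2) := by ring
      _ = susc β / 2 := by rw [hNs, one_mul]
  refine ⟨?_, hexp⟩
  have hk := hball (y := w) (by rw [dist_zero_right]; exact lt_of_le_of_lt hw hn) n a b
  have hq' : decayRate β ^ n ≤ K * s := by
    refine (hq n).trans (mul_le_mul_of_nonneg_left ?_ hK.le)
    exact pow_le_of_le_one hs0.le hs1 (by norm_num)
  calc _ ≤ _ := hk
    _ ≤ C * (s + s) * Real.exp (C * 1) * Real.exp (susc β / 2) + C * (K * s) := by
        gcongr
        exact h3.trans hs1
    _ = (C * 2 * Real.exp C * Real.exp (susc β / 2) + C * K) * s := by rw [mul_one]; ring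
    _ ≤ (C * 2 * Real.exp C * Real.exp (susc β / 2) + C * K + 1) * s :=
        mul_le_mul_of_nonneg_right (by linarith) hs0.le

lemma eventually_half_le_genFn_one_div (β : ℝ) :
    ∀ᶠ n : ℕ in atTop, ∀ a b, 1 / 2 ≤ (genFn β n (fun _ => 1) 0 a b / bulk β n).re := by
  obtain ⟨C, hC, h⟩ := eventually_norm_genFn_one_div_sub_le_inv_sqrt β
  filter_upwards [h, tendsto_inv_sqrt_vol.eventually_lt_const (show 0 < 1 / (2 * C) by positivity)]
    with n hn hs a b
  have h1 := (hn a b 0 (by simp)).1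
  have h2 := Complex.abs_re_le_norm (genFn β n (fun _ => 1) 0 a b / bulk β n -
    Complex.exp (vol n * (susc β / 2 * 0 ^ 2)))
  have h3 : C * (1 / √(vol n)) ≤ 1 / 2 := by
    calc C * (1 / √(vol n)) ≤ C * (1 / (2 * C)) := by gcongr
      _ = 1 / 2 := by field_simp
  have h4 := (h2.trans h1).trans h3
  simp only [Complex.sub_re, ne_eq, OfNat.ofNat_ne_zero, not_false_eq_true, zero_pow, mul_zero,
    Complex.exp_zero, Complex.one_re] at h4
  linarith [(abs_le.1 h4).1]

lemma genFn_one_div_bulk (β : ℝ) (n : ℕ) (a b : Bool) :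
    ∃ v : ℝ, 0 < v ∧ genFn β n (fun _ => 1) 0 a b / bulk β n = v := by
  obtain ⟨v, hv, h⟩ := genFn_one_ofReal_pos β 0 n a b
  rw [Complex.ofReal_zero] at h
  exact ⟨v / bulk β n, div_pos hv (bulk_pos β n), by rw [h]; push_cast; rfl⟩

/-- If all lower derivatives of the tilted expectation of `f` at `0` vanish, then the `i`-th one is
the limit of the finite-volume expectations of `f S^i`. -/
lemma tendsto_specMean_mul_pow (β : ℝ) (l i : ℕ) {f : Config → ℝ}
    (hf : DependsOn f (box l : Set ℤ))
    (h0 : ∀ j < i, iteratedDeriv j (tilted β l f) 0 = 0) (a b : Bool) :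
    Tendsto (fun n => (specMean β 0 n (fun η => f η * blockSum n η ^ i) a b : ℂ)) atTop
      (𝓝 (iteratedDeriv i (tilted β l f) 0)) := by
  obtain ⟨D, hD, hev⟩ := eventually_norm_genFn_sub_le β l hf
  have han := (analyticAt_tilted β l f).eventually_analyticAt
  obtain ⟨r, hr, hball⟩ := Metric.eventually_nhds_iff.1 (hev.and han)
  set G := tilted β l f with hG
  have hq := decayRate_pos β
  rw [tendsto_iff_norm_sub_tendsto_zero]
  have hlim : Tendsto (fun n : ℕ => (i.factorial * D / (r / 2) ^ i * 2) * decayRate β ^ n) atTop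
      (𝓝 0) := by
    simpa using (tendsto_pow_atTop_nhds_zero_of_lt_one hq.le (decayRate_lt_one β)).const_mul
      (i.factorial * D / (r / 2) ^ i * 2)
  refine squeeze_zero' (Eventually.of_forall fun _ => norm_nonneg _) ?_ hlim
  filter_upwards [eventually_ge_atTop l, eventually_half_le_genFn_one_div β] with n hn hhalf
  have hB := bulk_pos β n
  have hBc : (bulk β n : ℂ) ≠ 0 := by exact_mod_cast hB.ne'
  set k : ℂ → ℂ := fun w => genFn β n f w a b - G w * genFn β n (fun _ => 1) w a b with hk
  have hmem : ∀ w ∈ Metric.closedBall (0 : ℂ) (r / 2), dist w 0 < r := fun w hw =>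
    lt_of_le_of_lt (Metric.mem_closedBall.1 hw) (by linarith)
  have hkan : ∀ w ∈ Metric.closedBall (0 : ℂ) (r / 2), AnalyticAt ℂ k w := fun w hw =>
    (analyticAt_genFn β n f a b w).sub ((hball (hmem w hw)).2.mul (analyticAt_genFn β n _ a b w))
  have hdiff : DiffContOnCl ℂ k (Metric.ball 0 (r / 2)) := by
    refine ⟨fun w hw => ((hkan w (Metric.ball_subset_closedBall hw)).differentiableAt).differentiableWithinAt, ?_⟩
    rw [closure_ball _ (by positivity)]
    exact fun w hw => (hkan w hw).continuousAt.continuousWithinAt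
  have hcauchy := Complex.norm_iteratedDeriv_le_of_forall_mem_sphere_norm_le i (by positivity)
    hdiff (C := D * bulk β n * decayRate β ^ n)
    (fun z hz => (hball (hmem z (Metric.sphere_subset_closedBall hz))).1 n hn a b)
  have hF := analyticAt_genFn β n f a b 0
  have hone := analyticAt_genFn β n (fun _ => 1) a b 0
  have hGan : AnalyticAt ℂ G 0 := analyticAt_tilted β l f
  have hder : iteratedDeriv i k 0 = genFn β n (fun η => f η * blockSum n η ^ i) 0 a b -
      iteratedDeriv i G 0 * genFn β n (fun _ => 1) 0 a b := by
    have h1 : iteratedDeriv i k 0 = iteratedDeriv i (fun w => genFn β n f w a b) 0 -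
        iteratedDeriv i (G * fun w => genFn β n (fun _ => 1) w a b) 0 :=
      iteratedDeriv_sub (f := fun w => genFn β n f w a b)
        (g := G * fun w => genFn β n (fun _ => 1) w a b) hF.contDiffAt
        (hGan.mul hone).contDiffAt
    rw [h1, iteratedDeriv_mul hGan.contDiffAt hone.contDiffAt, iteratedDeriv_genFn,
      Finset.sum_eq_single i]
    · simp
    · intro j hj hne
      rw [h0 j (by have := Finset.mem_range.1 hj; omega)]
      simp
    · simp
  rw [hder] at hcauchy
  obtain ⟨v, hv, hv'⟩ := genFn_one_div_bulk β n a b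
  have hvh : 1 / 2 ≤ v := by have := hhalf a b; rwa [hv', Complex.ofReal_re] at this
  have hv1 : genFn β n (fun _ => 1) 0 a b = ((v * bulk β n : ℝ) : ℂ) := by
    rw [Complex.ofReal_mul, ← hv', div_mul_cancel₀ _ hBc]
  have hvB : 0 < v * bulk β n := by positivity
  rw [ofReal_specMean, Complex.ofReal_zero, div_sub' (by rw [hv1]; exact_mod_cast hvB.ne'), norm_div,
    div_le_iff₀ (by rw [hv1, Complex.norm_real]; exact norm_pos_iff.2 hvB.ne'),
    mul_comm (genFn β n (fun _ => 1) 0 a b)]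
  refine hcauchy.trans ?_
  rw [hv1, Complex.norm_real, Real.norm_of_nonneg hvB.le]
  calc i.factorial * (D * bulk β n * decayRate β ^ n) / (r / 2) ^ i =
      (i.factorial * D / (r / 2) ^ i * 2) * decayRate β ^ n * (1 / 2 * bulk β n) := by ring
    _ ≤ _ := by gcongr

/-- The centered moments at density `1/2` are derivatives of the tilted expectation. -/
lemma centeredMoment_half (β : ℝ) (l i : ℕ) {f : Config → ℝ}
    (hf : DependsOn f (box l : Set ℤ)) (hphi : phi β f (1 / 2) = 0)
    (h0 : ∀ j < i, iteratedDeriv j (tilted β l f) 0 = 0) :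
    (centeredMoment β f i (1 / 2) : ℂ) = iteratedDeriv i (tilted β l f) 0 := by
  have hre : ∀ a b, Tendsto (fun n => specMean β 0 n (fun η => f η * blockSum n η ^ i) a b) atTop
      (𝓝 (iteratedDeriv i (tilted β l f) 0).re) := by
    intro a b
    have h := (Complex.continuous_re.tendsto _).comp (tendsto_specMean_mul_pow β l i hf h0 a b)
    simpa only [Function.comp_def, Complex.ofReal_re] using h
  have him : (iteratedDeriv i (tilted β l f) 0).im = 0 := by
    have h := (Complex.continuous_im.tendsto _).comp
      (tendsto_specMean_mul_pow β l i hf h0 true true)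
    simp only [Function.comp_def, Complex.ofReal_im] at h
    exact tendsto_nhds_unique h tendsto_const_nhds
  have h1 := tendsto_integral_bdry (ising β 0)
    (u := fun n => specMean β 0 n (fun η => f η * blockSum n η ^ i)) hre
  have h2 : centeredMoment β f i (1 / 2) = (iteratedDeriv i (tilted β l f) 0).re := by
    refine Tendsto.limUnder_eq ((tendsto_congr' ?_).1 h1)
    filter_upwards [eventually_ge_atTop l] with n hn
    have hd : DependsOn (fun η => f η * blockSum n η ^ i) (box n : Set ℤ) := by
      intro η ξ h
      simp only [DependsOn.mono_box hf hn h, dependsOn_blockSum n h]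
    rw [nu_half, hphi, ← integral_eq_specMean (ising_isIsing β 0) hd]
    simp [blockSum]
  rw [h2]
  exact Complex.ext (by simp) (by simp [him])

lemma phi_half (β : ℝ) (l : ℕ) {f : Config → ℝ} (hf : DependsOn f (box l : Set ℤ)) :
    (phi β f (1 / 2) : ℂ) = tilted β l f 0 := by
  rw [phi, nu_half]
  simpa using ofReal_integral_eq_tilted (ising_isIsing β 0) l hf

lemma phi'_half (β : ℝ) (l : ℕ) {f : Config → ℝ} (hf : DependsOn f (box l : Set ℤ))
    (hphi : phi β f (1 / 2) = 0) :
    (phi' β f (1 / 2) : ℂ) = iteratedDeriv 1 (tilted β l f) 0 / susc β := by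
  have h0 : ∀ j < 1, iteratedDeriv j (tilted β l f) 0 = 0 := by
    intro j hj
    obtain rfl : j = 0 := by omega
    rw [iteratedDeriv_zero, ← phi_half β l hf, hphi, Complex.ofReal_zero]
  rw [phi', deriv_tilt_half, Complex.ofReal_mul, centeredMoment_half β l 1 hf hphi h0]
  push_cast
  ring

/-- The term with `λ''` drops out because the first centered moment vanishes with `φ_f'`. -/
lemma phi''_half (β : ℝ) (l : ℕ) {f : Config → ℝ} (hf : DependsOn f (box l : Set ℤ))
    (hphi : phi β f (1 / 2) = 0) (hphi' : phi' β f (1 / 2) = 0) :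
    (phi'' β f (1 / 2) : ℂ) = iteratedDeriv 2 (tilted β l f) 0 / susc β ^ 2 := by
  have hτ : (susc β : ℂ) ≠ 0 := by exact_mod_cast (susc_pos β).ne'
  have hG1 : iteratedDeriv 1 (tilted β l f) 0 = 0 := by
    have := phi'_half β l hf hphi
    rw [hphi', Complex.ofReal_zero, eq_comm, div_eq_zero_iff] at this
    exact this.resolve_right hτ
  have h0 : ∀ j < 2, iteratedDeriv j (tilted β l f) 0 = 0 := by
    intro j hj
    obtain rfl | rfl : j = 0 ∨ j = 1 := by omega
    · rw [iteratedDeriv_zero, ← phi_half β l hf, hphi, Complex.ofReal_zero]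
    · exact hG1
  have hc : centeredMoment β f 1 (1 / 2) = 0 := by
    have := centeredMoment_half β l 1 hf hphi fun j hj => h0 j (by omega)
    rw [hG1] at this
    exact_mod_cast this
  rw [phi'', deriv_tilt_half, hc, mul_zero, add_zero, Complex.ofReal_mul,
    centeredMoment_half β l 2 hf hphi h0]
  push_cast
  ring

/-- The variance of the block sum is `N` times the susceptibility, up to `O(N^{1/2})`. -/
lemma eventually_abs_blockVariance_sub_le (β : ℝ) :
    ∃ C : ℝ, 0 < C ∧ ∀ᶠ n : ℕ in atTop, |blockVariance β n - susc β| ≤ C * (1 / √(vol n)) := by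
  obtain ⟨C, hC, h⟩ := eventually_norm_genFn_one_div_sub_le_inv_sqrt β
  have hτ := susc_pos β
  refine ⟨2 * (2 * C + susc β * C), by positivity, ?_⟩
  filter_upwards [h, eventually_half_le_genFn_one_div β] with n hn hhalf
  have hN := vol_pos n
  have hB := bulk_pos β n
  have hBc : (bulk β n : ℂ) ≠ 0 := by exact_mod_cast hB.ne'
  set s : ℝ := 1 / √(vol n) with hs
  have hs0 : 0 < s := by positivity
  have hNs : vol n * s ^ 2 = 1 := by
    rw [hs, div_pow, one_pow, Real.sq_sqrt hN.le, mul_one_div_cancel hN.ne']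
  have hvar : blockVariance β n = ∫ η, specMean β 0 n (fun η => blockSum n η ^ 2 / vol n)
      (η (-(n : ℤ) - 1)) (η ((n : ℤ) + 1)) ∂ising β 0 := by
    have hd : DependsOn (fun η => blockSum n η ^ 2 / vol n) (box n : Set ℤ) := by
      intro η ξ h
      simp only [dependsOn_blockSum n h]
    rw [← integral_eq_specMean (ising_isIsing β 0) hd, blockVariance]
    refine integral_congr_ae (Eventually.of_forall fun η => ?_)
    simp only [div_pow]
    rw [Real.sq_sqrt (by positivity)]
    rfl
  rw [hvar]
  refine abs_integral_bdry_sub_le _ n _ fun a b => ?_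
  -- Cauchy's estimate on the circle of radius `N^{-1/2}`
  set k : ℂ → ℂ := fun w => genFn β n (fun _ => 1) w a b / bulk β n -
    Complex.exp (vol n * (susc β / 2 * w ^ 2)) with hk
  have han : ∀ w, AnalyticAt ℂ (fun w => genFn β n (fun _ => 1) w a b / bulk β n) w := fun w =>
    (analyticAt_genFn β n _ a b w).div analyticAt_const hBc
  have han' : ∀ w, AnalyticAt ℂ (fun w : ℂ => Complex.exp (vol n * (susc β / 2 * w ^ 2))) w :=
    fun w => by fun_prop
  have hdiff : Differentiable ℂ k := fun w => ((han w).sub (han' w)).differentiableAt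
  have hcauchy := Complex.norm_iteratedDeriv_le_of_forall_mem_sphere_norm_le 2 hs0
    (c := 0) hdiff.diffContOnCl (C := C * s)
    (fun z hz => (hn a b z (by simpa using (mem_sphere_zero_iff_norm.1 hz).le)).1)
  have hder1 : iteratedDeriv 2 (fun w => genFn β n (fun _ => 1) w a b / bulk β n) 0 =
      genFn β n (fun η => blockSum n η ^ 2) 0 a b / bulk β n := by
    have := congrFun (iteratedDeriv_genFn β n (fun _ => 1) a b 2) 0
    simp only [one_mul] at this
    rw [← this]
    exact iteratedDeriv_div_const _ _
  have hder2 : iteratedDeriv 2 (fun w : ℂ => Complex.exp (vol n * (susc β / 2 * w ^ 2))) 0 =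
      vol n * susc β := by
    have d1 : ∀ w : ℂ, HasDerivAt (fun w : ℂ => Complex.exp (vol n * (susc β / 2 * w ^ 2)))
        (Complex.exp (vol n * (susc β / 2 * w ^ 2)) * (vol n * susc β * w)) w := by
      intro w
      refine ((((hasDerivAt_pow 2 w).const_mul (susc β / 2 : ℂ)).const_mul
        (vol n : ℂ)).cexp).congr_deriv ?_
      push_cast
      ring
    have d2 := (d1 0).mul ((hasDerivAt_id (0 : ℂ)).const_mul (vol n * susc β : ℂ))
    rw [iteratedDeriv_succ, iteratedDeriv_one, funext fun w => (d1 w).deriv]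
    refine d2.deriv.trans ?_
    simp
  have hder : iteratedDeriv 2 k 0 = genFn β n (fun η => blockSum n η ^ 2) 0 a b / bulk β n -
      vol n * susc β := by
    rw [← hder1, ← hder2]
    exact iteratedDeriv_fun_sub (han 0).contDiffAt (han' 0).contDiffAt
  rw [hder] at hcauchy
  obtain ⟨v, hv, hv'⟩ := genFn_one_div_bulk β n a b
  have hvh : 1 / 2 ≤ v := by have := hhalf a b; rwa [hv', Complex.ofReal_re] at this
  have hv1 : |v - 1| ≤ C * s := by
    have := (hn a b 0 (by simpa using hs0.le)).1
    rw [hv'] at this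
    simpa [← Complex.ofReal_one, ← Complex.ofReal_sub, Complex.norm_real] using this
  set m : ℝ := specMean β 0 n (fun η => blockSum n η ^ 2 / vol n) a b with hm
  have hmv : genFn β n (fun η => blockSum n η ^ 2) 0 a b / bulk β n = ((m * v * vol n : ℝ) : ℂ) := by
    have hNc : (vol n : ℂ) ≠ 0 := by exact_mod_cast hN.ne'
    have hg : genFn β n (fun η => blockSum n η ^ 2 / vol n) 0 a b * vol n =
        genFn β n (fun η => blockSum n η ^ 2) 0 a b := by
      unfold genFn
      rw [Finset.sum_mul]
      refine Finset.sum_congr rfl fun A _ => ?_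
      push_cast
      field_simp
    obtain ⟨u, hu, hu'⟩ := genFn_one_ofReal_pos β 0 n a b
    have huc : (u : ℂ) ≠ 0 := by exact_mod_cast hu.ne'
    rw [Complex.ofReal_zero] at hu'
    rw [Complex.ofReal_mul, Complex.ofReal_mul, ← hv', hm, ofReal_specMean, Complex.ofReal_zero,
      ← hg, hu']
    field_simp
  rw [hmv, ← Complex.ofReal_mul, ← Complex.ofReal_sub, Complex.norm_real, Real.norm_eq_abs,
    show m * v * vol n - vol n * susc β = vol n * (m * v - susc β) by ring, abs_mul,
    abs_of_pos hN] at hcauchy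
  have h1 : |m * v - susc β| ≤ 2 * C * s := by
    have h2 : ((2 : ℕ).factorial : ℝ) * (C * s) / s ^ 2 = vol n * (2 * C * s) := by
      rw [div_eq_iff (by positivity)]
      push_cast [Nat.factorial]
      linear_combination (-(2 * C * s)) * hNs
    rw [h2] at hcauchy
    exact le_of_mul_le_mul_left hcauchy hN
  have h2 : |(m - susc β) * v| ≤ (2 * C + susc β * C) * s := by
    rw [show (m - susc β) * v = (m * v - susc β) - susc β * (v - 1) by ring]
    refine (abs_sub _ _).trans ?_
    rw [abs_mul, abs_of_pos hτ]
    nlinarith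
  rw [abs_mul, abs_of_pos hv] at h2
  have := abs_nonneg (m - susc β)
  nlinarith

/-- The block sum has exponential tails on the scale `N^{1/2}`. -/
lemma eventually_measureReal_blockSum_ge_le (β : ℝ) :
    ∃ C : ℝ, 0 < C ∧ ∀ᶠ n : ℕ in atTop, ∀ R : ℝ,
      (ising β 0).real {η | R ≤ |blockSum n η|} ≤ C * Real.exp (-(R / √(vol n))) := by
  obtain ⟨C, hC, h⟩ := eventually_norm_genFn_one_div_sub_le_inv_sqrt β
  refine ⟨2 * (2 * (C + Real.exp (susc β / 2))), by positivity, ?_⟩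
  filter_upwards [h, eventually_half_le_genFn_one_div β] with n hn hhalf R
  have hN := vol_pos n
  have hB := bulk_pos β n
  have hBc : (bulk β n : ℂ) ≠ 0 := by exact_mod_cast hB.ne'
  set s : ℝ := 1 / √(vol n) with hs
  have hs0 : 0 < s := by positivity
  have hs1 : s ≤ 1 := by
    rw [hs, div_le_one (Real.sqrt_pos.2 hN)]
    exact Real.one_le_sqrt.2 (one_le_vol n)
  have hd : ∀ t : ℝ, DependsOn (fun η => Real.exp (t * blockSum n η)) (box n : Set ℤ) := by
    intro t η ξ h
    simp only [dependsOn_blockSum n h]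
  have hexp : ∀ t : ℝ, |t| ≤ s →
      ∫ η, Real.exp (t * blockSum n η) ∂ising β 0 ≤ 2 * (C + Real.exp (susc β / 2)) := by
    intro t ht
    rw [integral_eq_specMean (ising_isIsing β 0) (hd t)]
    have hle : ∀ a b, specMean β 0 n (fun η => Real.exp (t * blockSum n η)) a b ≤
        2 * (C + Real.exp (susc β / 2)) := by
      intro a b
      obtain ⟨v, hv, hv'⟩ := genFn_one_div_bulk β n a b
      have hvh : 1 / 2 ≤ v := by have := hhalf a b; rwa [hv', Complex.ofReal_re] at this
      have hg : genFn β n (fun η => Real.exp (t * blockSum n η)) 0 a b =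
          genFn β n (fun _ => 1) t a b := by
        unfold genFn
        refine Finset.sum_congr rfl fun A _ => ?_
        push_cast
        rw [zero_mul, Complex.exp_zero]
        ring
      have he : (specMean β 0 n (fun η => Real.exp (t * blockSum n η)) a b : ℂ) * v =
          genFn β n (fun _ => 1) t a b / bulk β n := by
        rw [ofReal_specMean, Complex.ofReal_zero, hg, ← hv', div_mul_div_cancel₀]
        intro h0
        rw [h0, zero_div] at hv'
        exact hv.ne (by exact_mod_cast hv')
      obtain ⟨h1, h2⟩ := hn a b t (by rw [Complex.norm_real]; exact ht)
      rw [← he] at h1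
      have h3 : ‖(specMean β 0 n (fun η => Real.exp (t * blockSum n η)) a b : ℂ) * v‖ ≤
          C + Real.exp (susc β / 2) := by
        have := norm_le_norm_add_norm_sub'
          ((specMean β 0 n (fun η => Real.exp (t * blockSum n η)) a b : ℂ) * v)
          (Complex.exp (vol n * (susc β / 2 * (t : ℂ) ^ 2)))
        nlinarith
      rw [← Complex.ofReal_mul, Complex.norm_real] at h3
      have h4 := (Real.le_norm_self _).trans h3
      have h5 : 0 < C + Real.exp (susc β / 2) := by positivity
      by_contra hcon
      push Not at hcon
      nlinarith
    refine (integral_mono (integrable_bdry_fun n _ _) (integrable_const _)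
      fun η => hle _ _).trans (by simp)
  have hset : (ising β 0).real {η | R ≤ |blockSum n η|} * Real.exp (s * R) ≤
      ∫ η, (Real.exp (s * blockSum n η) + Real.exp (-s * blockSum n η)) ∂ising β 0 := by
    have hm := mul_meas_ge_le_integral_of_nonneg (μ := ising β 0)
      (f := fun η => Real.exp (s * blockSum n η) + Real.exp (-s * blockSum n η))
      (Eventually.of_forall fun η => by positivity)
      ((integrable_of_dependsOn (hd s) _).add (integrable_of_dependsOn (hd (-s)) _))
      (Real.exp (s * R))
    rw [mul_comm]
    refine le_trans (mul_le_mul_of_nonneg_left (measureReal_mono ?_) (Real.exp_pos _).le) hm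
    intro η (hη : R ≤ |blockSum n η|)
    change Real.exp (s * R) ≤ _
    have h1 : Real.exp (s * R) ≤ Real.exp (s * |blockSum n η|) := by gcongr
    have := Real.exp_pos (s * blockSum n η)
    have := Real.exp_pos (-s * blockSum n η)
    rcases abs_cases (blockSum n η) with ⟨h, -⟩ | ⟨h, -⟩ <;> rw [h] at h1
    · linarith
    · rw [show s * -blockSum n η = -s * blockSum n η by ring] at h1; linarith
  rw [integral_add (integrable_of_dependsOn (hd s) _) (integrable_of_dependsOn (hd (-s)) _)] at hset
  have h1 := hexp s (abs_of_pos hs0).le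
  have h2 := hexp (-s) (by rw [abs_neg]; exact (abs_of_pos hs0).le)
  have h3 : R / √(vol n) = s * R := by rw [hs]; ring
  rw [h3, Real.exp_neg, ← div_eq_mul_inv, le_div_iff₀ (Real.exp_pos _)]
  linarith

end SpeedChange

namespace SpeedChange

/-! ### Conditional expectations given the block density -/

lemma blockDensity_sub_half (n : ℕ) (η : Config) :
    blockDensity n η - 1 / 2 = blockSum n η / vol n := by
  have h : blockSum n η = ∑ x ∈ box n, occ η x - vol n * (1 / 2) := by
    rw [blockSum, Finset.sum_sub_distrib, Finset.sum_const, nsmul_eq_mul, card_box]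
  have hv : (2 * (n : ℝ) + 1) = vol n := rfl
  rw [h, blockDensity, hv, sub_div, mul_div_cancel_left₀ _ (vol_pos n).ne']

lemma specMean_eq_levelSum (β : ℝ) (n : ℕ) (f : Config → ℝ) (a b : Bool) (S : ℝ) :
    specMean β 0 n (fun η => f η * if blockSum n η = S then 1 else 0) a b =
      levelSum β n f a b S / partitionFn β 0 n (bdry a b) := by
  unfold specMean levelSum localSpec boltzmann
  rw [Finset.sum_filter, Finset.sum_div]
  refine Finset.sum_congr rfl fun A _ => ?_
  by_cases h : blockSum n (indicatorConfig A) = S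
  · simp only [h, if_true, zero_mul, Real.exp_zero]
    ring
  · simp only [h, if_false, mul_zero, zero_mul, zero_div]

lemma levelSum_one_pos (β : ℝ) {n : ℕ} {A : Finset ℤ} (hA : A ⊆ box n) (a b : Bool) :
    0 < levelSum β n (fun _ => 1) a b (blockSum n (indicatorConfig A)) := by
  unfold levelSum
  exact Finset.sum_pos (fun _ _ => by positivity) ⟨A, by simp [hA]⟩

lemma blockSum_occupied (n : ℕ) (η : Config) :
    blockSum n (indicatorConfig (occupied n η)) = blockSum n η :=
  blockSum_congr fun _ hx => indicatorConfig_occupied η hx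

lemma abs_levelMean_le (β : ℝ) (n : ℕ) {f : Config → ℝ} {M : ℝ} (hM : ∀ η, |f η| ≤ M)
    (a b : Bool) (S : ℝ) : |levelMean β n f a b S| ≤ M := by
  have hM0 : 0 ≤ M := (abs_nonneg _).trans (hM fun _ => true)
  have h1 : |levelSum β n f a b S| ≤ M * levelSum β n (fun _ => 1) a b S := by
    unfold levelSum
    rw [Finset.mul_sum]
    refine (Finset.abs_sum_le_sum_abs _ _).trans (Finset.sum_le_sum fun A _ => ?_)
    rw [abs_mul, abs_of_pos (Real.exp_pos _), one_mul]
    gcongr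
    exact hM _
  have h0 : 0 ≤ levelSum β n (fun _ => 1) a b S := Finset.sum_nonneg fun _ _ => by positivity
  rw [levelMean, abs_div, abs_of_nonneg h0]
  exact div_le_of_le_mul₀ h0 hM0 h1

lemma measurable_levelMean (β : ℝ) (n : ℕ) (f : Config → ℝ) (a b : Bool) :
    Measurable (levelMean β n f a b) := by
  have h : ∀ f, Measurable (levelSum β n f a b) := by
    intro f
    unfold levelSum
    simp only [Finset.sum_filter]
    refine Finset.measurable_fun_sum _ fun A _ => ?_
    exact Measurable.ite (measurableSet_eq_fun measurable_const measurable_id) measurable_const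
      measurable_const
  exact (h f).div (h _)

/-- The finite-volume expectation conditions on the total spin. -/
lemma specMean_levelMean (β : ℝ) (n : ℕ) (f : Config → ℝ) (u : ℝ → ℝ) (a b : Bool) :
    specMean β 0 n (fun η => levelMean β n f a b (blockSum n η) * u (blockSum n η)) a b =
      specMean β 0 n (fun η => f η * u (blockSum n η)) a b := by
  classical
  unfold specMean
  rw [← Finset.sum_fiberwise_of_maps_to (s := (box n).powerset)
      (t := (box n).powerset.image fun A => blockSum n (indicatorConfig A))
      (g := fun A => blockSum n (indicatorConfig A)) (fun A hA => Finset.mem_image_of_mem _ hA),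
    ← Finset.sum_fiberwise_of_maps_to (s := (box n).powerset)
      (t := (box n).powerset.image fun A => blockSum n (indicatorConfig A))
      (g := fun A => blockSum n (indicatorConfig A)) (fun A hA => Finset.mem_image_of_mem _ hA)]
  refine Finset.sum_congr rfl fun S hS => ?_
  obtain ⟨A₀, hA₀, rfl⟩ := Finset.mem_image.1 hS
  have hpos := levelSum_one_pos β (Finset.mem_powerset.1 hA₀) a b
  set S := blockSum n (indicatorConfig A₀)
  have e1 : ∀ h : Config → ℝ, (∑ A ∈ (box n).powerset with blockSum n (indicatorConfig A) = S,
      h (indicatorConfig A) * u (blockSum n (indicatorConfig A)) *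
        localSpec β 0 n (indicatorConfig A) (bdry a b)) =
      levelSum β n h a b S * (u S / partitionFn β 0 n (bdry a b)) := by
    intro h
    unfold levelSum localSpec boltzmann
    rw [Finset.sum_mul]
    refine Finset.sum_congr rfl fun A hA => ?_
    rw [(Finset.mem_filter.1 hA).2, zero_mul, Real.exp_zero]
    ring
  rw [e1 f, e1 fun η => levelMean β n f a b (blockSum n η)]
  congr 1
  have e2 : levelSum β n (fun η => levelMean β n f a b (blockSum n η)) a b S =
      levelMean β n f a b S * levelSum β n (fun _ => 1) a b S := by
    unfold levelSum
    rw [Finset.mul_sum]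
    refine Finset.sum_congr rfl fun A hA => ?_
    simp only [(Finset.mem_filter.1 hA).2, one_mul]
  rw [e2, levelMean, div_mul_cancel₀ _ hpos.ne']

/-- Both boundary values occur with positive probability. -/
lemma measureReal_bdry_pos {β lam : ℝ} {ν : Measure Config} (hν : IsIsing β lam ν) (n : ℕ)
    (a b : Bool) : 0 < ν.real {η | η (-(n : ℤ) - 1) = a ∧ η ((n : ℤ) + 1) = b} := by
  have := hν.1
  have h := cyl_pos hν (n + 1) (occupied_subset (n + 1) (bdry a b))
  have hl : -(n : ℤ) - 1 ∈ box (n + 1) := by rw [mem_box]; push_cast; omega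
  have hr : (n : ℤ) + 1 ∈ box (n + 1) := by rw [mem_box]; push_cast; omega
  unfold cyl at h
  rw [integral_indicator_const _ (measurableSet_cyl _ _), smul_eq_mul, mul_one] at h
  refine h.trans_le (measureReal_mono fun η hη => ?_)
  have hη' : ∀ x ∈ box (n + 1), η x = bdry a b x := fun x hx =>
    (hη x hx).trans (indicatorConfig_occupied _ hx)
  exact ⟨(hη' _ hl).trans (bdry_left a b n), (hη' _ hr).trans (bdry_right a b n)⟩

/-- The elementary conditional expectation given the block density and the boundary values. -/
lemma blockCondExp_eq_levelMean (β : ℝ) {n : ℕ} {f : Config → ℝ}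
    (hf : DependsOn f (box n : Set ℤ)) (a b : Bool) (η₀ : Config) :
    blockCondExp β f n a b (blockDensity n η₀ - 1 / 2) =
      levelMean β n f a b (blockSum n η₀) := by
  have hν := ising_isIsing β 0
  set S := blockSum n η₀ with hS
  set U : Set Config := {η | η (-(n : ℤ) - 1) = a ∧ η ((n : ℤ) + 1) = b} with hU
  have hUm := measurableSet_bdry n a b
  have hUm' : MeasurableSet U := outsideAlg_le n _ hUm
  have hSm : MeasurableSet {η | blockSum n η = S} :=
    (DependsOn.measurable_of_box (dependsOn_blockSum n)) (measurableSet_singleton S)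
  have hE : {η : Config | blockDensity n η - 1 / 2 = blockDensity n η₀ - 1 / 2 ∧
      η (-(n : ℤ) - 1) = a ∧ η ((n : ℤ) + 1) = b} = U ∩ {η | blockSum n η = S} := by
    ext η
    refine Iff.trans and_comm (and_congr Iff.rfl ?_)
    change _ - _ = _ - _ ↔ blockSum n η = S
    rw [blockDensity_sub_half, blockDensity_sub_half, div_left_inj' (vol_pos n).ne']
  have hint : ∀ h : Config → ℝ, DependsOn h (box n : Set ℤ) →
      ∫ η in U ∩ {η | blockSum n η = S}, h η ∂ising β 0 =
        (ising β 0).real U * (levelSum β n h a b S / partitionFn β 0 n (bdry a b)) := by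
    intro h hh
    have hd : DependsOn (fun η => h η * if blockSum n η = S then 1 else 0) (box n : Set ℤ) := by
      intro η ξ hηξ
      simp only [hh hηξ, dependsOn_blockSum n hηξ]
    have e1 := setIntegral_eq_specMean hν hd hUm
    have e2 : ∫ η in U, specMean β 0 n (fun η => h η * if blockSum n η = S then 1 else 0)
        (η (-(n : ℤ) - 1)) (η ((n : ℤ) + 1)) ∂ising β 0 = ∫ η in U,
          levelSum β n h a b S / partitionFn β 0 n (bdry a b) ∂ising β 0 := by
      refine setIntegral_congr_fun hUm' fun η hη => ?_
      have hη' : η (-(n : ℤ) - 1) = a ∧ η ((n : ℤ) + 1) = b := hη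
      rw [hη'.1, hη'.2, specMean_eq_levelSum]
    rw [e2, setIntegral_const, smul_eq_mul] at e1
    rw [← e1, ← setIntegral_indicator hSm]
    refine setIntegral_congr_fun hUm' fun η _ => ?_
    by_cases hη : blockSum n η = S
    · rw [Set.indicator_of_mem (show η ∈ {η | blockSum n η = S} from hη)]
      simp [hη]
    · rw [Set.indicator_of_notMem (show η ∉ {η | blockSum n η = S} from hη)]
      simp [hη]
  have hpos := levelSum_one_pos β (occupied_subset n η₀) a b
  rw [blockSum_occupied] at hpos
  have hZ := partitionFn_pos β 0 n (bdry a b)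
  have hUpos : 0 < (ising β 0).real U := measureReal_bdry_pos hν n a b
  have hmE : (ising β 0).real (U ∩ {η | blockSum n η = S}) =
      (ising β 0).real U * (levelSum β n (fun _ => 1) a b S / partitionFn β 0 n (bdry a b)) := by
    rw [← hint (fun _ => 1) (fun _ _ _ => rfl)]
    simp
  rw [blockCondExp, hE, ProbabilityTheory.cond, integral_smul_measure, hint f hf,
    ENNReal.toReal_inv, smul_eq_mul]
  change ((ising β 0).real (U ∩ {η | blockSum n η = S}))⁻¹ * _ = _
  rw [hmE, levelMean]
  field_simp

lemma blockAlg_le (n : ℕ) : blockAlg n ≤ (inferInstance : MeasurableSpace Config) := by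
  refine sup_le (Measurable.comap_le ?_) (outsideAlg_le n)
  unfold blockDensity
  exact (Finset.measurable_fun_sum _ fun x _ => (continuous_occ x).measurable).div_const _

lemma measurable_levelMean_bdry (β : ℝ) (n : ℕ) (f : Config → ℝ) :
    Measurable[blockAlg n] fun η : Config =>
      levelMean β n f (η (-(n : ℤ) - 1)) (η ((n : ℤ) + 1)) (blockSum n η) := by
  have hS : Measurable[blockAlg n] (blockSum n) := by
    have h1 : Measurable[blockAlg n] (blockDensity n) :=
      (comap_measurable (blockDensity n)).mono le_sup_left le_rfl
    have h2 : blockSum n = fun η => vol n * (blockDensity n η - 1 / 2) := by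
      ext η
      rw [blockDensity_sub_half, mul_div_cancel₀ _ (vol_pos n).ne']
    rw [h2]
    exact (h1.sub_const _).const_mul _
  have he : (fun η : Config =>
      levelMean β n f (η (-(n : ℤ) - 1)) (η ((n : ℤ) + 1)) (blockSum n η)) = fun η : Config =>
      ∑ a : Bool, ∑ b : Bool, (if η (-(n : ℤ) - 1) = a ∧ η ((n : ℤ) + 1) = b then 1 else 0) *
        levelMean β n f a b (blockSum n η) := by
    ext η
    rw [Fintype.sum_bool, Fintype.sum_bool, Fintype.sum_bool]
    generalize η (-(n : ℤ) - 1) = a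
    generalize η ((n : ℤ) + 1) = b
    cases a <;> cases b <;> simp
  rw [he]
  refine Finset.measurable_fun_sum _ fun a _ => Finset.measurable_fun_sum _ fun b _ => ?_
  refine Measurable.mul ?_ ((measurable_levelMean β n f a b).comp hS)
  exact (measurable_bdry_fun n fun a' b' => if a' = a ∧ b' = b then 1 else 0).mono
    le_sup_right le_rfl

lemma sup_eq_generateFrom_inter {α : Type*} (m₁ m₂ : MeasurableSpace α) :
    m₁ ⊔ m₂ = MeasurableSpace.generateFrom
      {s | ∃ t u, MeasurableSet[m₁] t ∧ MeasurableSet[m₂] u ∧ s = t ∩ u} := by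
  refine le_antisymm (sup_le ?_ ?_) (MeasurableSpace.generateFrom_le ?_)
  · intro t ht
    exact MeasurableSpace.measurableSet_generateFrom
      ⟨t, Set.univ, ht, MeasurableSet.univ, (Set.inter_univ t).symm⟩
  · intro u hu
    exact MeasurableSpace.measurableSet_generateFrom
      ⟨Set.univ, u, MeasurableSet.univ, hu, (Set.univ_inter u).symm⟩
  · rintro _ ⟨t, u, ht, hu, rfl⟩
    have h1 : MeasurableSet[m₁ ⊔ m₂] t := (le_sup_left : m₁ ≤ m₁ ⊔ m₂) t ht
    have h2 : MeasurableSet[m₁ ⊔ m₂] u := (le_sup_right : m₂ ≤ m₁ ⊔ m₂) u hu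
    exact MeasurableSet.inter h1 h2

lemma isPiSystem_inter {α : Type*} (m₁ m₂ : MeasurableSpace α) :
    IsPiSystem {s | ∃ t u, MeasurableSet[m₁] t ∧ MeasurableSet[m₂] u ∧ s = t ∩ u} := by
  rintro _ ⟨t, u, ht, hu, rfl⟩ _ ⟨t', u', ht', hu', rfl⟩ _
  exact ⟨t ∩ t', u ∩ u', MeasurableSet.inter ht ht', MeasurableSet.inter hu hu',
    Set.inter_inter_inter_comm t u t' u'⟩

/-- The conditional expectation given the block density and the outside of the block. -/
lemma condExp_blockAlg_ae_eq (β : ℝ) {n : ℕ} {f : Config → ℝ}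
    (hf : DependsOn f (box n : Set ℤ)) {M : ℝ} (hM : ∀ η, |f η| ≤ M) :
    (ising β 0)[f | blockAlg n] =ᵐ[ising β 0] fun η =>
      levelMean β n f (η (-(n : ℤ) - 1)) (η ((n : ℤ) + 1)) (blockSum n η) := by
  have hν := ising_isIsing β 0
  set g : Config → ℝ := fun η =>
    levelMean β n f (η (-(n : ℤ) - 1)) (η ((n : ℤ) + 1)) (blockSum n η) with hg
  have hgm := measurable_levelMean_bdry β n f
  have hgint : Integrable g (ising β 0) :=
    Integrable.of_bound (hgm.mono (blockAlg_le n) le_rfl).aestronglyMeasurable M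
      (Eventually.of_forall fun η => abs_levelMean_le β n hM _ _ _)
  have hfint := integrable_of_dependsOn hf (ising β 0)
  refine (ae_eq_condExp_of_forall_setIntegral_eq (blockAlg_le n) hfint
    (fun _ _ _ => hgint.integrableOn) ?_ hgm.stronglyMeasurable.aestronglyMeasurable).symm
  -- the rectangles: an event of the block density and an outside event
  have key : ∀ V : Set ℝ, MeasurableSet V → ∀ B, MeasurableSet[outsideAlg n] B →
      ∫ η in blockDensity n ⁻¹' V ∩ B, g η ∂ising β 0 =
        ∫ η in blockDensity n ⁻¹' V ∩ B, f η ∂ising β 0 := by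
    classical
    intro V hV B hB
    have hBm := outsideAlg_le n _ hB
    have hVm : MeasurableSet (blockDensity n ⁻¹' V) :=
      blockAlg_le n _ ((le_sup_left : _ ≤ blockAlg n) _ ⟨V, hV, rfl⟩)
    set u : ℝ → ℝ := fun S => if S / vol n + 1 / 2 ∈ V then 1 else 0 with hu
    have hind : ∀ h : Config → ℝ, ∫ η in blockDensity n ⁻¹' V ∩ B, h η ∂ising β 0 =
        ∫ η in B, h η * u (blockSum n η) ∂ising β 0 := by
      intro h
      rw [Set.inter_comm, ← setIntegral_indicator hVm]
      refine setIntegral_congr_fun hBm fun η _ => ?_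
      have e : blockSum n η / vol n + 1 / 2 = blockDensity n η := by
        rw [← blockDensity_sub_half]; ring
      simp only [hu, e, Set.indicator_apply, Set.mem_preimage]
      split_ifs <;> simp
    have hd : ∀ h : Config → ℝ, DependsOn h (box n : Set ℤ) →
        DependsOn (fun η => h η * u (blockSum n η)) (box n : Set ℤ) := by
      intro h hh η ξ hηξ
      simp only [hh hηξ, dependsOn_blockSum n hηξ]
    rw [hind g, hind f, setIntegral_eq_specMean hν (hd f hf) hB,
      setIntegral_eq_specMean_bdry hν (H := fun a b η => levelMean β n f a b (blockSum n η) *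
        u (blockSum n η)) (fun a b => hd _ fun η ξ h => by rw [dependsOn_blockSum n h]) hB]
    simp only [specMean_levelMean]
  intro s hs _
  refine MeasurableSpace.induction_on_inter (m := blockAlg n)
    (C := fun s _ => ∫ x in s, g x ∂ising β 0 = ∫ x in s, f x ∂ising β 0)
    (sup_eq_generateFrom_inter _ _) (isPiSystem_inter _ _) ?_ ?_ ?_ ?_ s hs
  · simp
  · rintro _ ⟨t, B, ⟨V, hV, rfl⟩, hB, rfl⟩
    exact key V hV B hB
  · intro t ht h
    have hu := key Set.univ MeasurableSet.univ Set.univ MeasurableSet.univ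
    simp only [Set.preimage_univ, Set.univ_inter, setIntegral_univ] at hu
    rw [setIntegral_compl (blockAlg_le n _ ht) hgint, setIntegral_compl (blockAlg_le n _ ht) hfint,
      h, hu]
  · intro t hd hm h
    have hm' := fun i => blockAlg_le n _ (hm i)
    rw [integral_iUnion hm' hd hgint.integrableOn, integral_iUnion hm' hd hfint.integrableOn]
    simp only [h]

/-- On local functions the supremum norm is controlled by every `L^p` norm. -/
lemma exists_abs_le_mul_eLpNorm (β : ℝ) (l : ℕ) :
    ∃ K : ℝ, 0 < K ∧ ∀ f : Config → ℝ, DependsOn f (box l : Set ℤ) → ∀ p : ℝ≥0∞, 1 ≤ p →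
      eLpNorm f p (ising β 0) ≠ ∞ ∧ ∀ η, |f η| ≤ K * (eLpNorm f p (ising β 0)).toReal := by
  have hν := ising_isIsing β 0
  have hpos : ∀ A ∈ (box l).powerset, 0 < ∫ η, cyl l A η ∂ising β 0 := fun A hA =>
    cyl_pos hν l (Finset.mem_powerset.1 hA)
  refine ⟨∑ A ∈ (box l).powerset, (∫ η, cyl l A η ∂ising β 0)⁻¹,
    Finset.sum_pos (fun A hA => inv_pos.2 (hpos A hA)) ⟨∅, by simp⟩, fun f hf p hp => ?_⟩
  have hfm : AEStronglyMeasurable f (ising β 0) :=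
    (DependsOn.measurable_of_box hf).aestronglyMeasurable
  have hbound : ∀ η, |f η| ≤ ∑ A ∈ (box l).powerset, |f (indicatorConfig A)| := by
    intro η
    rw [hf (y := indicatorConfig (occupied l η)) fun x hx => (indicatorConfig_occupied η hx).symm]
    exact Finset.single_le_sum (f := fun A => |f (indicatorConfig A)|) (fun _ _ => abs_nonneg _)
      (Finset.mem_powerset.2 (occupied_subset l η))
  have hfin : eLpNorm f p (ising β 0) ≠ ∞ :=
    (MemLp.of_bound hfm _ (Eventually.of_forall hbound)).2.ne
  refine ⟨hfin, fun η => ?_⟩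
  set A := occupied l η with hA
  have hAs := occupied_subset l η
  have hfη : f η = f (indicatorConfig A) := hf fun x hx => (indicatorConfig_occupied η hx).symm
  have hle : |f η| * ∫ η, cyl l A η ∂ising β 0 ≤ (eLpNorm f p (ising β 0)).toReal := by
    have h1 : ∫ η, |f η| ∂ising β 0 = (eLpNorm f 1 (ising β 0)).toReal := by
      rw [eLpNorm_one_eq_lintegral_enorm, ← integral_norm_eq_lintegral_enorm hfm]
      rfl
    have h2 : (eLpNorm f 1 (ising β 0)).toReal ≤ (eLpNorm f p (ising β 0)).toReal :=
      ENNReal.toReal_mono hfin (eLpNorm_le_eLpNorm_of_exponent_le hp hfm)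
    refine le_trans ?_ (h1.le.trans h2)
    rw [← integral_const_mul]
    refine integral_mono ((integrable_of_dependsOn (dependsOn_cyl l A) _).const_mul _)
      (integrable_of_dependsOn hf _).abs fun ξ => ?_
    change |f η| * cyl l A ξ ≤ |f ξ|
    rw [cyl_apply (hA ▸ hAs)]
    split_ifs with h
    · rw [mul_one, hfη, h]
      exact (congrArg abs (hf fun x hx => indicatorConfig_occupied ξ hx)).le
    · simp
  have hpA := hpos A (Finset.mem_powerset.2 hAs)
  calc |f η| = (∫ η, cyl l A η ∂ising β 0)⁻¹ * (|f η| * ∫ η, cyl l A η ∂ising β 0) := by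
        field_simp
    _ ≤ (∑ A ∈ (box l).powerset, (∫ η, cyl l A η ∂ising β 0)⁻¹) *
        (eLpNorm f p (ising β 0)).toReal := by
        refine mul_le_mul ?_ hle (by positivity)
          (Finset.sum_nonneg fun A hA => (inv_pos.2 (hpos A hA)).le)
        exact Finset.single_le_sum (f := fun A => (∫ η, cyl l A η ∂ising β 0)⁻¹)
          (fun A hA => (inv_pos.2 (hpos A hA)).le) (Finset.mem_powerset.2 hAs)

end SpeedChange

namespace SpeedChange

/-! ### Uniformity in the local function -/

lemma genFn_eq_sum (β : ℝ) (l n : ℕ) {f : Config → ℝ} (hf : DependsOn f (box l : Set ℤ)) (w : ℂ)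
    (a b : Bool) : genFn β n f w a b =
      ∑ A ∈ (box l).powerset, (f (indicatorConfig A) : ℂ) * genFn β n (cyl l A) w a b := by
  unfold genFn
  simp only [Finset.mul_sum]
  rw [Finset.sum_comm]
  refine Finset.sum_congr rfl fun B _ => ?_
  rw [eq_sum_cyl hf (indicatorConfig B), Finset.sum_mul, Complex.ofReal_sum, Finset.sum_mul]
  refine Finset.sum_congr rfl fun A _ => ?_
  push_cast
  ring

lemma tilted_eq_sum (β : ℝ) (l : ℕ) {f : Config → ℝ} (hf : DependsOn f (box l : Set ℤ)) (w : ℂ) :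
    tilted β l f w =
      ∑ A ∈ (box l).powerset, (f (indicatorConfig A) : ℂ) * tilted β l (cyl l A) w := by
  unfold tilted
  simp only [← mul_div_assoc]
  rw [← Finset.sum_div]
  congr 1
  simp only [leftForm, Fintype.sum_bool, genFn_eq_sum β l l hf, Finset.mul_sum, Finset.sum_mul,
    mul_add, ← Finset.sum_add_distrib]
  refine Finset.sum_congr rfl fun A _ => ?_
  ring

lemma iteratedDeriv_tilted_eq_sum (β : ℝ) (l i : ℕ) {f : Config → ℝ}
    (hf : DependsOn f (box l : Set ℤ)) :
    iteratedDeriv i (tilted β l f) 0 = ∑ A ∈ (box l).powerset,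
      (f (indicatorConfig A) : ℂ) * iteratedDeriv i (tilted β l (cyl l A)) 0 := by
  rw [funext (tilted_eq_sum β l hf), iteratedDeriv_fun_sum
    (f := fun A w => (f (indicatorConfig A) : ℂ) * tilted β l (cyl l A) w) fun A _ =>
    (analyticAt_const.mul (analyticAt_tilted β l (cyl l A))).contDiffAt]
  refine Finset.sum_congr rfl fun A _ => ?_
  exact iteratedDeriv_const_mul_field _ _

lemma levelMean_eq_sum (β : ℝ) (l n : ℕ) {f : Config → ℝ} (hf : DependsOn f (box l : Set ℤ))
    (a b : Bool) (S : ℝ) : levelMean β n f a b S =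
      ∑ A ∈ (box l).powerset, f (indicatorConfig A) * levelMean β n (cyl l A) a b S := by
  unfold levelMean
  simp only [← mul_div_assoc]
  rw [← Finset.sum_div]
  congr 1
  unfold levelSum
  simp only [Finset.mul_sum]
  rw [Finset.sum_comm]
  refine Finset.sum_congr rfl fun B _ => ?_
  rw [eq_sum_cyl hf (indicatorConfig B), Finset.sum_mul]
  refine Finset.sum_congr rfl fun A _ => ?_
  ring

/-- The expansion of `levelMean`, with an error that is uniform in the local function. -/
lemma exists_levelMean_sub_le_mul (β : ℝ) (l : ℕ) :
    ∃ K ε₀ : ℝ, 0 < K ∧ 0 < ε₀ ∧ ∀ f : Config → ℝ, DependsOn f (box l : Set ℤ) →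
      ∀ M, (∀ η, |f η| ≤ M) →
      (∀ i ∈ ({1, 2} : Finset ℕ), ‖iteratedDeriv i (tilted β l f) 0‖ ≤ K * M) ∧
      ∀ n, l ≤ n → ∀ a b, ∀ A ⊆ box n, ∀ S ε,
      S = blockSum n (indicatorConfig A) → IsScale β n S ε → ε ≤ ε₀ →
      ‖(levelMean β n f a b S : ℂ) - (tilted β l f 0 +
        iteratedDeriv 1 (tilted β l f) 0 * profileMoment β n a b S 1 +
        iteratedDeriv 2 (tilted β l f) 0 / 2 * profileMoment β n a b S 2)‖ ≤ K * M * ε ^ 3 := by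
  choose K ε₀ hK hε₀ h using fun A => exists_levelMean_sub_le β l (dependsOn_cyl l A)
  have hne : (box l).powerset.Nonempty := ⟨∅, by simp⟩
  set G : ℕ → Finset ℤ → ℂ := fun i A => iteratedDeriv i (tilted β l (cyl l A)) 0 with hG
  refine ⟨∑ A ∈ (box l).powerset, (K A + ‖G 1 A‖ + ‖G 2 A‖), (box l).powerset.inf' hne ε₀,
    Finset.sum_pos (fun A _ => by have := hK A; positivity) hne,
    (Finset.lt_inf'_iff hne).2 fun A _ => hε₀ A, fun f hf M hM => ⟨?_, ?_⟩⟩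
  · intro i hi
    rw [iteratedDeriv_tilted_eq_sum β l i hf, Finset.sum_mul]
    refine (norm_sum_le _ _).trans (Finset.sum_le_sum fun A _ => ?_)
    rw [norm_mul, Complex.norm_real, Real.norm_eq_abs, mul_comm]
    refine mul_le_mul ?_ (hM _) (abs_nonneg _) (by have := hK A; positivity)
    have := hK A
    have := norm_nonneg (G 1 A)
    have := norm_nonneg (G 2 A)
    change ‖G i A‖ ≤ _
    simp only [Finset.mem_insert, Finset.mem_singleton] at hi
    rcases hi with rfl | rfl <;> linarith
  · intro n hn a b A₀ hA₀ S ε hS hscale hε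
    have hM0 : 0 ≤ M := (abs_nonneg _).trans (hM fun _ => true)
    have hε0 : 0 ≤ ε := le_trans (by positivity) hscale.1
    have e : (levelMean β n f a b S : ℂ) - (tilted β l f 0 +
        iteratedDeriv 1 (tilted β l f) 0 * profileMoment β n a b S 1 +
        iteratedDeriv 2 (tilted β l f) 0 / 2 * profileMoment β n a b S 2) =
        ∑ A ∈ (box l).powerset, (f (indicatorConfig A) : ℂ) *
          ((levelMean β n (cyl l A) a b S : ℂ) - (tilted β l (cyl l A) 0 +
            G 1 A * profileMoment β n a b S 1 + G 2 A / 2 * profileMoment β n a b S 2)) := by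
      rw [levelMean_eq_sum β l n hf, tilted_eq_sum β l hf, iteratedDeriv_tilted_eq_sum β l 1 hf,
        iteratedDeriv_tilted_eq_sum β l 2 hf]
      push_cast
      simp only [Finset.sum_div, Finset.sum_mul, ← Finset.sum_add_distrib,
        ← Finset.sum_sub_distrib]
      exact Finset.sum_congr rfl fun A _ => by ring
    rw [e, mul_assoc, Finset.sum_mul]
    refine (norm_sum_le _ _).trans (Finset.sum_le_sum fun A hA => ?_)
    rw [norm_mul, Complex.norm_real, Real.norm_eq_abs]
    have h1 := h A n hn a b A₀ hA₀ S ε hS hscale (hε.trans (Finset.inf'_le _ hA))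
    calc |f (indicatorConfig A)| * _ ≤ M * (K A * ε ^ 3) :=
          mul_le_mul (hM _) h1 (norm_nonneg _) hM0
      _ = K A * (M * ε ^ 3) := by ring
      _ ≤ _ := by
        refine mul_le_mul_of_nonneg_right ?_ (by positivity)
        linarith [norm_nonneg (G 1 A), norm_nonneg (G 2 A)]

/-! ### Pointwise estimates -/

/-- The pointwise form of the expansion in terms of `φ_f'` and `φ_f''`. -/
lemma exists_abs_levelMean_sub_le (β : ℝ) (l : ℕ) :
    ∃ C ε₁ : ℝ, 0 < C ∧ 0 < ε₁ ∧ ∀ᶠ n in atTop, ∀ f : Config → ℝ, DependsOn f (box l : Set ℤ) →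
      phi β f (1 / 2) = 0 → ∀ M, (∀ η, |f η| ≤ M) → ∀ a b, ∀ A ⊆ box n, ∀ S ε,
      S = blockSum n (indicatorConfig A) → IsScale β n S ε → ε ≤ ε₁ →
      |levelMean β n f a b S - phi' β f (1 / 2) * (S / vol n)| ≤ C * M * ε ^ 2 ∧
      (phi' β f (1 / 2) = 0 → |levelMean β n f a b S - phi'' β f (1 / 2) / 2 *
        ((S / vol n) ^ 2 - blockVariance β n / vol n)| ≤ C * M * ε ^ 3) := by
  obtain ⟨K, ε₀, hK, hε₀, h⟩ := exists_levelMean_sub_le_mul β l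
  obtain ⟨K', ε₀', hK', hε₀', h'⟩ := exists_profileMoment_sub_le β
  obtain ⟨V, hV, hvar⟩ := eventually_abs_blockVariance_sub_le β
  have hτ := susc_pos β
  have hτc : (susc β : ℂ) ≠ 0 := by exact_mod_cast hτ.ne'
  refine ⟨K * K' + K * (K' + 1 + 1 / susc β) + K + K * V / (2 * susc β ^ 2),
    min (min ε₀ ε₀') 1, by positivity, by positivity, ?_⟩
  filter_upwards [hvar, eventually_ge_atTop l] with n hvar hn f hf hphi M hM a b A hA S ε hS hsc hε
  have hM0 : 0 ≤ M := (abs_nonneg _).trans (hM fun _ => true)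
  obtain ⟨hG, hexp⟩ := h f hf M hM
  have hexp := hexp n hn a b A hA S ε hS hsc (hε.trans ((min_le_left _ _).trans (min_le_left _ _)))
  obtain ⟨-, hR1, hR2⟩ := h' n a b S ε hsc (hε.trans ((min_le_left _ _).trans (min_le_right _ _)))
  have hε1 : ε ≤ 1 := hε.trans (min_le_right _ _)
  have hN := vol_pos n
  have hNc : (vol n : ℂ) ≠ 0 := by exact_mod_cast hN.ne'
  obtain ⟨hs1, hs2, -⟩ := hsc
  have hs0 : 0 < 1 / √(vol n) := by positivity
  have hε0 : 0 ≤ ε := hs0.le.trans hs1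
  have hN2 : 1 / vol n ≤ ε ^ 2 := by
    calc 1 / vol n = (1 / √(vol n)) ^ 2 := by rw [div_pow, one_pow, Real.sq_sqrt hN.le]
      _ ≤ ε ^ 2 := by gcongr
  have hε32 : ε ^ 3 ≤ ε ^ 2 := pow_le_pow_of_le_one hε0 hε1 (by norm_num)
  set G₁ := iteratedDeriv 1 (tilted β l f) 0
  set G₂ := iteratedDeriv 2 (tilted β l f) 0
  have hG₁ : ‖G₁‖ ≤ K * M := hG 1 (by simp)
  have hG₂ : ‖G₂‖ ≤ K * M := hG 2 (by simp)
  have hG₂2 : ‖G₂ / 2‖ ≤ K * M := by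
    rw [norm_div, Complex.norm_ofNat]
    have := norm_nonneg G₂
    linarith
  rw [← phi_half β l hf, hphi, Complex.ofReal_zero, zero_add] at hexp
  set x := saddle β n S with hx
  have hxS : S / vol n = susc β * x := by
    rw [hx, saddle]; field_simp
  set R₁ := profileMoment β n a b S 1
  set R₂ := profileMoment β n a b S 2
  have hKM : 0 ≤ K * M := by positivity
  constructor
  · have e : ((levelMean β n f a b S - phi' β f (1 / 2) * (S / vol n) : ℝ) : ℂ) =
        ((levelMean β n f a b S : ℂ) - (G₁ * R₁ + G₂ / 2 * R₂)) + G₁ * (R₁ - x) + G₂ / 2 * R₂ := by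
      rw [hxS]
      push_cast
      rw [phi'_half β l hf hphi]
      field_simp
      ring
    have hR2' : ‖R₂‖ ≤ (K' + 1 + 1 / susc β) * ε ^ 2 := by
      have e2 : R₂ = (R₂ - ((x : ℂ) ^ 2 - 1 / (vol n * susc β))) +
          ((x ^ 2 - 1 / (vol n * susc β) : ℝ) : ℂ) := by push_cast; ring
      have h3 : ‖((x ^ 2 - 1 / (vol n * susc β) : ℝ) : ℂ)‖ ≤ ε ^ 2 + ε ^ 2 * (1 / susc β) := by
        rw [Complex.norm_real, Real.norm_eq_abs]
        refine (abs_sub _ _).trans (add_le_add ?_ ?_)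
        · rw [abs_pow]
          gcongr
        · rw [abs_of_pos (by positivity), ← one_div_mul_one_div]
          gcongr
      rw [e2]
      refine (norm_add_le _ _).trans ((add_le_add hR2 h3).trans ?_)
      have : K' * ε ^ 3 ≤ K' * ε ^ 2 := by gcongr
      linarith
    rw [← Real.norm_eq_abs, ← Complex.norm_real, e]
    refine (norm_add₃_le).trans ?_
    rw [norm_mul, norm_mul]
    have t1 : ‖G₁‖ * ‖R₁ - x‖ ≤ K * M * (K' * ε ^ 2) :=
      mul_le_mul hG₁ hR1 (norm_nonneg _) hKM
    have t2 : ‖G₂ / 2‖ * ‖R₂‖ ≤ K * M * ((K' + 1 + 1 / susc β) * ε ^ 2) :=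
      mul_le_mul hG₂2 hR2' (norm_nonneg _) hKM
    have t3 : K * M * ε ^ 3 ≤ K * M * ε ^ 2 := by gcongr
    have t4 : 0 ≤ K * V / (2 * susc β ^ 2) * M * ε ^ 2 := by positivity
    linarith
  · intro hphi'
    have hG₁0 : G₁ = 0 := by
      have := phi'_half β l hf hphi
      rw [hphi', Complex.ofReal_zero, eq_comm, div_eq_zero_iff] at this
      exact this.resolve_right hτc
    rw [hG₁0, zero_mul, zero_add] at hexp
    have e : ((levelMean β n f a b S - phi'' β f (1 / 2) / 2 *
        ((S / vol n) ^ 2 - blockVariance β n / vol n) : ℝ) : ℂ) =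
        ((levelMean β n f a b S : ℂ) - G₂ / 2 * R₂) +
        G₂ / 2 * (R₂ - ((x : ℂ) ^ 2 - 1 / (vol n * susc β))) +
        G₂ * (((blockVariance β n - susc β) / (2 * susc β ^ 2 * vol n) : ℝ) : ℂ) := by
      rw [hxS]
      push_cast
      rw [phi''_half β l hf hphi hphi']
      field_simp
      ring
    rw [← Real.norm_eq_abs, ← Complex.norm_real, e]
    refine (norm_add₃_le).trans ?_
    rw [norm_mul, norm_mul]
    have t1 : ‖G₂ / 2‖ * ‖R₂ - ((x : ℂ) ^ 2 - 1 / (vol n * susc β))‖ ≤ K * M * (K' * ε ^ 3) :=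
      mul_le_mul hG₂2 hR2 (norm_nonneg _) hKM
    have t2 : ‖(((blockVariance β n - susc β) / (2 * susc β ^ 2 * vol n) : ℝ) : ℂ)‖ ≤
        V / (2 * susc β ^ 2) * ε ^ 3 := by
      rw [Complex.norm_real, Real.norm_eq_abs, abs_div,
        abs_of_pos (show 0 < 2 * susc β ^ 2 * vol n by positivity)]
      calc |blockVariance β n - susc β| / (2 * susc β ^ 2 * vol n) ≤
            V * (1 / √(vol n)) / (2 * susc β ^ 2 * vol n) := by gcongr
        _ = V / (2 * susc β ^ 2) * ((1 / √(vol n)) * (1 / vol n)) := by field_simp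
        _ ≤ V / (2 * susc β ^ 2) * (ε * ε ^ 2) := by gcongr
        _ = _ := by ring
    have t3 := mul_le_mul hG₂ t2 (norm_nonneg _) hKM
    have t4 : 0 ≤ K * (K' + 1 + 1 / susc β) * M * ε ^ 3 := by positivity
    have t5 : K * M * (V / (2 * susc β ^ 2) * ε ^ 3) = K * V / (2 * susc β ^ 2) * M * ε ^ 3 := by
      ring
    linarith

/-- A bound on `φ_f'`, and on `φ_f''` if `φ_f'` vanishes. -/
lemma exists_abs_phi'_le (β : ℝ) (l : ℕ) :
    ∃ C : ℝ, 0 < C ∧ ∀ f : Config → ℝ, DependsOn f (box l : Set ℤ) →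
      phi β f (1 / 2) = 0 → ∀ M, (∀ η, |f η| ≤ M) →
      |phi' β f (1 / 2)| ≤ C * M ∧ (phi' β f (1 / 2) = 0 → |phi'' β f (1 / 2)| ≤ C * M) := by
  obtain ⟨K, ε₀, hK, hε₀, h⟩ := exists_levelMean_sub_le_mul β l
  have hτ := susc_pos β
  refine ⟨K / susc β + K / susc β ^ 2, by positivity, fun f hf hphi M hM => ?_⟩
  have hM0 : 0 ≤ M := (abs_nonneg _).trans (hM fun _ => true)
  obtain ⟨hG, -⟩ := h f hf M hM
  refine ⟨?_, fun hphi' => ?_⟩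
  · rw [← Real.norm_eq_abs, ← Complex.norm_real, phi'_half β l hf hphi, norm_div,
      Complex.norm_real, Real.norm_of_nonneg hτ.le, div_le_iff₀ hτ]
    refine (hG 1 (by simp)).trans ?_
    have : (K / susc β + K / susc β ^ 2) * M * susc β = K * M + K / susc β ^ 2 * M * susc β := by
      field_simp
    rw [this]
    have : 0 ≤ K / susc β ^ 2 * M * susc β := by positivity
    linarith
  · rw [← Real.norm_eq_abs, ← Complex.norm_real, phi''_half β l hf hphi hphi', norm_div,
      norm_pow, Complex.norm_real, Real.norm_of_nonneg hτ.le, div_le_iff₀ (by positivity)]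
    refine (hG 2 (by simp)).trans ?_
    have : (K / susc β + K / susc β ^ 2) * M * susc β ^ 2 = K * M + K / susc β * M * susc β ^ 2 := by
      field_simp
      ring
    rw [this]
    have : 0 ≤ K / susc β * M * susc β ^ 2 := by positivity
    linarith

end SpeedChange

namespace SpeedChange

/-! ### The bounds in `L⁴` -/

/-- An `L⁴` bound for a bounded function that is small where the total spin is moderate. -/
lemma eLpNorm_four_le (β : ℝ) (n : ℕ) {err : Config → ℝ} {R α M γ : ℝ} (hα : 0 ≤ α) (hγ : 0 ≤ γ)
    (hM : ∀ η, |err η| ≤ M) (herr : ∀ η, |blockSum n η| < R → |err η| ≤ α)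
    (hR : (ising β 0).real {η | R ≤ |blockSum n η|} ≤ γ ^ 4) :
    eLpNorm err 4 (ising β 0) ≤ ENNReal.ofReal (α + M * γ) := by
  have hM0 : 0 ≤ M := (abs_nonneg _).trans (hM fun _ => true)
  have hSm := DependsOn.measurable_of_box (dependsOn_blockSum n)
  set B : Set Config := {η | R ≤ |blockSum n η|} with hB
  have hBm : MeasurableSet B := measurableSet_le measurable_const hSm.abs
  have h1 : eLpNorm err 4 (ising β 0) ≤
      eLpNorm ((fun _ => α) + B.indicator fun _ => M) 4 (ising β 0) := by
    refine eLpNorm_mono_real fun η => ?_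
    rw [Real.norm_eq_abs, Pi.add_apply]
    by_cases h : η ∈ B
    · rw [Set.indicator_of_mem h]
      linarith [hM η]
    · rw [Set.indicator_of_notMem h, add_zero]
      exact herr η (not_le.1 h)
  have h2 : eLpNorm (fun _ : Config => α) 4 (ising β 0) = ENNReal.ofReal α := by
    rw [eLpNorm_const α (by norm_num) (IsProbabilityMeasure.ne_zero _), measure_univ,
      ENNReal.one_rpow, mul_one, Real.enorm_of_nonneg hα]
  have h3 : eLpNorm (B.indicator fun _ => M) 4 (ising β 0) ≤ ENNReal.ofReal (M * γ) := by
    rw [eLpNorm_indicator_const hBm (by norm_num) (by norm_num), Real.enorm_of_nonneg hM0,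
      ENNReal.ofReal_mul hM0]
    gcongr
    have h4 : (ising β 0) B ≤ ENNReal.ofReal γ ^ (4 : ℝ) := by
      rw [ENNReal.ofReal_rpow_of_nonneg hγ (by norm_num), ← ofReal_measureReal]
      exact ENNReal.ofReal_le_ofReal (hR.trans (by norm_cast))
    calc (ising β 0) B ^ (1 / (4 : ℝ≥0∞).toReal) ≤
          (ENNReal.ofReal γ ^ (4 : ℝ)) ^ (1 / (4 : ℝ≥0∞).toReal) := by gcongr
      _ = ENNReal.ofReal γ := by rw [← ENNReal.rpow_mul]; norm_num
  calc eLpNorm err 4 (ising β 0) ≤ _ := h1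
    _ ≤ eLpNorm (fun _ : Config => α) 4 (ising β 0) +
        eLpNorm (B.indicator fun _ => M) 4 (ising β 0) :=
      eLpNorm_add_le aestronglyMeasurable_const
        (aestronglyMeasurable_const.indicator hBm) (by norm_num)
    _ ≤ ENNReal.ofReal α + ENNReal.ofReal (M * γ) := by rw [h2]; gcongr
    _ = ENNReal.ofReal (α + M * γ) := (ENNReal.ofReal_add hα (by positivity)).symm

/-- Deviations of the block sum beyond `N^{1/2+δ}` are negligible. -/
lemma exists_measureReal_blockSum_ge_le (β : ℝ) {δ : ℝ} (hδ : 0 < δ) :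
    ∃ C : ℝ, 0 < C ∧ ∀ᶠ n : ℕ in atTop,
      (ising β 0).real {η | vol n ^ (1 / 2 + δ) ≤ |blockSum n η|} ≤
        (C * vol n ^ (-(3 / 2) : ℝ)) ^ 4 := by
  obtain ⟨C, hC, h⟩ := eventually_measureReal_blockSum_ge_le β
  have h1 : Tendsto (fun n => (vol n ^ δ) ^ (6 / δ) * Real.exp (-1 * vol n ^ δ)) atTop (𝓝 0) :=
    (tendsto_rpow_mul_exp_neg_mul_atTop_nhds_zero (6 / δ) 1 one_pos).comp
      ((tendsto_rpow_atTop hδ).comp tendsto_vol)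
  refine ⟨C + 1, by positivity, ?_⟩
  filter_upwards [h, h1.eventually_le_const one_pos] with n hn hn1
  have hN := vol_pos n
  have e1 : vol n ^ (1 / 2 + δ) / √(vol n) = vol n ^ δ := by
    rw [Real.rpow_add hN, ← Real.sqrt_eq_rpow, mul_div_cancel_left₀ _ (Real.sqrt_pos.2 hN).ne']
  have hn2 := hn (vol n ^ (1 / 2 + δ))
  rw [e1] at hn2
  rw [← Real.rpow_mul hN.le, mul_div_cancel₀ _ hδ.ne', neg_one_mul] at hn1
  have e2 : (vol n ^ (-(3 / 2) : ℝ)) ^ 4 = (vol n ^ (6 : ℝ))⁻¹ := by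
    rw [← Real.rpow_natCast, ← Real.rpow_mul hN.le, ← Real.rpow_neg hN.le]
    norm_num
  have h6 : 0 < vol n ^ (6 : ℝ) := by positivity
  have h3 : Real.exp (-vol n ^ δ) ≤ (vol n ^ (6 : ℝ))⁻¹ := by
    rw [← one_div, le_div_iff₀ h6, mul_comm]
    exact hn1
  rw [mul_pow, e2]
  refine hn2.trans (mul_le_mul ?_ h3 (Real.exp_pos _).le (by positivity))
  calc C ≤ C + 1 := by linarith
    _ ≤ (C + 1) ^ 4 := le_self_pow₀ (by linarith) (by norm_num)

/-- Moderate values of the total spin lie in the range of the saddle point expansion. -/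
lemma isScale_of_abs_lt (β : ℝ) {δ : ℝ} (hδ : 0 < δ) (n : ℕ) {S : ℝ}
    (hS : |S| < vol n ^ (1 / 2 + δ)) :
    IsScale β n S ((1 + 1 / susc β + 1 / susc β ^ 3) * vol n ^ (-(1 / 2) + 3 * δ)) := by
  have hN := vol_pos n
  have hN1 := one_le_vol n
  have hτ := susc_pos β
  set A : ℝ := 1 + 1 / susc β + 1 / susc β ^ 3 with hA
  have hA1 : 1 ≤ A := by
    have : 0 ≤ 1 / susc β := by positivity
    have : 0 ≤ 1 / susc β ^ 3 := by positivity
    linarith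
  have hA2 : 1 / susc β ≤ A := by
    have : 0 ≤ 1 / susc β ^ 3 := by positivity
    linarith
  have hA3 : 1 / susc β ^ 3 ≤ A := by
    have : 0 ≤ 1 / susc β := by positivity
    linarith
  have hx : |saddle β n S| ≤ 1 / susc β * vol n ^ (-(1 / 2) + δ) := by
    rw [saddle, abs_div, abs_of_pos (by positivity : 0 < susc β * vol n)]
    have e : vol n ^ (1 / 2 + δ) = vol n * vol n ^ (-(1 / 2) + δ) := by
      nth_rewrite 2 [← Real.rpow_one (vol n)]
      rw [← Real.rpow_add hN]
      congr 1; ring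
    rw [div_le_iff₀ (by positivity)]
    calc |S| ≤ vol n * vol n ^ (-(1 / 2) + δ) := by rw [← e]; exact hS.le
      _ = _ := by field_simp
  refine ⟨?_, ?_, ?_⟩
  · calc 1 / √(vol n) = 1 * vol n ^ (-(1 / 2) : ℝ) := by
          rw [Real.sqrt_eq_rpow, Real.rpow_neg hN.le, one_mul, one_div]
      _ ≤ A * vol n ^ (-(1 / 2) + 3 * δ) := by
          gcongr
          linarith
  · calc |saddle β n S| ≤ 1 / susc β * vol n ^ (-(1 / 2) + δ) := hx
      _ ≤ A * vol n ^ (-(1 / 2) + 3 * δ) := by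
          gcongr
          linarith
  · calc vol n * |saddle β n S| ^ 3 ≤ vol n * (1 / susc β * vol n ^ (-(1 / 2) + δ)) ^ 3 := by
          gcongr
      _ = 1 / susc β ^ 3 * vol n ^ (-(1 / 2) + 3 * δ) := by
          have e : vol n * (vol n ^ (-(1 / 2) + δ)) ^ 3 = vol n ^ (-(1 / 2) + 3 * δ) := by
            nth_rewrite 1 [← Real.rpow_one (vol n)]
            rw [← Real.rpow_natCast, ← Real.rpow_mul hN.le, ← Real.rpow_add hN]
            congr 1; push_cast; ring
          rw [mul_pow, ← e]
          ring
      _ ≤ _ := by gcongr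

lemma abs_blockDensity_sub_half_le (n : ℕ) (η : Config) : |blockDensity n η - 1 / 2| ≤ 1 / 2 := by
  have hN := vol_pos n
  rw [blockDensity_sub_half, abs_div, abs_of_pos hN, div_le_iff₀ hN]
  calc |blockSum n η| ≤ ∑ x ∈ box n, |occ η x - 1 / 2| := Finset.abs_sum_le_sum_abs _ _
    _ ≤ ∑ x ∈ box n, 1 / 2 := Finset.sum_le_sum fun x _ => by
        rw [occ_sub_half, spin]; split_ifs <;> norm_num
    _ = 1 / 2 * vol n := by rw [Finset.sum_const, nsmul_eq_mul, card_box]; ring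

lemma blockVariance_nonneg (β : ℝ) (n : ℕ) : 0 ≤ blockVariance β n :=
  integral_nonneg fun _ => sq_nonneg _

lemma blockVariance_div_vol_le (β : ℝ) (n : ℕ) : blockVariance β n / vol n ≤ 1 := by
  have hN := vol_pos n
  rw [div_le_one hN, blockVariance]
  have hle : ∀ η : Config, ((∑ x ∈ box n, (occ η x - 1 / 2)) / √(2 * (n : ℝ) + 1)) ^ 2 ≤ vol n := by
    intro η
    have h := abs_blockDensity_sub_half_le n η
    rw [blockDensity_sub_half, abs_div, abs_of_pos hN, div_le_iff₀ hN] at h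
    change (blockSum n η / √(vol n)) ^ 2 ≤ vol n
    rw [div_pow, Real.sq_sqrt hN.le, div_le_iff₀ hN, ← sq_abs]
    nlinarith [abs_nonneg (blockSum n η)]
  have := norm_integral_le_of_norm_le_const (μ := ising β 0) (C := vol n)
    (f := fun η : Config => ((∑ x ∈ box n, (occ η x - 1 / 2)) / √(2 * (n : ℝ) + 1)) ^ 2)
    (Eventually.of_forall fun η => by
      rw [Real.norm_of_nonneg (sq_nonneg _)]; exact hle η)
  simp only [probReal_univ, mul_one] at this
  exact (Real.le_norm_self _).trans this

/-- The estimates for any version `g` of the conditional expectation of `f` given the total spin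
and the boundary values. For blocks that do not contain the support of `f`, only `|g| ≤ M` is
required. -/
lemma exists_eLpNorm_sub_le (β : ℝ) {ε : ℝ} (hε₀ : 0 < ε) (hε₁ : ε < 1) (l : ℕ) :
    ∃ C : ℝ, 0 < C ∧ ∀ f : Config → ℝ, DependsOn f (box l : Set ℤ) → phi β f (1 / 2) = 0 →
      ∀ M, (∀ η, |f η| ≤ M) → ∀ n : ℕ, 1 ≤ n → ∀ g : Config → ℝ, (∀ η, |g η| ≤ M) →
      (l ≤ n → ∀ η, ∃ a b, g η = levelMean β n f a b (blockSum n η)) →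
      (phi' β f (1 / 2) = 0 →
        eLpNorm (fun η => g η - phi'' β f (1 / 2) / 2 *
            ((blockDensity n η - 1 / 2) ^ 2 - blockVariance β n / (2 * (n : ℝ) + 1))) 4 (ising β 0)
          ≤ ENNReal.ofReal (C * M / (n : ℝ) ^ (3 / 2 - ε))) ∧
      eLpNorm (fun η => g η - phi' β f (1 / 2) * (blockDensity n η - 1 / 2)) 4 (ising β 0)
          ≤ ENNReal.ofReal (C * M / (n : ℝ) ^ (1 - ε)) := by
  obtain ⟨C₁, ε₁, hC₁, hε₁', hpt⟩ := exists_abs_levelMean_sub_le β l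
  obtain ⟨C₂, hC₂, hphi_le⟩ := exists_abs_phi'_le β l
  set δ : ℝ := ε / 9 with hδ
  have hδ0 : 0 < δ := by positivity
  obtain ⟨C₃, hC₃, htail⟩ := exists_measureReal_blockSum_ge_le β hδ0
  set A : ℝ := 1 + 1 / susc β + 1 / susc β ^ 3 with hA
  have hτ := susc_pos β
  have hA0 : 0 < A := by positivity
  have hscale : Tendsto (fun n => A * vol n ^ (-(1 / 2) + 3 * δ)) atTop (𝓝 0) := by
    have h := (tendsto_rpow_neg_atTop (y := 1 / 2 - 3 * δ) (by rw [hδ]; linarith)).comp tendsto_vol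
    have h2 := h.const_mul A
    rw [mul_zero] at h2
    refine h2.congr fun n => ?_
    simp only [Function.comp_apply]
    congr 2; ring
  obtain ⟨n₀, hn₀⟩ := eventually_atTop.1
    (hpt.and (htail.and ((hscale.eventually_le_const hε₁').and (eventually_ge_atTop l))))
  set n₁ : ℕ := n₀ + 1 with hn₁
  have hn₁0 : (1 : ℝ) ≤ n₁ := by rw [hn₁]; push_cast; linarith [n₀.cast_nonneg (α := ℝ)]
  -- the crude bound on the error
  set E : ℝ := 1 + C₂ with hE
  have hE0 : 0 < E := by positivity
  refine ⟨C₁ * A ^ 3 + C₁ * A ^ 2 + E * C₃ + E * (n₁ : ℝ) ^ (3 / 2 : ℝ), by positivity,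
    fun f hf hphi M hM n hn g hg hgl => ?_⟩
  have hM0 : 0 ≤ M := (abs_nonneg _).trans (hM fun _ => true)
  obtain ⟨hp', hp''⟩ := hphi_le f hf hphi M hM
  have hv : (2 * (n : ℝ) + 1) = vol n := rfl
  have hN := vol_pos n
  have hn0 : (0 : ℝ) < n := by exact_mod_cast hn
  have hn1 : (1 : ℝ) ≤ n := by exact_mod_cast hn
  have hnN : (n : ℝ) ≤ vol n := by unfold vol; linarith
  have crude₁ : phi' β f (1 / 2) = 0 → ∀ η, |g η - phi'' β f (1 / 2) / 2 *
      ((blockDensity n η - 1 / 2) ^ 2 - blockVariance β n / (2 * (n : ℝ) + 1))| ≤ E * M := by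
    intro h0 η
    have h1 := abs_blockDensity_sub_half_le n η
    have h2 := blockVariance_div_vol_le β n
    have h3 : 0 ≤ blockVariance β n / vol n := div_nonneg (blockVariance_nonneg β n) hN.le
    have h4 : (blockDensity n η - 1 / 2) ^ 2 ≤ 1 := by
      rw [← sq_abs]; nlinarith [abs_nonneg (blockDensity n η - 1 / 2)]
    rw [hv]
    refine (abs_sub _ _).trans ?_
    rw [abs_mul, abs_div, abs_two, hE, add_mul, one_mul]
    refine add_le_add (hg η) ?_
    have h5 : |(blockDensity n η - 1 / 2) ^ 2 - blockVariance β n / vol n| ≤ 1 := by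
      rw [abs_le]; constructor <;> nlinarith [sq_nonneg (blockDensity n η - 1 / 2)]
    have h6 : |phi'' β f (1 / 2)| / 2 ≤ C₂ * M := by
      have := hp'' h0
      linarith [abs_nonneg (phi'' β f (1 / 2))]
    calc _ ≤ C₂ * M * 1 := mul_le_mul h6 h5 (abs_nonneg _) (by positivity)
      _ = C₂ * M := mul_one _
  have crude₂ : ∀ η, |g η - phi' β f (1 / 2) * (blockDensity n η - 1 / 2)| ≤ E * M := by
    intro η
    have h1 := abs_blockDensity_sub_half_le n η
    refine (abs_sub _ _).trans ?_
    rw [abs_mul, hE, add_mul, one_mul]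
    refine add_le_add (hg η) ?_
    calc _ ≤ C₂ * M * 1 := mul_le_mul hp' (h1.trans (by norm_num)) (abs_nonneg _) (by positivity)
      _ = C₂ * M := mul_one _
  rcases lt_or_ge n n₁ with hlt | hge
  · -- small blocks
    have hnn : (n : ℝ) ≤ n₁ := by exact_mod_cast hlt.le
    have hbound : ∀ err : Config → ℝ, (∀ η, |err η| ≤ E * M) → ∀ s : ℝ, s ≤ 3 / 2 → 0 ≤ s →
        eLpNorm err 4 (ising β 0) ≤ ENNReal.ofReal ((C₁ * A ^ 3 + C₁ * A ^ 2 + E * C₃ +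
          E * (n₁ : ℝ) ^ (3 / 2 : ℝ)) * M / (n : ℝ) ^ s) := by
      intro err herr s hs hs0
      have h1 := eLpNorm_four_le β n (R := -1) (α := 0) (γ := 1) le_rfl zero_le_one herr
        (fun η hη => absurd hη (not_lt.2 ((by norm_num : (-1 : ℝ) ≤ 0).trans (abs_nonneg _))))
        (by rw [one_pow]; exact measureReal_le_one)
      refine h1.trans (ENNReal.ofReal_le_ofReal ?_)
      rw [zero_add, mul_one, le_div_iff₀ (by positivity)]
      have h2 : (n : ℝ) ^ s ≤ (n₁ : ℝ) ^ (3 / 2 : ℝ) :=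
        (Real.rpow_le_rpow hn0.le hnn hs0).trans (Real.rpow_le_rpow_of_exponent_le hn₁0 hs)
      calc E * M * (n : ℝ) ^ s ≤ E * M * (n₁ : ℝ) ^ (3 / 2 : ℝ) := by gcongr
        _ = E * (n₁ : ℝ) ^ (3 / 2 : ℝ) * M := by ring
        _ ≤ _ := by
          gcongr
          have : 0 ≤ C₁ * A ^ 3 + C₁ * A ^ 2 + E * C₃ := by positivity
          linarith
    exact ⟨fun h0 => hbound _ (crude₁ h0) _ (by linarith) (by linarith),
      hbound _ crude₂ _ (by linarith) (by linarith)⟩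
  · obtain ⟨hpt, htail, hsc, hln⟩ := hn₀ n (by omega)
    have hpt' : ∀ η, |blockSum n η| < vol n ^ (1 / 2 + δ) → ∃ a b,
        g η = levelMean β n f a b (blockSum n η) ∧
        |levelMean β n f a b (blockSum n η) - phi' β f (1 / 2) * (blockSum n η / vol n)| ≤
          C₁ * M * (A * vol n ^ (-(1 / 2) + 3 * δ)) ^ 2 ∧
        (phi' β f (1 / 2) = 0 → |levelMean β n f a b (blockSum n η) - phi'' β f (1 / 2) / 2 *
          ((blockSum n η / vol n) ^ 2 - blockVariance β n / vol n)| ≤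
            C₁ * M * (A * vol n ^ (-(1 / 2) + 3 * δ)) ^ 3) := by
      intro η hη
      obtain ⟨a, b, hab⟩ := hgl hln η
      exact ⟨a, b, hab, hpt f hf hphi M hM a b _ (occupied_subset n η) _ _
        (blockSum_occupied n η).symm (isScale_of_abs_lt β hδ0 n hη) hsc⟩
    have hpow : ∀ (k : ℕ) (s : ℝ), k * (-(1 / 2) + 3 * δ) ≤ -s → 0 ≤ s →
        (A * vol n ^ (-(1 / 2) + 3 * δ)) ^ k ≤ A ^ k / (n : ℝ) ^ s := by
      intro k s hk hs
      have e : A ^ k / (n : ℝ) ^ s = A ^ k * (n : ℝ) ^ (-s) := by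
        rw [Real.rpow_neg hn0.le, ← div_eq_mul_inv]
      rw [e, mul_pow, ← Real.rpow_natCast (vol n ^ _), ← Real.rpow_mul hN.le, mul_comm _ (k : ℝ)]
      refine mul_le_mul_of_nonneg_left ?_ (by positivity)
      calc vol n ^ (k * (-(1 / 2) + 3 * δ)) ≤ vol n ^ (-s) :=
            Real.rpow_le_rpow_of_exponent_le (one_le_vol n) hk
        _ ≤ (n : ℝ) ^ (-s) := Real.rpow_le_rpow_of_nonpos hn0 hnN (by linarith)
    have htl : ∀ s : ℝ, 0 ≤ s → s ≤ 3 / 2 → vol n ^ (-(3 / 2) : ℝ) ≤ 1 / (n : ℝ) ^ s := by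
      intro s hs hs'
      rw [one_div, ← Real.rpow_neg hn0.le]
      calc vol n ^ (-(3 / 2) : ℝ) ≤ (n : ℝ) ^ (-(3 / 2) : ℝ) :=
            Real.rpow_le_rpow_of_nonpos hn0 hnN (by norm_num)
        _ ≤ (n : ℝ) ^ (-s) := Real.rpow_le_rpow_of_exponent_le hn1 (by linarith)
    have hbound : ∀ err : Config → ℝ, (∀ η, |err η| ≤ E * M) → ∀ (k : ℕ) (s : ℝ),
        (k = 2 ∨ k = 3) → s ≤ 3 / 2 → 0 ≤ s → k * (-(1 / 2) + 3 * δ) ≤ -s →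
        (∀ η, |blockSum n η| < vol n ^ (1 / 2 + δ) → |err η| ≤
          C₁ * M * (A * vol n ^ (-(1 / 2) + 3 * δ)) ^ k) →
        eLpNorm err 4 (ising β 0) ≤ ENNReal.ofReal ((C₁ * A ^ 3 + C₁ * A ^ 2 + E * C₃ +
          E * (n₁ : ℝ) ^ (3 / 2 : ℝ)) * M / (n : ℝ) ^ s) := by
      intro err hcrude k s hk hs hs0 hks herr
      have h1 := eLpNorm_four_le β n (by positivity) (by positivity) hcrude herr htail
      refine h1.trans (ENNReal.ofReal_le_ofReal ?_)
      have hns : 0 < (n : ℝ) ^ s := by positivity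
      have hAk : A ^ k ≤ A ^ 3 + A ^ 2 := by
        have : 0 < A ^ 2 := by positivity
        have : 0 < A ^ 3 := by positivity
        rcases hk with rfl | rfl <;> linarith
      calc C₁ * M * (A * vol n ^ (-(1 / 2) + 3 * δ)) ^ k +
            E * M * (C₃ * vol n ^ (-(3 / 2) : ℝ)) ≤
            C₁ * M * ((A ^ 3 + A ^ 2) / (n : ℝ) ^ s) + E * M * (C₃ * (1 / (n : ℝ) ^ s)) := by
            gcongr
            · exact (hpow k s hks hs0).trans (by gcongr)
            · exact htl s hs0 hs
        _ = (C₁ * A ^ 3 + C₁ * A ^ 2 + E * C₃) * M / (n : ℝ) ^ s := by field_simp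
        _ ≤ _ := by
          refine div_le_div_of_nonneg_right (mul_le_mul_of_nonneg_right ?_ hM0) hns.le
          exact le_add_of_nonneg_right (by positivity)
    refine ⟨fun h0 => hbound _ (crude₁ h0) 3 _ (Or.inr rfl) (by linarith) (by linarith)
      (by rw [hδ]; push_cast; linarith) fun η hη => ?_,
      hbound _ crude₂ 2 _ (Or.inl rfl) (by linarith) (by linarith)
      (by rw [hδ]; push_cast; linarith) fun η hη => ?_⟩
    · obtain ⟨a, b, hab, -, h3⟩ := hpt' η hη
      rw [hab, hv, blockDensity_sub_half]
      exact h3 h0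
    · obtain ⟨a, b, hab, h2, -⟩ := hpt' η hη
      rw [hab, blockDensity_sub_half]
      exact h2

end SpeedChange

namespace SpeedChange

lemma abs_blockCondExp_le (β : ℝ) {f : Config → ℝ} {M : ℝ} (hM : ∀ η, |f η| ≤ M) (n : ℕ)
    (a b : Bool) (y : ℝ) : |blockCondExp β f n a b y| ≤ M := by
  have hM0 : 0 ≤ M := (abs_nonneg _).trans (hM fun _ => true)
  unfold blockCondExp
  set μ := ProbabilityTheory.cond (ising β 0)
    {η | blockDensity n η - 1 / 2 = y ∧ η (-(n : ℤ) - 1) = a ∧ η ((n : ℤ) + 1) = b}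
  have h := norm_integral_le_of_norm_le_const (μ := μ) (f := f) (C := M) (Eventually.of_forall hM)
  have hμ : μ.real Set.univ ≤ 1 := by
    by_cases h0 : ising β 0
        {η | blockDensity n η - 1 / 2 = y ∧ η (-(n : ℤ) - 1) = a ∧ η ((n : ℤ) + 1) = b} = 0
    · simp [μ, ProbabilityTheory.cond_eq_zero_of_meas_eq_zero h0]
    · have : IsProbabilityMeasure μ := ProbabilityTheory.cond_isProbabilityMeasure h0
      exact measureReal_le_one
  rw [← Real.norm_eq_abs]
  exact h.trans (mul_le_of_le_one_right hM0 hμ)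

lemma ofReal_mul_toReal_div (C K r : ℝ) {x : ℝ≥0∞} (hx : x ≠ ∞) :
    ENNReal.ofReal (C * (K * x.toReal) / r) = ENNReal.ofReal (C * K / r) * x := by
  rw [show C * (K * x.toReal) / r = C * K / r * x.toReal by ring,
    ENNReal.ofReal_mul' ENNReal.toReal_nonneg, ENNReal.ofReal_toReal hx]

end SpeedChange


theorem proposition5p2 (β ε : ℝ) (hε₀ : 0 < ε) (hε₁ : ε < 1) :
    (∀ l : ℕ, ∃ C : ℝ, ∀ f : SpeedChange.Config → ℝ, DependsOn f (SpeedChange.box l : Set ℤ) →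
      SpeedChange.phi β f (1 / 2) = 0 → SpeedChange.phi' β f (1 / 2) = 0 →
      ∀ (a b : Bool) (n : ℕ), 1 ≤ n →
        eLpNorm (fun η => SpeedChange.blockCondExp β f n a b (SpeedChange.blockDensity n η - 1 / 2)
            - SpeedChange.phi'' β f (1 / 2) / 2 *
              ((SpeedChange.blockDensity n η - 1 / 2) ^ 2
                - SpeedChange.blockVariance β n / (2 * (n : ℝ) + 1))) 4 (SpeedChange.ising β 0)
          ≤ ENNReal.ofReal (C / (n : ℝ) ^ (3 / 2 - ε)) * eLpNorm f ∞ (SpeedChange.ising β 0)) ∧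
    (∀ l : ℕ, ∃ C : ℝ, ∀ f : SpeedChange.Config → ℝ, DependsOn f (SpeedChange.box l : Set ℤ) →
      SpeedChange.phi β f (1 / 2) = 0 →
      ∀ (a b : Bool) (n : ℕ), 1 ≤ n →
        eLpNorm (fun η => SpeedChange.blockCondExp β f n a b (SpeedChange.blockDensity n η - 1 / 2)
            - (SpeedChange.blockDensity n η - 1 / 2) * SpeedChange.phi' β f (1 / 2)) 4
            (SpeedChange.ising β 0)
          ≤ ENNReal.ofReal (C / (n : ℝ) ^ (1 - ε)) * eLpNorm f ∞ (SpeedChange.ising β 0)) ∧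
    SpeedChange.EquivalenceOfEnsembles β (1 - ε) := by
  refine ⟨fun l => ?_, fun l => ?_, fun l => ?_⟩
  · obtain ⟨C, -, h⟩ := SpeedChange.exists_eLpNorm_sub_le β hε₀ hε₁ l
    obtain ⟨K, -, hK⟩ := SpeedChange.exists_abs_le_mul_eLpNorm β l
    refine ⟨C * K, fun f hf hphi hphi' a b n hn => ?_⟩
    obtain ⟨hfin, hM⟩ := hK f hf ∞ le_top
    rw [← SpeedChange.ofReal_mul_toReal_div C K _ hfin]
    exact (h f hf hphi _ hM n hn _ (fun η => SpeedChange.abs_blockCondExp_le β hM n a b _)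
      fun hl η => ⟨a, b, SpeedChange.blockCondExp_eq_levelMean β
        (SpeedChange.DependsOn.mono_box hf hl) a b η⟩).1 hphi'
  · obtain ⟨C, -, h⟩ := SpeedChange.exists_eLpNorm_sub_le β hε₀ hε₁ l
    obtain ⟨K, -, hK⟩ := SpeedChange.exists_abs_le_mul_eLpNorm β l
    refine ⟨C * K, fun f hf hphi a b n hn => ?_⟩
    obtain ⟨hfin, hM⟩ := hK f hf ∞ le_top
    rw [← SpeedChange.ofReal_mul_toReal_div C K _ hfin]
    simp only [mul_comm _ (SpeedChange.phi' β f (1 / 2))]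
    exact (h f hf hphi _ hM n hn _ (fun η => SpeedChange.abs_blockCondExp_le β hM n a b _)
      fun hl η => ⟨a, b, SpeedChange.blockCondExp_eq_levelMean β
        (SpeedChange.DependsOn.mono_box hf hl) a b η⟩).2
  · -- with `α₀ = 1 - ε` the exponents are those of the first two parts at `ε / 2`
    obtain ⟨C, -, h⟩ := SpeedChange.exists_eLpNorm_sub_le β (half_pos hε₀)
      ((half_lt_self hε₀).trans hε₁) l
    obtain ⟨K, -, hK⟩ := SpeedChange.exists_abs_le_mul_eLpNorm β l
    refine ⟨C * K, fun f hf hphi n hn hl => ?_⟩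
    obtain ⟨hfin, hM⟩ := hK f hf 5 (by norm_num)
    rw [← SpeedChange.ofReal_mul_toReal_div C K _ hfin,
      ← SpeedChange.ofReal_mul_toReal_div C K _ hfin,
      show 1 + (1 - ε) / 2 = 3 / 2 - ε / 2 by ring, show 1 / 2 + (1 - ε) / 2 = 1 - ε / 2 by ring]
    have hae := SpeedChange.condExp_blockAlg_ae_eq β (SpeedChange.DependsOn.mono_box hf hl) hM
    have hg := h f hf hphi _ hM n hn (fun η => SpeedChange.levelMean β n f (η (-(n : ℤ) - 1))
      (η ((n : ℤ) + 1)) (SpeedChange.blockSum n η))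
      (fun η => SpeedChange.abs_levelMean_le β n hM _ _ _) fun _ η => ⟨_, _, rfl⟩
    refine ⟨fun hphi' => le_trans (le_of_eq (eLpNorm_congr_ae ?_)) (hg.1 hphi'),
      le_trans (le_of_eq (eLpNorm_congr_ae ?_)) hg.2⟩
    · filter_upwards [hae] with η hη
      rw [hη]
    · filter_upwards [hae] with η hη
      rw [hη]
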